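/- **Setting.** Let $\Lambda=(-\pi,\pi)\setminus\{0\}$ and, for $n\in\mathbb N$ and an integrable symmetric function $f$ on $\Lambda$, let $T_n(f)=\bigl(\int_{-\pi}^{\pi}e^{i(k-j)\lambda}f(\lambda)\,d\lambda\bigr)_{k,j=1}^n$. For $c>0$, $\alpha\in\mathbb R$ and $L:(0,\infty)\to(0,\infty)$, let $\Gamma_1(c,\alpha,L)$ be the set of symmetric integrable functions $h\in C^1(\Lambda)$ with $|h(\lambda)|+|\lambda h'(\lambda)|\le c|\lambda|^{-\alpha-\epsilon}L(\epsilon)$ for all $\lambda\in\Lambda$ and $\epsilon>0$. Write $h\in\bigoplus_{i=1}^m\bigcap_{k=1}^q\Gamma_1(c_{i,k},\alpha_{i,k},L)$ if $h=\sum_{i=1}^m h_i$ on $\Lambda$ with $h_i\in\Gamma_1(c_{i,k},\alpha_{i,k},L)$ for all $i,k$. Put $x_+=\max(x,0)$ and $x\vee y=\max(x,y)$. **Theorem.** Let $m,p,q\ge1$, $L:(0,\infty)\to(0,\infty)$ and $\eta\in(0,1)$. There exists a constant $K=K(\epsilon,L,m,p,q,\eta,\boldsymbol\alpha)$, defined for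 $\epsilon>0$ and $\boldsymbol\alpha=(\alpha_{i,k},\overline\alpha_{i,k},\beta_{i,k})_{i\le m,k\le q}\in\mathbb R^{3mq}$, such that (a) for every compact set $S\subset\mathbb R^{3mq}$ there is $\epsilon_0>0$ with $\sup_{\boldsymbol\alpha\in S}K(\epsilon,\ldots,\boldsymbol\alpha)<\infty$ for all $\epsilon\in(0,\epsilon_0]$; (b) the following holds for all $\epsilon>0$ and $n\ge1$, all $c_{i,k},\overline c_{i,k},d_{i,k}>0$, all $\alpha_{i,k},\overline\alpha_{i,k},\beta_{i,k}\in\mathbb R$ with $\min_k\alpha_{i,k}<1$ and $\min_k\beta_{i,k}<1$ for all $i$, all index maps $i',i^\ast,i^\star:\{1,\dots,m\}\times\{1,\dots,q\}\to\{1,\dots,m\}$ and $k',k^\ast,k^\star:\{1,\dots,m\}\times\{1,\dots,q\}\to\{1,\dots,q\}$, and all functions $f_l>0$ and $g_l$ on $\Lambda$ ($l=1,\dots,p$). Below, $i',k',i^\ast,k^\ast,i^\star,k^\star$ are evaluated at $(i,k)$ (under $\max_k$, $\min_k$ and $\sum_k$, at the running index $k$). Let $\alpha'_i=\max_k\overline\alpha_{i',k}\mathbf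 1_{\{\overline\alpha_{i',k}<1\}}$. Suppose that, for all $l$, $$f_l\in\bigoplus_{i=1}^m\bigcap_{k=1}^q\Gamma_1(c_{i,k},\alpha_{i,k},L),\quad \frac1{f_l}\in\bigoplus_{k=1}^q\bigcap_{i=1}^m\Gamma_1(1/\overline c_{i,k},-\overline\alpha_{i,k},L),\quad g_l\in\bigoplus_{i=1}^m\bigcap_{k=1}^q\Gamma_1(d_{i,k},\beta_{i,k},L),$$ and that, for all $i$ and $k$, $$\max_k(\beta_{i,k'}-\overline\alpha_{i',k})_++\min_k\overline\alpha_{i',k}<1-\eta,\quad \beta_{i,k'}-\overline\alpha_{i',k}<1-\eta,$$ $$p(\beta_{i,k^\ast}-\overline\alpha_{i^\ast,k})_+<1-\eta,\quad p(\alpha_{i,k^\star}-\overline\alpha_{i^\star,k})_+<1-\eta,$$ $$\beta_{i,k^\ast}<1-\eta,\quad\alpha_{i,k^\star}<1-\eta,\quad\overline\alpha_{i^\ast,k}>-1+\eta,\quad\overline\alpha_{i^\star,k}>-1+\eta,\quad\alpha'_i<1-\eta.$$ Then every $T_n(f_l)$ is invertible, $\prod_{l}g_l/f_l$ is integrable on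 $(-\pi,\pi)$, and $$\left|\frac1n\operatorname{tr}\Bigl(\prod_{l=1}^pT_n(g_l)T_n(f_l)^{-1}\Bigr)-\frac1{2\pi}\int_{-\pi}^{\pi}\prod_{l=1}^p\frac{g_l(\lambda)}{f_l(\lambda)}\,d\lambda\right|\le\frac Kn\,\delta_n^\star\bigl[(\delta_n^\ast)^p+(\delta_n^\star\delta_n)^p\bigr],$$ where $$\delta_n=\sum_{i=1}^m\sum_{k=1}^q\frac{d_{i,k'}}{\overline c_{i',k}}(R_{i,k}n)^{\frac{(\beta_{i,k'}-\overline\alpha_{i',k})_+}{1-(\alpha'_i)_+}+\epsilon},\qquad \delta_n^\ast=\sum_{i=1}^m\sum_{k=1}^q\frac{d_{i,k^\ast}}{\overline c_{i^\ast,k}}n^{(\beta_{i,k^\ast}-\overline\alpha_{i^\ast,k})_++\epsilon},$$ $$\delta_n^\star=1\vee\sum_{i=1}^m\sum_{k=1}^q\frac{c_{i,k^\star}}{\overline c_{i^\star,k}}n^{(\alpha_{i,k^\star}-\overline\alpha_{i^\star,k})_++\epsilon},$$ and, with $i'_1=i'(i,k_1)$ and $i'_2=i'(i,k_2)$, $R_{i,k}=1\vee\max_{k_1}\min_{k_2}\overline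 c_{i'_2,k_2}/\overline c_{i'_1,k_1}$ if $\beta_{i,k'}-\overline\alpha_{i',k}+\eta\ge0$ and $R_{i,k}=1$ otherwise; here the maximum is over all $k_1$ with $\overline\alpha_{i'_1,k_1}+(\beta_{i,k'}-\overline\alpha_{i',k})\ge1-\eta$, the minimum is over all $k_2$ with $\overline\alpha_{i'_2,k_2}+(\beta_{i,k'}-\overline\alpha_{i',k})<1-\eta$, and $\max\emptyset=-\infty$. -/

import Mathlib

namespace ToeplitzTrace

noncomputable section

/-- The punctured frequency interval `(-π, π) \ {0}`. -/
def freqDomain : Set ℝ := Set.Ioo (-Real.pi) Real.pi \ {0}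

/-- `Γ₁(c, α, L)`: symmetric, integrable, continuously differentiable functions `h` on
`(-π, π) \ {0}` with `|h(x)| + |x h'(x)| ≤ c |x|^(-α-ε) L(ε)` for all `x` and all `ε > 0`.
Only the values of `h` on `(-π, π) \ {0}` matter. -/
def GammaOne (c α : ℝ) (L : ℝ → ℝ) : Set (ℝ → ℝ) :=
  {h | (∀ x ∈ freqDomain, h (-x) = h x) ∧
    MeasureTheory.IntegrableOn h freqDomain ∧
    ContDiffOn ℝ 1 h freqDomain ∧
    ∀ x ∈ freqDomain, ∀ ε : ℝ, 0 < ε →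
      |h x| + |x * deriv h x| ≤ c * |x| ^ (-α - ε) * L ε}

/-- `h ∈ ⊕ᵢ ⋂ₖ Γ₁(c i k, α i k, L)`: on the punctured interval `h` is a sum of functions `u i`,
`i < m`, each of which satisfies all of the `q` bounds with index `(i, k)`, `k < q`. -/
def InSumInter {m q : ℕ} (c α : Fin m → Fin q → ℝ) (L : ℝ → ℝ) (h : ℝ → ℝ) : Prop :=
  ∃ u : Fin m → ℝ → ℝ, (∀ i k, u i ∈ GammaOne (c i k) (α i k) L) ∧
    ∀ x ∈ freqDomain, h x = ∑ i, u i x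

/-- The Toeplitz matrix `T_n(f)`, with entries `∫_{-π}^{π} e^{i(k-j)x} f(x) dx`. -/
def toeplitz (n : ℕ) (f : ℝ → ℝ) : Matrix (Fin n) (Fin n) ℂ :=
  Matrix.of fun k j =>
    ∫ x in (-Real.pi)..Real.pi,
      Complex.exp (Complex.I * (((k : ℕ) : ℂ) - ((j : ℕ) : ℂ)) * (x : ℂ)) * (f x : ℂ)

/-- The exponents `(α i k)`, `(αbar i k)`, `(β i k)`, as a point of a Euclidean space. -/
abbrev Exponents (m q : ℕ) : Type :=
  (Fin m → Fin q → ℝ) × (Fin m → Fin q → ℝ) × (Fin m → Fin q → ℝ)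

/-- A choice of indices `row i k ∈ {1, …, m}` and `col i k ∈ {1, …, q}` for every `(i, k)`. -/
structure Selection (m q : ℕ) where
  row : Fin m → Fin q → Fin m
  col : Fin m → Fin q → Fin q

variable {m q : ℕ}

/-- `b_{i, col(i,k)} - a_{row(i,k), k}`. -/
def gap (s : Selection m q) (b a : Fin m → Fin q → ℝ) (i : Fin m) (k : Fin q) : ℝ :=
  b i (s.col i k) - a (s.row i k) k

/-- `α'_i = max_k αbar_{row(i,k), k} · 1{αbar_{row(i,k), k} < 1}`. -/
def alphaPrime (s : Selection m q) (αbar : Fin m → Fin q → ℝ) (i : Fin m) : ℝ :=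
  ⨆ k : Fin q, if αbar (s.row i k) k < 1 then αbar (s.row i k) k else 0

/-- The quantity `R_{i,k}`. The maximum runs over the `k₁` with
`αbar_{row(i,k₁), k₁} + gap ≥ 1 - η` and the minimum over the `k₂` with
`αbar_{row(i,k₂), k₂} + gap < 1 - η`. If there is no such `k₁`, then the real supremum over the
empty type is `0` and the value is `1`, as for `max ∅ = -∞`. -/
def ratioR (s : Selection m q) (cbar αbar β : Fin m → Fin q → ℝ) (η : ℝ)
    (i : Fin m) (k : Fin q) : ℝ :=
  if 0 ≤ gap s β αbar i k + η then
    max 1 (⨆ k₁ : {k₁ : Fin q // 1 - η ≤ αbar (s.row i k₁) k₁ + gap s β αbar i k},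
      ⨅ k₂ : {k₂ : Fin q // αbar (s.row i k₂) k₂ + gap s β αbar i k < 1 - η},
        cbar (s.row i k₂) k₂ / cbar (s.row i k₁) k₁)
  else 1

/-- `δ_n`. -/
def deltaOp (s : Selection m q) (d cbar αbar β : Fin m → Fin q → ℝ) (η ε : ℝ) (n : ℕ) : ℝ :=
  ∑ i, ∑ k, d i (s.col i k) / cbar (s.row i k) k *
    (ratioR s cbar αbar β η i k * (n : ℝ)) ^
      (max (gap s β αbar i k) 0 / (1 - max (alphaPrime s αbar i) 0) + ε)

/-- `∑_{i,k} (e_{i, col(i,k)} / cbar_{row(i,k), k}) n ^ ((b_{i, col(i,k)} - αbar_{row(i,k), k})₊ + ε)`.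
With `e = d`, `b = β` this is `δ*_n`; with `e = c`, `b = α` its maximum with `1` is `δ⋆_n`. -/
def deltaSum (s : Selection m q) (e cbar b αbar : Fin m → Fin q → ℝ) (ε : ℝ) (n : ℕ) : ℝ :=
  ∑ i, ∑ k, e i (s.col i k) / cbar (s.row i k) k * (n : ℝ) ^ (max (gap s b αbar i k) 0 + ε)

/-- The conditions on the exponents `(α, αbar, β)` and on the selections
`s₁ = (i', k')`, `s₂ = (i*, k*)`, `s₃ = (i⋆, k⋆)`. -/
structure Admissible (p : ℕ) (η : ℝ) (α αbar β : Fin m → Fin q → ℝ)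
    (s₁ s₂ s₃ : Selection m q) : Prop where
  min_alpha : ∀ i, (⨅ k, α i k) < 1
  min_beta : ∀ i, (⨅ k, β i k) < 1
  max_add_min : ∀ i, (⨆ k, max (gap s₁ β αbar i k) 0) + (⨅ k, αbar (s₁.row i k) k) < 1 - η
  gap_lt : ∀ i k, gap s₁ β αbar i k < 1 - η
  mul_gap_beta : ∀ i k, (p : ℝ) * max (gap s₂ β αbar i k) 0 < 1 - η
  mul_gap_alpha : ∀ i k, (p : ℝ) * max (gap s₃ α αbar i k) 0 < 1 - η
  beta_lt : ∀ i k, β i (s₂.col i k) < 1 - η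
  alpha_lt : ∀ i k, α i (s₃.col i k) < 1 - η
  lt_alphabar : ∀ i k, -1 + η < αbar (s₂.row i k) k
  lt_alphabar' : ∀ i k, -1 + η < αbar (s₃.row i k) k
  alphaPrime_lt : ∀ i, alphaPrime s₁ αbar i < 1 - η

end

end ToeplitzTrace

/-! ### Exponential vectors, the Toeplitz form and the Dirichlet kernel. -/

namespace ToeplitzTrace
open MeasureTheory

/-! Let `e_x` be the vector `evec n x`. Then `T_n(f) = ∫ f(x) e_x e_x^* dx`, and `e_x^* e_y` is the
Dirichlet kernel. Each `T_n(f_l)⁻¹` is replaced by `C_l = (2π)⁻² T_n(1/f_l)`. The trace after the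
replacement and the cost of the replacement are estimated separately.

Trace of `∏ T_n(g_l) T_n(1/f_l)`. Since `T_n(1) = 2π I`, the row `e_x^* T_n(h)` equals `2π h(x)
e_x^*` plus `∫ (h(y) - h(x)) (e_x^* e_y) e_y^* dy`. The bound on `h'` makes the increment compensate
the diagonal singularity of the kernel, so the remainder is small for `|x| ≥ 1/n`. The remaining
matrices of the product act on it through a weighted Schur test, with square roots of the majorants
as weights. For `|x| < 1/n` crude bounds suffice. This is `norm_trace_chainMat_sub_le`; for the
classes `Γ₁` it becomes `integrableOn_prod_and_norm_trace_sub_le`, with an error of order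
`(δ*_n)^p`.

Cost of the replacement. Cauchy–Schwarz gives `C_l ≥ T_n(f_l)⁻¹`
(`posSemidef_toeplitz_one_div_sub_inv`). With `T_n(f_l) = S^* S`, the defect `W = S (C_l -
T_n(f_l)⁻¹) S^*` is positive semidefinite, so `|tr(QW)| ≤ ‖Q‖ tr W`, and `tr W = tr(T_n(f_l) C_l) -
n`. The trace estimate for the two symbols `f_l`, `1/f_l`, whose product is `1`, bounds this by a
multiple of `δ⋆_n`. The matrices `T_n(g_l)`, conjugated by the factors `S`, have operator norm at
most a multiple of `δ_n`. Telescoping (`norm_trace_prod_sub_trace_prod_inv_le`) gives `δ⋆_n (δ⋆_n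
δ_n)^p`.

The operator norm bound amounts to `∫ |g| |P|² ≤ K δ_n ∫ f |P|²` for trigonometric polynomials `P`
of degree less than `n` (`integral_abs_mul_sq_norm_le`). Away from the origin the terms of `g` are
pointwise dominated by `f`. Near it, `|P|²` is bounded by `∫ f |P|²` times powers of `n`
(`norm_sq_le_supSum`), and the result is integrated against `|x|^(ε-1)`. The cutoff `(R
n)^(-1/(1-α'₊))` balances the two regimes. -/

lemma measurableSet_freqDomain : MeasurableSet freqDomain :=
  measurableSet_Ioo.diff (measurableSet_singleton 0)

lemma freqDomain_ae_eq_Ioc :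
    (Set.Ioc (-Real.pi) Real.pi : Set ℝ) =ᵐ[volume] freqDomain :=
  Ioo_ae_eq_Ioc.symm.trans (sdiff_null_ae_eq_self (measure_singleton 0)).symm

instance isFiniteMeasure_restrict_freqDomain :
    IsFiniteMeasure (volume.restrict freqDomain) := by
  refine ⟨?_⟩
  rw [Measure.restrict_apply_univ, ← measure_congr freqDomain_ae_eq_Ioc]
  simp

lemma intervalIntegral_eq_freqDomain {E : Type*} [NormedAddCommGroup E] [NormedSpace ℝ E]
    (f : ℝ → E) :
    ∫ x in (-Real.pi)..Real.pi, f x = ∫ x in freqDomain, f x := by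
  rw [intervalIntegral.integral_of_le (by linarith [Real.pi_pos])]
  exact setIntegral_congr_set freqDomain_ae_eq_Ioc

lemma intervalIntegrable_iff_freqDomain {E : Type*} [NormedAddCommGroup E] (f : ℝ → E) :
    IntervalIntegrable f volume (-Real.pi) Real.pi ↔ IntegrableOn f freqDomain := by
  rw [intervalIntegrable_iff_integrableOn_Ioc_of_le (by linarith [Real.pi_pos])]
  exact integrableOn_congr_set_ae freqDomain_ae_eq_Ioc

lemma freqDomain_abs_pos {x : ℝ} (hx : x ∈ freqDomain) : 0 < |x| := abs_pos.2 hx.2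

lemma freqDomain_abs_lt {x : ℝ} (hx : x ∈ freqDomain) : |x| < Real.pi := abs_lt.2 hx.1

lemma mem_freqDomain_iff {x : ℝ} : x ∈ freqDomain ↔ 0 < |x| ∧ |x| < Real.pi := by
  simp only [freqDomain, Set.mem_sdiff, Set.mem_Ioo, Set.mem_singleton_iff, abs_pos, abs_lt]
  tauto

/-- The vector `(e^{ikx})_{k < n}`. -/
noncomputable def evec (n : ℕ) (x : ℝ) : Fin n → ℂ :=
  fun k => Complex.exp (Complex.I * ((k : ℕ) : ℂ) * (x : ℂ))

lemma evec_eq (n : ℕ) (x : ℝ) (k : Fin n) :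
    evec n x k = Complex.exp (((((k : ℕ) : ℝ) * x : ℝ) : ℂ) * Complex.I) := by
  unfold evec; congr 1; push_cast; ring

lemma norm_evec (n : ℕ) (x : ℝ) (k : Fin n) : ‖evec n x k‖ = 1 := by
  rw [evec_eq, Complex.norm_exp_ofReal_mul_I]

lemma continuous_evec (n : ℕ) (k : Fin n) : Continuous fun x => evec n x k := by
  unfold evec; fun_prop

lemma star_evec (n : ℕ) (x : ℝ) (k : Fin n) :
    star (evec n x k) = Complex.exp (-(Complex.I * ((k : ℕ) : ℂ) * (x : ℂ))) := by
  unfold evec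
  rw [Complex.star_def, ← Complex.exp_conj]
  simp

lemma toeplitz_apply (n : ℕ) (f : ℝ → ℝ) (k j : Fin n) :
    toeplitz n f k j = ∫ x in freqDomain, (f x : ℂ) * (evec n x k * star (evec n x j)) := by
  rw [toeplitz, Matrix.of_apply, intervalIntegral_eq_freqDomain]
  refine integral_congr_ae (Filter.Eventually.of_forall fun x => ?_)
  beta_reduce
  rw [star_evec, evec, ← Complex.exp_add, mul_comm]
  congr 2
  ring

lemma IntegrableOn.ofReal_mul_bounded {f : ℝ → ℝ} (hf : IntegrableOn f freqDomain)
    {g : ℝ → ℂ} (hg : Continuous g) {C : ℝ} (hC : ∀ x, ‖g x‖ ≤ C) :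
    IntegrableOn (fun x => (f x : ℂ) * g x) freqDomain := by
  have := Integrable.bdd_mul (c := C) hf.ofReal (𝕜 := ℂ)
    hg.aestronglyMeasurable (Filter.Eventually.of_forall hC)
  refine this.congr (Filter.Eventually.of_forall fun x => ?_)
  simp [mul_comm]

lemma continuous_dotProduct_evec {n : ℕ} (w : Fin n → ℂ) :
    Continuous fun x => w ⬝ᵥ evec n x := by
  unfold dotProduct
  exact continuous_finsetSum _ fun k _ => continuous_const.mul (continuous_evec n k)

lemma continuous_star_evec_dotProduct {n : ℕ} (w : Fin n → ℂ) :
    Continuous fun x => star (evec n x) ⬝ᵥ w := by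
  unfold dotProduct
  exact continuous_finsetSum _ fun k _ => (continuous_evec n k).star.mul continuous_const

/-- The weak form of `T_n(f) = ∫ f(x) e_x e_x^* dx`, through which all matrix quantities below
become integrals. -/
lemma dotProduct_toeplitz_mulVec {n : ℕ} {f : ℝ → ℝ} (hf : IntegrableOn f freqDomain)
    (w z : Fin n → ℂ) :
    w ⬝ᵥ (toeplitz n f).mulVec z =
      ∫ x in freqDomain, (f x : ℂ) * ((w ⬝ᵥ evec n x) * (star (evec n x) ⬝ᵥ z)) := by
  have hint : ∀ k j : Fin n, IntegrableOn
      (fun x => (f x : ℂ) * (w k * (evec n x k * star (evec n x j)) * z j)) freqDomain := by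
    intro k j
    refine IntegrableOn.ofReal_mul_bounded hf (C := ‖w k‖ * ‖z j‖) ?_ ?_
    · exact (continuous_const.mul ((continuous_evec n k).mul (continuous_evec n j).star)).mul
        continuous_const
    · intro x
      simp [norm_evec]
  have h1 : ∀ x, (f x : ℂ) * ((w ⬝ᵥ evec n x) * (star (evec n x) ⬝ᵥ z)) =
      ∑ k, ∑ j, (f x : ℂ) * (w k * (evec n x k * star (evec n x j)) * z j) := by
    intro x
    simp only [dotProduct, Pi.star_apply]
    rw [Finset.sum_mul_sum, Finset.mul_sum]
    refine Finset.sum_congr rfl fun k _ => ?_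
    rw [Finset.mul_sum]
    refine Finset.sum_congr rfl fun j _ => ?_
    ring
  simp only [h1]
  rw [integral_finsetSum _ fun k _ => integrable_finsetSum _ fun j _ => hint k j]
  simp only [dotProduct, Matrix.mulVec, Finset.mul_sum]
  refine Finset.sum_congr rfl fun k _ => ?_
  rw [integral_finsetSum _ fun j _ => hint k j]
  refine Finset.sum_congr rfl fun j _ => ?_
  rw [toeplitz_apply]
  rw [← integral_mul_const, ← integral_const_mul]
  refine integral_congr_ae (Filter.Eventually.of_forall fun x => ?_)
  beta_reduce
  ring

/-- Orthogonality of the exponentials. With the integral representation it is the reproducing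
formula `∫ e_y e_y^* dy = 2π I`, which allows a constant to be subtracted from a symbol. -/
lemma toeplitz_one (n : ℕ) :
    toeplitz n (fun _ => 1) = ((2 * Real.pi : ℝ) : ℂ) • (1 : Matrix (Fin n) (Fin n) ℂ) := by
  ext k j
  rw [toeplitz, Matrix.of_apply]
  by_cases h : k = j
  · subst h
    simp
    ring
  · have h0 : Complex.I * (((k : ℕ) : ℂ) - ((j : ℕ) : ℂ)) ≠ 0 := by
      refine mul_ne_zero Complex.I_ne_zero (sub_ne_zero.2 ?_)
      exact_mod_cast fun h' => h (Fin.ext h')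
    simp only [Complex.ofReal_one, mul_one]
    rw [integral_exp_mul_complex h0]
    rw [Matrix.smul_apply, Matrix.one_apply_ne h, smul_zero]
    rw [div_eq_zero_iff]; left
    rw [sub_eq_zero, Complex.exp_eq_exp_iff_exists_int]
    refine ⟨(k : ℕ) - (j : ℕ), ?_⟩
    push_cast
    ring

lemma norm_star_evec_dotProduct_evec_le (n : ℕ) (x y : ℝ) :
    ‖star (evec n x) ⬝ᵥ evec n y‖ ≤ n := by
  unfold dotProduct
  refine (norm_sum_le _ _).trans ?_
  simp [norm_evec]

/-- The kernel is a geometric sum, so its modulus times `|sin((y-x)/2)|` is at most `1`. Measuring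
distance by `||x| - |y||` suits even symbols and stays correct when `x` and `y` lie near opposite
ends of the interval. -/
lemma norm_star_evec_dotProduct_evec_mul_le (n : ℕ) {x y : ℝ} (hx : x ∈ freqDomain)
    (hy : y ∈ freqDomain) :
    ‖star (evec n x) ⬝ᵥ evec n y‖ * |(|x| - |y|)| ≤ Real.pi := by
  have hs : |(|x| - |y|)| / Real.pi ≤ |Real.sin ((y - x) / 2)| := by
    have hx1 := freqDomain_abs_lt hx
    have hy1 := freqDomain_abs_lt hy
    have hx0 := freqDomain_abs_pos hx
    have hy0 := freqDomain_abs_pos hy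
    have key : |(|x| - |y|)| / Real.pi ≤ |Real.sin ((|x| - |y|) / 2)| := by
      have hb : |(|x| - |y|) / 2| ≤ Real.pi / 2 := by
        rw [abs_div, abs_two]
        have : |(|x| - |y|)| ≤ Real.pi := abs_le.2 ⟨by linarith, by linarith⟩
        linarith
      have := Real.mul_abs_le_abs_sin hb
      calc |(|x| - |y|)| / Real.pi = 2 / Real.pi * |(|x| - |y|) / 2| := by
            rw [abs_div, abs_two]; ring
        _ ≤ _ := this
    refine key.trans ?_
    -- For points of opposite sign the half-difference has modulus `(|x| + |y|)/2`. The sum and the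
    -- difference of the two sines are products of nonnegative factors.
    have hopp : |Real.sin ((|x| - |y|) / 2)| ≤ |Real.sin ((|x| + |y|) / 2)| := by
      have e1 : Real.sin ((|x| + |y|) / 2) - Real.sin ((|x| - |y|) / 2)
          = 2 * Real.sin (|y| / 2) * Real.cos (|x| / 2) := by
        rw [Real.sin_sub_sin]; ring_nf
      have e2 : Real.sin ((|x| + |y|) / 2) + Real.sin ((|x| - |y|) / 2)
          = 2 * Real.sin (|x| / 2) * Real.cos (|y| / 2) := by
        rw [show (|x| - |y|) / 2 = -((|y| - |x|) / 2) by ring, Real.sin_neg, ← sub_eq_add_neg,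
          Real.sin_sub_sin]
        ring_nf
      have p1 : 0 ≤ Real.sin (|x| / 2) :=
        Real.sin_nonneg_of_nonneg_of_le_pi (by linarith) (by linarith)
      have p2 : 0 ≤ Real.sin (|y| / 2) :=
        Real.sin_nonneg_of_nonneg_of_le_pi (by linarith) (by linarith)
      have p3 : 0 ≤ Real.cos (|x| / 2) := Real.cos_nonneg_of_mem_Icc ⟨by linarith, by linarith⟩
      have p4 : 0 ≤ Real.cos (|y| / 2) := Real.cos_nonneg_of_mem_Icc ⟨by linarith, by linarith⟩
      have q1 := mul_nonneg p2 p3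
      have q2 := mul_nonneg p1 p4
      refine abs_le.2 ⟨?_, ?_⟩
      · linarith [le_abs_self (Real.sin ((|x| + |y|) / 2))]
      · linarith [le_abs_self (Real.sin ((|x| + |y|) / 2))]
    rcases abs_choice x with h1 | h1 <;> rcases abs_choice y with h2 | h2 <;>
      rw [h1, h2] at hopp ⊢
    · rw [← abs_neg, ← Real.sin_neg, show -((x - y) / 2) = (y - x) / 2 by ring]
    · rw [← abs_neg (Real.sin ((y - x) / 2)), ← Real.sin_neg,
        show -((y - x) / 2) = (x + -y) / 2 by ring]
      exact hopp
    · rw [show (y - x) / 2 = (-x + y) / 2 by ring]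
      exact hopp
    · rw [show (-x - -y) / 2 = (y - x) / 2 by ring]
  have hgeom : ‖star (evec n x) ⬝ᵥ evec n y‖ * |Real.sin ((y - x) / 2)| ≤ 1 := by
    have h1 : star (evec n x) ⬝ᵥ evec n y =
        ∑ k ∈ Finset.range n, (Complex.exp (((y - x : ℝ) : ℂ) * Complex.I)) ^ k := by
      rw [← Fin.sum_univ_eq_sum_range]
      unfold dotProduct
      refine Finset.sum_congr rfl fun k _ => ?_
      rw [Pi.star_apply, star_evec, evec, ← Complex.exp_add, ← Complex.exp_nat_mul]
      congr 1; push_cast; ring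
    have h2 : ‖Complex.exp (((y - x : ℝ) : ℂ) * Complex.I) - 1‖ = 2 * |Real.sin ((y - x) / 2)| := by
      have := Complex.norm_exp_I_mul_ofReal_sub_one (y - x)
      rw [mul_comm] at this
      rw [this, Real.norm_eq_abs, abs_mul, abs_two]
    have h3 := geom_sum_mul (Complex.exp (((y - x : ℝ) : ℂ) * Complex.I)) n
    have h4 : ‖star (evec n x) ⬝ᵥ evec n y‖ * (2 * |Real.sin ((y - x) / 2)|) ≤ 2 := by
      rw [← h2, h1, ← norm_mul, h3]
      refine (norm_sub_le _ _).trans ?_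
      rw [norm_pow, Complex.norm_exp_ofReal_mul_I]
      simp; norm_num
    linarith
  have hn := norm_nonneg (star (evec n x) ⬝ᵥ evec n y)
  have := mul_le_mul_of_nonneg_left hs hn
  rw [mul_div_assoc', div_le_iff₀ Real.pi_pos] at this
  nlinarith [Real.pi_pos]

/-! ### Power weights, integrable uniformly in the position of the singularity. -/

lemma integrableOn_abs_rpow {r : ℝ} (hr : -1 < r) (a : ℝ) :
    IntegrableOn (fun u : ℝ => |u| ^ r) (Set.Ioo (-a) a) := by
  rcases le_or_gt a 0 with ha | ha
  · rw [Set.Ioo_eq_empty (by linarith)]; exact integrableOn_empty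
  have h1 : IntegrableOn (fun u : ℝ => |u| ^ r) (Set.Ioc 0 a) := by
    have := (intervalIntegrable_iff_integrableOn_Ioc_of_le ha.le).1
      (intervalIntegral.intervalIntegrable_rpow' (a := 0) (b := a) hr)
    refine this.congr_fun (fun u hu => ?_) measurableSet_Ioc
    simp only [abs_of_pos hu.1]
  have h2 : IntegrableOn (fun u : ℝ => |u| ^ r) (Set.Ico (-a) 0) := by
    have := h1.comp_neg
    simpa using this
  have h3 : IntegrableOn (fun u : ℝ => |u| ^ r) {(0 : ℝ)} := by
    simp
  refine ((h2.union h3).union h1).mono_set ?_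
  intro u hu
  rcases lt_trichotomy u 0 with h | h | h
  · exact Or.inl (Or.inl ⟨hu.1.le, h⟩)
  · exact Or.inl (Or.inr h)
  · exact Or.inr ⟨h, hu.2.le⟩

lemma freqDomain_subset : freqDomain ⊆ Set.Ioo (-Real.pi) Real.pi := Set.sdiff_subset

lemma integrableOn_abs_rpow_freqDomain {r : ℝ} (hr : -1 < r) :
    IntegrableOn (fun u : ℝ => |u| ^ r) freqDomain :=
  (integrableOn_abs_rpow hr _).mono_set freqDomain_subset

/-- The shifted variable `c + y` stays in `(-2π, 2π)`, so translation invariance gives a bound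
independent of `c`. -/
lemma integral_abs_add_rpow_le {r : ℝ} (hr : -1 < r) {c : ℝ} (hc : |c| ≤ Real.pi) :
    IntegrableOn (fun y : ℝ => |c + y| ^ r) freqDomain ∧
    ∫ y in freqDomain, |c + y| ^ r ≤
      ∫ u in Set.Ioo (-(2 * Real.pi)) (2 * Real.pi), |u| ^ r := by
  have h0 := integrableOn_abs_rpow hr (2 * Real.pi)
  set g : ℝ → ℝ := Set.indicator (Set.Ioo (-(2 * Real.pi)) (2 * Real.pi)) fun u => |u| ^ r
    with hg
  have hgi : Integrable g := (integrable_indicator_iff measurableSet_Ioo).2 h0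
  have hgn : ∀ u, 0 ≤ g u := fun u =>
    Set.indicator_nonneg (fun u _ => Real.rpow_nonneg (abs_nonneg _) _) u
  have heq : Set.EqOn (fun y => g (c + y)) (fun y : ℝ => |c + y| ^ r) freqDomain := by
    intro y hy
    have h1 := freqDomain_abs_lt hy
    rw [abs_lt] at h1
    rw [abs_le] at hc
    have : c + y ∈ Set.Ioo (-(2 * Real.pi)) (2 * Real.pi) := ⟨by linarith, by linarith⟩
    simp only [hg, Set.indicator_of_mem this]
  have hgc : Integrable fun y => g (c + y) := hgi.comp_add_left c
  refine ⟨hgc.integrableOn.congr_fun heq measurableSet_freqDomain, ?_⟩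
  calc ∫ y in freqDomain, |c + y| ^ r = ∫ y in freqDomain, g (c + y) :=
        (setIntegral_congr_fun measurableSet_freqDomain heq).symm
    _ ≤ ∫ y, g (c + y) := setIntegral_le_integral hgc (Filter.Eventually.of_forall fun y => hgn _)
    _ = ∫ y, g y := integral_add_left_eq_self g c
    _ = _ := integral_indicator measurableSet_Ioo

/-- The integrable majorant of the Dirichlet kernel estimates. -/
noncomputable def schurWeight (ε z y : ℝ) : ℝ := |y| ^ (ε - 1) + |(|z| - |y|)| ^ (ε - 1)

lemma schurWeight_nonneg (ε z y : ℝ) : 0 ≤ schurWeight ε z y :=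
  add_nonneg (Real.rpow_nonneg (abs_nonneg _) _) (Real.rpow_nonneg (abs_nonneg _) _)

/-- A bound for the integral of `schurWeight`. -/
noncomputable def schurConst (ε : ℝ) : ℝ :=
  3 * ∫ u in Set.Ioo (-(2 * Real.pi)) (2 * Real.pi), |u| ^ (ε - 1)

lemma schurConst_nonneg (ε : ℝ) : 0 ≤ schurConst ε :=
  mul_nonneg (by norm_num) (integral_nonneg fun _ => Real.rpow_nonneg (abs_nonneg _) _)

/-- The singularity at `|y| = |z|` is split into those at `y = z` and `y = -z`; with the one at `0`
this accounts for the factor `3` in `schurConst`. -/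
lemma integral_schurWeight {ε : ℝ} (hε : 0 < ε) {z : ℝ} (hz : z ∈ freqDomain) :
    IntegrableOn (schurWeight ε z) freqDomain ∧
      ∫ y in freqDomain, schurWeight ε z y ≤ schurConst ε := by
  have hr : -1 < ε - 1 := by linarith
  obtain ⟨i0, b0⟩ := integral_abs_add_rpow_le hr (c := 0) (by simp [Real.pi_pos.le])
  obtain ⟨i1, b1⟩ := integral_abs_add_rpow_le hr (c := |z|)
    (by rw [abs_abs]; exact (freqDomain_abs_lt hz).le)
  obtain ⟨i2, b2⟩ := integral_abs_add_rpow_le hr (c := -|z|)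
    (by rw [abs_neg, abs_abs]; exact (freqDomain_abs_lt hz).le)
  have hle : ∀ y, schurWeight ε z y ≤
      |0 + y| ^ (ε - 1) + (|(|z| + y)| ^ (ε - 1) + |(-|z| + y)| ^ (ε - 1)) := by
    intro y
    unfold schurWeight
    rw [zero_add]
    refine add_le_add le_rfl ?_
    have n1 : 0 ≤ |(|z| + y)| ^ (ε - 1) := Real.rpow_nonneg (abs_nonneg _) _
    have n2 : 0 ≤ |(-|z| + y)| ^ (ε - 1) := Real.rpow_nonneg (abs_nonneg _) _
    rcases abs_choice y with h | h <;> rw [h]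
    · rw [← abs_neg (|z| - y), show -(|z| - y) = -|z| + y by ring]; linarith
    · rw [show |z| - -y = |z| + y by ring]; linarith
  have hint := i0.add (i1.add i2)
  have hmeas : Measurable (schurWeight ε z) := by
    unfold schurWeight
    fun_prop
  have hI : IntegrableOn (schurWeight ε z) freqDomain := by
    refine Integrable.mono' hint hmeas.aestronglyMeasurable
      (Filter.Eventually.of_forall fun y => ?_)
    rw [Real.norm_of_nonneg (schurWeight_nonneg _ _ _)]
    exact hle y
  refine ⟨hI, ?_⟩
  refine (integral_mono hI hint hle).trans ?_
  rw [integral_add' i0 (i1.add i2), integral_add' i1 i2]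
  unfold schurConst
  linarith

/-! ### The Dirichlet kernel at scales not smaller than `1/n`. -/

/-- `max (|x|, 1/n)`. -/
noncomputable def absFloor (n : ℕ) (x : ℝ) : ℝ := max |x| (1 / (n : ℝ))

/-- The integrable singular factor `(max (|x|, 1/n) / |x|) ^ (1 - ε)`. -/
noncomputable def singFactor (ε : ℝ) (n : ℕ) (x : ℝ) : ℝ := (absFloor n x / |x|) ^ (1 - ε)

/-- The ratio of the larger to the smaller of `max (|x|, 1/n)` and `max (|y|, 1/n)`. -/
noncomputable def scaleRatio (n : ℕ) (x y : ℝ) : ℝ :=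
  max (absFloor n x / absFloor n y) (absFloor n y / absFloor n x)

section
variable {n : ℕ} {ε x y z : ℝ}

lemma abs_le_absFloor : |x| ≤ absFloor n x := le_max_left _ _

lemma inv_le_absFloor : 1 / (n : ℝ) ≤ absFloor n x := le_max_right _ _

lemma absFloor_pos (hn : 1 ≤ n) : 0 < absFloor n x :=
  lt_of_lt_of_le (by positivity) inv_le_absFloor

lemma absFloor_of_le (h : 1 / (n : ℝ) ≤ |x|) : absFloor n x = |x| := max_eq_left h

lemma absFloor_le_pi (hn : 1 ≤ n) (hx : x ∈ freqDomain) : absFloor n x ≤ Real.pi := by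
  refine max_le (freqDomain_abs_lt hx).le ?_
  have : (1 : ℝ) ≤ n := by exact_mod_cast hn
  calc 1 / (n : ℝ) ≤ 1 := by rw [div_le_one (by linarith)]; exact this
    _ ≤ Real.pi := by linarith [Real.pi_gt_three]

lemma one_le_singFactor (hε : ε ≤ 1) (hx : x ∈ freqDomain) : 1 ≤ singFactor ε n x := by
  refine Real.one_le_rpow ?_ (by linarith)
  rw [one_le_div (freqDomain_abs_pos hx)]
  exact abs_le_absFloor

lemma singFactor_of_le (hx : x ∈ freqDomain) (h : 1 / (n : ℝ) ≤ |x|) : singFactor ε n x = 1 := by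
  rw [singFactor, absFloor_of_le h, div_self (freqDomain_abs_pos hx).ne', Real.one_rpow]

/-- The left side equals `absFloor n x ^ (-ε) * |x| ^ (ε - 1)`: a factor `n ^ ε` is paid for
integrability at the origin. -/
lemma singFactor_div_absFloor_le (hn : 1 ≤ n) (hε : 0 ≤ ε) (hx : x ∈ freqDomain) :
    singFactor ε n x / absFloor n x ≤ (n : ℝ) ^ ε * |x| ^ (ε - 1) := by
  have ha : 0 < absFloor n x := absFloor_pos hn
  have hx0 := freqDomain_abs_pos hx
  have hn0 : (0 : ℝ) < n := by exact_mod_cast hn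
  have h1 : singFactor ε n x / absFloor n x = absFloor n x ^ (-ε) * |x| ^ (ε - 1) := by
    rw [singFactor, Real.div_rpow ha.le hx0.le, div_div, mul_comm (|x| ^ _), ← div_div,
      show -ε = (1 - ε) - 1 by ring, Real.rpow_sub_one ha.ne', div_eq_mul_inv (_ / _),
      ← Real.rpow_neg hx0.le]
    congr 2; ring
  rw [h1]
  refine mul_le_mul_of_nonneg_right ?_ (Real.rpow_nonneg hx0.le _)
  rw [Real.rpow_neg ha.le, ← Real.inv_rpow ha.le]
  refine Real.rpow_le_rpow (inv_nonneg.2 ha.le) ?_ hε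
  rw [inv_le_comm₀ ha hn0, ← one_div]
  exact inv_le_absFloor

lemma one_le_scaleRatio (hn : 1 ≤ n) : 1 ≤ scaleRatio n x y := by
  have hx : 0 < absFloor n x := absFloor_pos hn
  have hy : 0 < absFloor n y := absFloor_pos hn
  rcases le_total (absFloor n x) (absFloor n y) with h | h
  · exact le_max_of_le_right ((one_le_div hx).2 h)
  · exact le_max_of_le_left ((one_le_div hy).2 h)

lemma scaleRatio_comm : scaleRatio n x y = scaleRatio n y x := max_comm _ _

lemma scaleRatio_self (hn : 1 ≤ n) : scaleRatio n x x = 1 := by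
  rw [scaleRatio, max_self, div_self (absFloor_pos hn).ne']

lemma scaleRatio_le_mul (hn : 1 ≤ n) :
    scaleRatio n x z ≤ scaleRatio n x y * scaleRatio n y z := by
  have hx : 0 < absFloor n x := absFloor_pos hn
  have hy : 0 < absFloor n y := absFloor_pos hn
  have hz : 0 < absFloor n z := absFloor_pos hn
  refine max_le ?_ ?_
  · calc absFloor n x / absFloor n z
        = (absFloor n x / absFloor n y) * (absFloor n y / absFloor n z) := by field_simp
      _ ≤ _ := mul_le_mul (le_max_left _ _) (le_max_left _ _) (by positivity)
          (zero_le_one.trans (one_le_scaleRatio hn))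
  · calc absFloor n z / absFloor n x
        = (absFloor n y / absFloor n x) * (absFloor n z / absFloor n y) := by field_simp
      _ ≤ _ := mul_le_mul (le_max_right _ _) (le_max_right _ _) (by positivity)
          (zero_le_one.trans (one_le_scaleRatio hn))

/-- Turns the kernel bound `1 / max` into a product of a function of `x` and a function of `y`,
which is what makes the Schur test iterable. -/
lemma sqrt_scaleRatio_div_max (hn : 1 ≤ n) :
    √(scaleRatio n x y) / max (absFloor n x) (absFloor n y) =
      1 / (√(absFloor n x) * √(absFloor n y)) := by
  have key : ∀ a b : ℝ, 0 < a → a ≤ b → √(max (a / b) (b / a)) / max a b = 1 / (√a * √b) := by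
    intro a b ha hab
    have hb : 0 < b := ha.trans_le hab
    have : a / b ≤ b / a := ((div_le_one hb).2 hab).trans ((one_le_div ha).2 hab)
    rw [max_eq_right this, max_eq_right hab, Real.sqrt_div hb.le]
    have h1 : √a ≠ 0 := (Real.sqrt_pos.2 ha).ne'
    have h2 : √b ≠ 0 := (Real.sqrt_pos.2 hb).ne'
    rw [div_div, div_eq_div_iff (by positivity) (by positivity)]
    calc √b * (√a * √b) = √a * (√b * √b) := by ring
      _ = 1 * (√a * b) := by rw [Real.mul_self_sqrt hb.le]; ring
  unfold scaleRatio
  rcases le_total (absFloor n x) (absFloor n y) with h | h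
  · exact key _ _ (absFloor_pos hn) h
  · rw [max_comm (_ / _), max_comm (absFloor n x), mul_comm]
    exact key _ _ (absFloor_pos hn) h

/-- The Dirichlet kernel is bounded by the inverse of the larger scale, except when both
variables are of the same size, and this is at least `1/n`. -/
lemma norm_kernel_mul_max_le_or (hn : 1 ≤ n) (hx : x ∈ freqDomain) (hy : y ∈ freqDomain) :
    ‖star (evec n x) ⬝ᵥ evec n y‖ * max (absFloor n x) (absFloor n y) ≤ 8 ∨
      (1 / (n : ℝ) ≤ |x| ∧ 1 / (n : ℝ) ≤ |y| ∧ |y| ≤ 2 * |x| ∧ |x| ≤ 2 * |y|) := by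
  set D := ‖star (evec n x) ⬝ᵥ evec n y‖ with hD
  have hD0 : 0 ≤ D := norm_nonneg _
  have hn0 : (0 : ℝ) < n := by exact_mod_cast hn
  have h1 : D * (1 / (n : ℝ)) ≤ 1 := by
    rw [mul_one_div, div_le_one hn0]; exact norm_star_evec_dotProduct_evec_le n x y
  have h2 := norm_star_evec_dotProduct_evec_mul_le n hx hy
  rw [← hD] at h2
  have hpi := Real.pi_lt_four
  have hx0 := freqDomain_abs_pos hx
  have hy0 := freqDomain_abs_pos hy
  -- If the moduli are comparable and one is below `1/n`, both are at most `2/n` and the trivial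
  -- bound `n` suffices. If they are not comparable, `||x| - |y||` is at least half the larger one.
  by_cases hfar : |y| ≤ 2 * |x| ∧ |x| ≤ 2 * |y|
  · by_cases hb : 1 / (n : ℝ) ≤ |x| ∧ 1 / (n : ℝ) ≤ |y|
    · exact Or.inr ⟨hb.1, hb.2, hfar⟩
    · left
      have : max (absFloor n x) (absFloor n y) ≤ 2 * (1 / (n : ℝ)) := by
        have : 0 < 1 / (n : ℝ) := by positivity
        rcases not_and_or.1 hb with h | h <;> push Not at h <;>
          refine max_le (max_le ?_ ?_) (max_le ?_ ?_) <;> linarith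
      nlinarith
  · left
    have h3 : D * |x| ≤ 8 ∧ D * |y| ≤ 8 := by
      rcases not_and_or.1 hfar with h | h <;> push Not at h
      · have : |y| / 2 ≤ |(|x| - |y|)| := by
          rw [abs_sub_comm]; exact (by linarith : |y| / 2 ≤ |y| - |x|).trans (le_abs_self _)
        constructor <;> nlinarith
      · have : |x| / 2 ≤ |(|x| - |y|)| :=
          (by linarith : |x| / 2 ≤ |x| - |y|).trans (le_abs_self _)
        constructor <;> nlinarith
    rw [absFloor, absFloor, mul_max_of_nonneg _ _ hD0, mul_max_of_nonneg _ _ hD0,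
      mul_max_of_nonneg _ _ hD0]
    refine max_le (max_le h3.1 ?_) (max_le h3.2 ?_) <;> linarith

/-- The pointwise input of the Schur test. The two alternatives of `norm_kernel_mul_max_le_or`
produce the two terms of `schurWeight`; in the second, `singFactor` is `1` and the scales are
comparable. -/
lemma norm_kernel_mul_sqrt_le (hn : 1 ≤ n) (hε : 0 < ε) (hε1 : ε < 1) (hy : y ∈ freqDomain)
    (hz : z ∈ freqDomain) (hyz : |z| - |y| ≠ 0) :
    ‖star (evec n y) ⬝ᵥ evec n z‖ * √(scaleRatio n y z) * singFactor ε n y / √(absFloor n y) ≤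
      8 * (n : ℝ) ^ ε / √(absFloor n z) * schurWeight ε z y := by
  set D := ‖star (evec n y) ⬝ᵥ evec n z‖ with hD
  have hD0 : 0 ≤ D := norm_nonneg _
  have hn0 : (0 : ℝ) < n := by exact_mod_cast hn
  have ha : 0 < absFloor n y := absFloor_pos hn
  have hb : 0 < absFloor n z := absFloor_pos hn
  have hsa : 0 < √(absFloor n y) := Real.sqrt_pos.2 ha
  have hsb : 0 < √(absFloor n z) := Real.sqrt_pos.2 hb
  have hne : 0 < (n : ℝ) ^ ε := Real.rpow_pos_of_pos hn0 _
  rcases norm_kernel_mul_max_le_or hn hy hz with h | ⟨h1, h2, h3, h4⟩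
  · rw [← hD] at h
    have hm : 0 < max (absFloor n y) (absFloor n z) := lt_max_of_lt_left ha
    have hs0 : 0 ≤ singFactor ε n y :=
      zero_le_one.trans (one_le_singFactor hε1.le hy)
    have hDle : D ≤ 8 / max (absFloor n y) (absFloor n z) := (le_div_iff₀ hm).2 h
    calc D * √(scaleRatio n y z) * singFactor ε n y / √(absFloor n y)
        ≤ 8 / max (absFloor n y) (absFloor n z) * √(scaleRatio n y z) * singFactor ε n y /
          √(absFloor n y) := by gcongr
      _ = 8 * (√(scaleRatio n y z) / max (absFloor n y) (absFloor n z)) * singFactor ε n y /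
          √(absFloor n y) := by ring
      _ = 8 / √(absFloor n z) * (singFactor ε n y / (√(absFloor n y) * √(absFloor n y))) := by
          rw [sqrt_scaleRatio_div_max hn]; field_simp
      _ = 8 / √(absFloor n z) * (singFactor ε n y / absFloor n y) := by
          rw [Real.mul_self_sqrt ha.le]
      _ ≤ 8 / √(absFloor n z) * ((n : ℝ) ^ ε * schurWeight ε z y) := by
          refine mul_le_mul_of_nonneg_left ?_ (by positivity)
          refine (singFactor_div_absFloor_le hn hε.le hy).trans ?_
          refine mul_le_mul_of_nonneg_left ?_ hne.le
          exact le_add_of_nonneg_right (Real.rpow_nonneg (abs_nonneg _) _)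
      _ = _ := by ring
  · rw [singFactor_of_le hy h1, mul_one]
    have ht : 0 < |(|z| - |y|)| := abs_pos.2 hyz
    have hDn : D ≤ n := norm_star_evec_dotProduct_evec_le n y z
    have hDt : D ≤ Real.pi / |(|z| - |y|)| := by
      rw [le_div_iff₀ ht, abs_sub_comm]
      exact norm_star_evec_dotProduct_evec_mul_le n hy hz
    -- Interpolation between the bounds `n` and `π / ||z| - |y||` makes the diagonal singularity
    -- integrable at the price `n ^ ε`.
    have hDe : D ≤ 4 * (n : ℝ) ^ ε * |(|z| - |y|)| ^ (ε - 1) := by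
      calc D = D ^ ε * D ^ (1 - ε) := by
            rw [← Real.rpow_add_of_nonneg hD0 hε.le (by linarith)]; simp
        _ ≤ (n : ℝ) ^ ε * (Real.pi / |(|z| - |y|)|) ^ (1 - ε) := by
            gcongr
        _ = (n : ℝ) ^ ε * Real.pi ^ (1 - ε) * |(|z| - |y|)| ^ (ε - 1) := by
            rw [Real.div_rpow Real.pi_pos.le ht.le, div_eq_mul_inv, ← Real.rpow_neg ht.le]
            ring_nf
        _ ≤ (n : ℝ) ^ ε * 4 * |(|z| - |y|)| ^ (ε - 1) := by
            gcongr
            calc Real.pi ^ (1 - ε) ≤ Real.pi ^ (1 : ℝ) :=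
                  Real.rpow_le_rpow_of_exponent_le (by linarith [Real.pi_gt_three]) (by linarith)
              _ ≤ 4 := by rw [Real.rpow_one]; exact Real.pi_lt_four.le
        _ = _ := by ring
    have hRa : √(scaleRatio n y z) / √(absFloor n y) ≤ 2 / √(absFloor n z) := by
      rw [← Real.sqrt_div' _ ha.le, show (2 : ℝ) = √4 by
        rw [show (4 : ℝ) = 2 ^ 2 by norm_num, Real.sqrt_sq (by norm_num)], ← Real.sqrt_div' _ hb.le]
      refine Real.sqrt_le_sqrt ?_
      rw [scaleRatio, absFloor_of_le h1, absFloor_of_le h2]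
      have hy0 := freqDomain_abs_pos hy
      have hz0 := freqDomain_abs_pos hz
      rw [div_le_div_iff₀ hy0 hz0, max_mul_of_nonneg _ _ hz0.le]
      refine max_le ?_ ?_
      · rw [div_mul_cancel₀ _ hz0.ne']; linarith
      · rw [div_mul_eq_mul_div, div_le_iff₀ hy0]; nlinarith
    have hw : |(|z| - |y|)| ^ (ε - 1) ≤ schurWeight ε z y :=
      le_add_of_nonneg_left (Real.rpow_nonneg (abs_nonneg _) _)
    have hw0 : 0 ≤ |(|z| - |y|)| ^ (ε - 1) := Real.rpow_nonneg ht.le _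
    calc D * √(scaleRatio n y z) / √(absFloor n y)
        = D * (√(scaleRatio n y z) / √(absFloor n y)) := by ring
      _ ≤ (4 * (n : ℝ) ^ ε * |(|z| - |y|)| ^ (ε - 1)) * (2 / √(absFloor n z)) := by
          gcongr
      _ ≤ (4 * (n : ℝ) ^ ε * schurWeight ε z y) * (2 / √(absFloor n z)) := by gcongr
      _ = _ := by ring

end

/-! ### Weighted Schur test for products of Toeplitz matrices. -/

/-- `h` is integrable and bounded by `H`, with increments controlled by `H` and the relative
distance of the arguments. -/
structure Dominated (C : ℝ) (H h : ℝ → ℝ) : Prop where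
  integrable : IntegrableOn h freqDomain
  bound : ∀ x ∈ freqDomain, |h x| ≤ H x
  diff : ∀ x ∈ freqDomain, ∀ y ∈ freqDomain, |(|x| - |y|)| ≤ |x| / 2 →
    |h y - h x| ≤ C * (|(|x| - |y|)| / |x|) * H y

/-- Compatibility of two consecutive majorants in a product of Toeplitz matrices. -/
def Compat (ε : ℝ) (n : ℕ) (s : ℝ) (H H' : ℝ → ℝ) : Prop :=
  ∀ x ∈ freqDomain, ∀ y ∈ freqDomain,
    √(H x) * √(H' y) ≤ s * √(scaleRatio n x y) * (√(singFactor ε n x) * √(singFactor ε n y))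

/-- The product `T(h j) T(h (j+1)) ⋯ T(h (j+r-1))`. -/
noncomputable def chainMat (n : ℕ) (h : ℕ → ℝ → ℝ) : ℕ → ℕ → Matrix (Fin n) (Fin n) ℂ
  | _, 0 => 1
  | j, r + 1 => toeplitz n (h j) * chainMat n h (j + 1) r

/-- The constant in the Schur test. -/
noncomputable def stepConst (ε : ℝ) (n : ℕ) : ℝ := 8 * (n : ℝ) ^ ε * schurConst ε

lemma stepConst_nonneg (ε : ℝ) (n : ℕ) : 0 ≤ stepConst ε n := by
  have := schurConst_nonneg ε
  unfold stepConst; positivity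

lemma ae_freqDomain_abs_ne (z : ℝ) :
    ∀ᵐ y ∂(volume.restrict freqDomain), y ∈ freqDomain ∧ |z| - |y| ≠ 0 := by
  refine (ae_restrict_mem measurableSet_freqDomain).and ?_
  refine ae_restrict_of_ae ?_
  have : ∀ᵐ y : ℝ, y ∉ ({z, -z} : Set ℝ) := by
    refine (measure_eq_zero_iff_ae_notMem).1 ?_
    exact (Set.toFinite _).measure_zero _
  filter_upwards [this] with y hy h
  refine hy ?_
  rw [sub_eq_zero, abs_eq_abs] at h
  rcases h with h | h
  · exact Or.inl h.symm
  · exact Or.inr (by rw [Set.mem_singleton_iff]; linarith)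

section
variable {n : ℕ} {ε : ℝ}

lemma norm_integral_kernel_le (hn : 1 ≤ n) (hε : 0 < ε) (hε1 : ε < 1) {F : ℝ → ℂ} {Q z : ℝ}
    (hQ : 0 ≤ Q) (hz : z ∈ freqDomain)
    (hF : ∀ y ∈ freqDomain, ‖F y‖ ≤ Q * (‖star (evec n y) ⬝ᵥ evec n z‖ *
      √(scaleRatio n y z) * singFactor ε n y / √(absFloor n y))) :
    ‖∫ y in freqDomain, F y‖ ≤ Q * stepConst ε n / √(absFloor n z) := by
  obtain ⟨hI, hb⟩ := integral_schurWeight hε hz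
  have h1 : ‖∫ y in freqDomain, F y‖ ≤
      ∫ y in freqDomain, (Q * (8 * (n : ℝ) ^ ε / √(absFloor n z))) * schurWeight ε z y := by
    refine norm_integral_le_of_norm_le (hI.const_mul _) ?_
    filter_upwards [ae_freqDomain_abs_ne z] with y hy
    refine (hF y hy.1).trans ?_
    rw [mul_assoc Q]
    exact mul_le_mul_of_nonneg_left (norm_kernel_mul_sqrt_le hn hε hε1 hy.1 hz hy.2) hQ
  rw [integral_const_mul] at h1
  refine h1.trans ?_
  calc Q * (8 * (n : ℝ) ^ ε / √(absFloor n z)) * ∫ y in freqDomain, schurWeight ε z y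
      ≤ Q * (8 * (n : ℝ) ^ ε / √(absFloor n z)) * schurConst ε := by gcongr
    _ = _ := by unfold stepConst; ring

lemma vecMul_toeplitz_dotProduct {f : ℝ → ℝ} (hf : IntegrableOn f freqDomain)
    (w z : Fin n → ℂ) :
    Matrix.vecMul w (toeplitz n f) ⬝ᵥ z =
      ∫ x in freqDomain, (f x : ℂ) * ((w ⬝ᵥ evec n x) * (star (evec n x) ⬝ᵥ z)) := by
  rw [← Matrix.dotProduct_mulVec, dotProduct_toeplitz_mulVec hf]

/-- One step of the Schur test: the form of the bound on the row `w` is preserved, with the next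
majorant in place of `H`. Of `H = √H · √H`, one factor is used by the hypothesis on `w`, the other
by `Compat`. The free factor `κ` later carries `√(H j x)` for the starting point `x`. -/
lemma norm_vecMul_toeplitz_le (hn : 1 ≤ n) (hε : 0 < ε) (hε1 : ε < 1) {C s B κ : ℝ}
    {H H' h : ℝ → ℝ} {w : Fin n → ℂ} (hh : Dominated C H h) (hc : Compat ε n s H H')
    (hs : 0 ≤ s) (hB0 : 0 ≤ B) (hκ : 0 ≤ κ)
    (hB : ∀ y ∈ freqDomain, κ * ‖w ⬝ᵥ evec n y‖ * √(H y) ≤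
      B * √(singFactor ε n y) / √(absFloor n y)) :
    ∀ z ∈ freqDomain, κ * ‖Matrix.vecMul w (toeplitz n h) ⬝ᵥ evec n z‖ * √(H' z) ≤
      (B * s * stepConst ε n) * √(singFactor ε n z) / √(absFloor n z) := by
  intro z hz
  rw [vecMul_toeplitz_dotProduct hh.integrable]
  have e1 : κ * ‖∫ x in freqDomain, (h x : ℂ) *
      ((w ⬝ᵥ evec n x) * (star (evec n x) ⬝ᵥ evec n z))‖ * √(H' z) =
      ‖∫ x in freqDomain, ((κ * √(H' z) : ℝ) : ℂ) * ((h x : ℂ) *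
      ((w ⬝ᵥ evec n x) * (star (evec n x) ⬝ᵥ evec n z)))‖ := by
    rw [integral_const_mul, norm_mul, Complex.norm_real, Real.norm_of_nonneg (by positivity)]
    ring
  rw [e1]
  have hz1 : 0 ≤ √(singFactor ε n z) := Real.sqrt_nonneg _
  refine (norm_integral_kernel_le hn hε hε1 (Q := B * s * √(singFactor ε n z))
    (by positivity) hz ?_).trans (le_of_eq (by ring))
  intro y hy
  rw [norm_mul, norm_mul, norm_mul, Complex.norm_real, Complex.norm_real,
    Real.norm_of_nonneg (show 0 ≤ κ * √(H' z) by positivity), Real.norm_eq_abs]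
  set D := ‖star (evec n y) ⬝ᵥ evec n z‖
  set W := ‖w ⬝ᵥ evec n y‖
  have hy1 := hh.bound y hy
  have hH : 0 ≤ H y := (abs_nonneg _).trans hy1
  have hω : √(singFactor ε n y) * √(singFactor ε n y) = singFactor ε n y :=
    Real.mul_self_sqrt (zero_le_one.trans (one_le_singFactor hε1.le hy))
  calc κ * √(H' z) * (|h y| * (W * D)) ≤ κ * √(H' z) * (H y * (W * D)) := by gcongr
    _ = κ * √(H' z) * ((√(H y) * √(H y)) * (W * D)) := by rw [Real.mul_self_sqrt hH]
    _ = (κ * W * √(H y)) * (√(H y) * √(H' z)) * D := by ring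
    _ ≤ (B * √(singFactor ε n y) / √(absFloor n y)) *
        (s * √(scaleRatio n y z) * (√(singFactor ε n y) * √(singFactor ε n z))) * D := by
        refine mul_le_mul_of_nonneg_right ?_ (norm_nonneg _)
        exact mul_le_mul (hB y hy) (hc y hy z hz) (by positivity) (by positivity)
    _ = B * s * √(singFactor ε n z) * (D * √(scaleRatio n y z) *
        (√(singFactor ε n y) * √(singFactor ε n y)) / √(absFloor n y)) := by ring
    _ = _ := by rw [hω]

lemma norm_vecMul_chainMat_le (hn : 1 ≤ n) (hε : 0 < ε) (hε1 : ε < 1) {C s κ : ℝ}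
    {H h : ℕ → ℝ → ℝ} (hh : ∀ j, Dominated C (H j) (h j))
    (hc : ∀ j, Compat ε n s (H j) (H (j + 1))) (hs : 0 ≤ s) (hκ : 0 ≤ κ) (r : ℕ) :
    ∀ (j : ℕ) (B : ℝ) (w : Fin n → ℂ), 0 ≤ B →
    (∀ y ∈ freqDomain, κ * ‖w ⬝ᵥ evec n y‖ * √(H j y) ≤
      B * √(singFactor ε n y) / √(absFloor n y)) →
    ∀ z ∈ freqDomain, κ * ‖Matrix.vecMul w (chainMat n h j r) ⬝ᵥ evec n z‖ * √(H (j + r) z) ≤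
      (B * (s * stepConst ε n) ^ r) * √(singFactor ε n z) / √(absFloor n z) := by
  induction r with
  | zero =>
    intro j B w _ hB z hz
    simpa [chainMat] using hB z hz
  | succ r ih =>
    intro j B w hB0 hB z hz
    have h1 := norm_vecMul_toeplitz_le hn hε hε1 (hh j) (hc j) hs hB0 hκ hB
    have hK := stepConst_nonneg ε n
    have h2 := ih (j + 1) (B * s * stepConst ε n) _ (by positivity) h1 z hz
    rw [chainMat, ← Matrix.vecMul_vecMul, show j + (r + 1) = j + 1 + r by ring]
    refine h2.trans (le_of_eq ?_)
    ring

/-- Subtracting `h x` removes the exceptional alternative of the kernel bound: for nearby points the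
increment supplies the factor `||x| - |y||` missing there. For distant points that distance already
controls both scales, and the sum of the two majorants bounds the increment. -/
lemma norm_increment_kernel_le (hn : 1 ≤ n) {C : ℝ} (hC : 0 ≤ C) {H h : ℝ → ℝ}
    (hh : Dominated C H h) {x y : ℝ} (hx : x ∈ freqDomain) (hy : y ∈ freqDomain)
    (hxn : 1 / (n : ℝ) ≤ |x|) :
    |h y - h x| * ‖star (evec n x) ⬝ᵥ evec n y‖ * max (absFloor n x) (absFloor n y) ≤
      (12 + 6 * C) * (H x + H y) := by
  have hHx := hh.bound x hx
  have hHy := hh.bound y hy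
  have hHx0 : 0 ≤ H x := (abs_nonneg _).trans hHx
  have hHy0 : 0 ≤ H y := (abs_nonneg _).trans hHy
  have hx0 := freqDomain_abs_pos hx
  have hy0 := freqDomain_abs_pos hy
  have hk := norm_star_evec_dotProduct_evec_mul_le n hx hy
  set D := ‖star (evec n x) ⬝ᵥ evec n y‖ with hD
  have hD0 : 0 ≤ D := norm_nonneg _
  have hpi := Real.pi_lt_four
  set t := |(|x| - |y|)| with ht
  have hyt : |y| ≤ |x| + t := by
    have := neg_abs_le (|x| - |y|); linarith
  by_cases hc : t ≤ |x| / 2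
  · have hd := hh.diff x hx y hy hc
    have hm : max (absFloor n x) (absFloor n y) ≤ 3 / 2 * |x| := by
      refine max_le (max_le ?_ ?_) (max_le ?_ ?_) <;> linarith
    calc |h y - h x| * D * max (absFloor n x) (absFloor n y)
        ≤ (C * (t / |x|) * H y) * D * (3 / 2 * |x|) := by
          refine mul_le_mul (mul_le_mul_of_nonneg_right hd hD0) hm ?_ ?_
          · exact (absFloor_pos hn).le.trans (le_max_left _ _)
          · have := (abs_nonneg _).trans hd
            positivity
      _ = 3 / 2 * C * H y * (D * t) := by field_simp
      _ ≤ 3 / 2 * C * H y * 4 := by gcongr; linarith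
      _ ≤ _ := by nlinarith [mul_nonneg hC hHx0]
  · push Not at hc
    have hm : max (absFloor n x) (absFloor n y) ≤ 3 * t := by
      refine max_le (max_le ?_ ?_) (max_le ?_ ?_) <;> linarith
    calc |h y - h x| * D * max (absFloor n x) (absFloor n y)
        ≤ (H x + H y) * D * (3 * t) := by
          have a1 := abs_le.1 hHx
          have a2 := abs_le.1 hHy
          have a3 : |h y - h x| ≤ H x + H y :=
            abs_le.2 ⟨by linarith [a1.2, a2.1], by linarith [a1.1, a2.2]⟩
          have a4 : 0 ≤ max (absFloor n x) (absFloor n y) :=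
            (absFloor_pos hn).le.trans (le_max_left _ _)
          gcongr
      _ = 3 * (H x + H y) * (D * t) := by ring
      _ ≤ 3 * (H x + H y) * 4 := by gcongr; exact hk.trans hpi.le
      _ ≤ _ := by nlinarith [mul_nonneg hC hHx0, mul_nonneg hC hHy0]

/-- The remainder of the approximation `e_x^* T_n(h) ≈ 2π h(x) e_x^*`, bounded in the form that the
Schur test propagates. -/
lemma norm_increment_row_le (hn : 1 ≤ n) (hε : 0 < ε) (hε1 : ε < 1) {C s : ℝ} (hC : 0 ≤ C)
    (hs : 0 ≤ s) {H₀ H H' h : ℝ → ℝ} (hh : Dominated C H h)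
    (hc₀ : Compat ε n s H₀ H) (hc : Compat ε n s H H') {x : ℝ} (hx : x ∈ freqDomain)
    (hxn : 1 / (n : ℝ) ≤ |x|) :
    ∀ z ∈ freqDomain, √(H₀ x) * ‖(Matrix.vecMul (star (evec n x)) (toeplitz n h) -
        ((2 * Real.pi * h x : ℝ) : ℂ) • star (evec n x)) ⬝ᵥ evec n z‖ * √(H' z) ≤
      ((24 + 12 * C) * s ^ 2 * stepConst ε n / √(absFloor n x)) * √(singFactor ε n z) /
        √(absFloor n z) := by
  intro z hz
  have hone : ((2 * Real.pi * h x : ℝ) : ℂ) • (star (evec n x) ⬝ᵥ evec n z) =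
      ∫ y in freqDomain, (h x : ℂ) * ((star (evec n x) ⬝ᵥ evec n y) *
        (star (evec n y) ⬝ᵥ evec n z)) := by
    have h1 := dotProduct_toeplitz_mulVec (n := n) (f := fun _ => (1 : ℝ))
      (integrable_const _) (star (evec n x)) (evec n z)
    rw [toeplitz_one, Matrix.smul_mulVec, Matrix.one_mulVec, dotProduct_smul] at h1
    rw [integral_const_mul]
    simp only [Complex.ofReal_one, one_mul] at h1
    rw [← h1]
    push_cast
    simp only [smul_eq_mul]
    ring
  have hrep : (Matrix.vecMul (star (evec n x)) (toeplitz n h) -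
        ((2 * Real.pi * h x : ℝ) : ℂ) • star (evec n x)) ⬝ᵥ evec n z =
      ∫ y in freqDomain, ((h y - h x : ℝ) : ℂ) * ((star (evec n x) ⬝ᵥ evec n y) *
        (star (evec n y) ⬝ᵥ evec n z)) := by
    rw [sub_dotProduct, smul_dotProduct, hone, vecMul_toeplitz_dotProduct hh.integrable,
      ← integral_sub]
    · refine integral_congr_ae (Filter.Eventually.of_forall fun y => ?_)
      push_cast
      ring
    all_goals
      refine IntegrableOn.ofReal_mul_bounded (C := n * n) ?_ ?_ ?_
      · first | exact hh.integrable | exact integrable_const _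
      · exact (continuous_dotProduct_evec _).mul (continuous_star_evec_dotProduct _)
      · intro y
        rw [norm_mul]
        gcongr <;> exact norm_star_evec_dotProduct_evec_le _ _ _
  rw [hrep]
  have e1 : ∀ F : ℝ → ℂ, √(H₀ x) * ‖∫ y in freqDomain, F y‖ * √(H' z) =
      ‖∫ y in freqDomain, ((√(H₀ x) * √(H' z) : ℝ) : ℂ) * F y‖ := by
    intro F
    rw [integral_const_mul, norm_mul, Complex.norm_real, Real.norm_of_nonneg (by positivity)]
    ring
  rw [e1]
  have hz1 : 0 ≤ √(singFactor ε n z) := Real.sqrt_nonneg _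
  refine (norm_integral_kernel_le hn hε hε1
    (Q := (24 + 12 * C) * s ^ 2 * √(singFactor ε n z) / √(absFloor n x))
    (by positivity) hz ?_).trans (le_of_eq (by ring))
  intro y hy
  rw [norm_mul, norm_mul, norm_mul, Complex.norm_real, Complex.norm_real,
    Real.norm_of_nonneg (show 0 ≤ √(H₀ x) * √(H' z) by positivity), Real.norm_eq_abs]
  have hk := norm_increment_kernel_le hn hC hh hx hy hxn
  set D := ‖star (evec n y) ⬝ᵥ evec n z‖
  set D' := ‖star (evec n x) ⬝ᵥ evec n y‖
  have hHx0 : 0 ≤ H x := (abs_nonneg _).trans (hh.bound x hx)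
  have hHy0 : 0 ≤ H y := (abs_nonneg _).trans (hh.bound y hy)
  have hm : 0 < max (absFloor n x) (absFloor n y) := lt_max_of_lt_left (absFloor_pos hn)
  have hωx : √(singFactor ε n x) = 1 := by rw [singFactor_of_le hx hxn, Real.sqrt_one]
  have hωy1 : 1 ≤ singFactor ε n y := one_le_singFactor hε1.le hy
  have hωy : √(singFactor ε n y) * √(singFactor ε n y) = singFactor ε n y :=
    Real.mul_self_sqrt (zero_le_one.trans hωy1)
  set Rxy := √(scaleRatio n x y)
  set Ryz := √(scaleRatio n y z)
  -- Passing through `y` gives the term with `H x` the same bound as the term with `H y`.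
  have hRxz : √(scaleRatio n x z) ≤ Rxy * Ryz := by
    rw [← Real.sqrt_mul (zero_le_one.trans (one_le_scaleRatio hn))]
    exact Real.sqrt_le_sqrt (scaleRatio_le_mul hn)
  have t1 : √(H₀ x) * √(H' z) * H y ≤ s ^ 2 * √(singFactor ε n z) * (Rxy * Ryz) *
      singFactor ε n y := by
    calc √(H₀ x) * √(H' z) * H y = (√(H₀ x) * √(H y)) * (√(H y) * √(H' z)) := by
          linear_combination (-(√(H₀ x) * √(H' z))) * Real.mul_self_sqrt hHy0
      _ ≤ (s * Rxy * (√(singFactor ε n x) * √(singFactor ε n y))) *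
          (s * Ryz * (√(singFactor ε n y) * √(singFactor ε n z))) := by
          exact mul_le_mul (hc₀ x hx y hy) (hc y hy z hz) (by positivity) (by positivity)
      _ = s ^ 2 * √(singFactor ε n z) * (Rxy * Ryz) *
          (√(singFactor ε n y) * √(singFactor ε n y)) := by rw [hωx]; ring
      _ = _ := by rw [hωy]
  have t2 : √(H₀ x) * √(H' z) * H x ≤ s ^ 2 * √(singFactor ε n z) * (Rxy * Ryz) *
      singFactor ε n y := by
    calc √(H₀ x) * √(H' z) * H x = (√(H₀ x) * √(H x)) * (√(H x) * √(H' z)) := by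
          linear_combination (-(√(H₀ x) * √(H' z))) * Real.mul_self_sqrt hHx0
      _ ≤ (s * √(scaleRatio n x x) * (√(singFactor ε n x) * √(singFactor ε n x))) *
          (s * √(scaleRatio n x z) * (√(singFactor ε n x) * √(singFactor ε n z))) := by
          exact mul_le_mul (hc₀ x hx x hx) (hc x hx z hz) (by positivity) (by positivity)
      _ = s ^ 2 * √(singFactor ε n z) * √(scaleRatio n x z) * 1 := by
          rw [hωx, scaleRatio_self hn, Real.sqrt_one]; ring
      _ ≤ _ := by gcongr
  have hk' : |h y - h x| * D' ≤ (12 + 6 * C) * (H x + H y) / max (absFloor n x) (absFloor n y) :=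
    (le_div_iff₀ hm).2 hk
  calc √(H₀ x) * √(H' z) * (|h y - h x| * (D' * D))
      = √(H₀ x) * √(H' z) * (|h y - h x| * D') * D := by ring
    _ ≤ √(H₀ x) * √(H' z) * ((12 + 6 * C) * (H x + H y) /
        max (absFloor n x) (absFloor n y)) * D := by gcongr
    _ = (12 + 6 * C) * (√(H₀ x) * √(H' z) * H x + √(H₀ x) * √(H' z) * H y) /
        max (absFloor n x) (absFloor n y) * D := by ring
    _ ≤ (12 + 6 * C) * (s ^ 2 * √(singFactor ε n z) * (Rxy * Ryz) * singFactor ε n y +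
        s ^ 2 * √(singFactor ε n z) * (Rxy * Ryz) * singFactor ε n y) /
        max (absFloor n x) (absFloor n y) * D := by gcongr
    _ = (24 + 12 * C) * s ^ 2 * √(singFactor ε n z) * (Rxy / max (absFloor n x) (absFloor n y)) *
        (D * Ryz * singFactor ε n y) := by ring
    _ = _ := by
        rw [sqrt_scaleRatio_div_max hn]
        ring

end

/-! ### Diagonal values and the trace approximation. -/

/-- The diagonal value `e_x^* M e_x`. -/
noncomputable def symbolAt {n : ℕ} (M : Matrix (Fin n) (Fin n) ℂ) (x : ℝ) : ℂ :=
  Matrix.vecMul (star (evec n x)) M ⬝ᵥ evec n x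

lemma symbolAt_eq {n : ℕ} (M : Matrix (Fin n) (Fin n) ℂ) (x : ℝ) :
    symbolAt M x = ∑ k, evec n x k * (star (evec n x) ⬝ᵥ fun j => M j k) := by
  unfold symbolAt
  rw [dotProduct]
  refine Finset.sum_congr rfl fun k _ => ?_
  rw [mul_comm]; rfl

lemma continuous_symbolAt {n : ℕ} (M : Matrix (Fin n) (Fin n) ℂ) : Continuous (symbolAt M) := by
  have : symbolAt M = fun x => ∑ k, evec n x k * (star (evec n x) ⬝ᵥ fun j => M j k) :=
    funext (symbolAt_eq M)
  rw [this]
  exact continuous_finsetSum _ fun k _ =>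
    (continuous_evec n k).mul (continuous_star_evec_dotProduct _)

lemma exists_norm_symbolAt_le {n : ℕ} (M : Matrix (Fin n) (Fin n) ℂ) :
    ∃ C, ∀ x, ‖symbolAt M x‖ ≤ C := by
  refine ⟨∑ k, ∑ j, ‖M j k‖, fun x => ?_⟩
  rw [symbolAt_eq]
  refine (norm_sum_le _ _).trans (Finset.sum_le_sum fun k _ => ?_)
  rw [norm_mul, norm_evec, one_mul, dotProduct]
  refine (norm_sum_le _ _).trans (Finset.sum_le_sum fun j _ => ?_)
  rw [norm_mul, Pi.star_apply, norm_star, norm_evec, one_mul]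

lemma integrableOn_mul_symbolAt {n : ℕ} {f : ℝ → ℝ} (hf : IntegrableOn f freqDomain)
    (M : Matrix (Fin n) (Fin n) ℂ) :
    IntegrableOn (fun x => (f x : ℂ) * symbolAt M x) freqDomain := by
  obtain ⟨C, hC⟩ := exists_norm_symbolAt_le M
  exact IntegrableOn.ofReal_mul_bounded hf (continuous_symbolAt M) hC

lemma trace_toeplitz_mul {n : ℕ} {f : ℝ → ℝ} (hf : IntegrableOn f freqDomain)
    (M : Matrix (Fin n) (Fin n) ℂ) :
    (toeplitz n f * M).trace = ∫ x in freqDomain, (f x : ℂ) * symbolAt M x := by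
  have h1 : (toeplitz n f * M).trace =
      ∑ k, (Pi.single k (1 : ℂ) : Fin n → ℂ) ⬝ᵥ (toeplitz n f).mulVec (fun j => M j k) := by
    rw [Matrix.trace]
    refine Finset.sum_congr rfl fun k _ => ?_
    rw [single_dotProduct, one_mul]
    rfl
  rw [h1]
  simp only [dotProduct_toeplitz_mulVec hf, single_dotProduct, one_mul]
  rw [← integral_finsetSum]
  · refine integral_congr_ae (Filter.Eventually.of_forall fun x => ?_)
    beta_reduce
    rw [symbolAt_eq, Finset.mul_sum]
  · intro k _
    refine IntegrableOn.ofReal_mul_bounded hf (C := ∑ j, ‖M j k‖) ?_ ?_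
    · exact (continuous_evec n k).mul (continuous_star_evec_dotProduct _)
    · intro x
      rw [norm_mul, norm_evec, one_mul, dotProduct]
      refine (norm_sum_le _ _).trans (Finset.sum_le_sum fun j _ => ?_)
      rw [norm_mul, Pi.star_apply, norm_star, norm_evec, one_mul]

lemma symbolAt_one (n : ℕ) (x : ℝ) : symbolAt (1 : Matrix (Fin n) (Fin n) ℂ) x = n := by
  rw [symbolAt, Matrix.vecMul_one, dotProduct]
  have : ∀ k, star (evec n x) k * evec n x k = 1 := by
    intro k
    rw [Pi.star_apply, Complex.star_def, mul_comm, Complex.mul_conj, Complex.normSq_eq_norm_sq,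
      norm_evec]
    simp
  rw [Finset.sum_congr rfl fun k _ => this k]
  simp

/-- The constant in `norm_symbolAt_chainMat_sub_le`. -/
noncomputable def diagConst (C : ℝ) : ℕ → ℝ
  | 0 => 0
  | r + 1 => (24 + 12 * C) + 2 * Real.pi * diagConst C r

lemma diagConst_nonneg {C : ℝ} (hC : 0 ≤ C) (r : ℕ) : 0 ≤ diagConst C r := by
  induction r with
  | zero => exact le_rfl
  | succ r ih => have := Real.pi_pos; unfold diagConst; positivity

section
variable {n : ℕ} {ε : ℝ}

/-- The first matrix is peeled off: its remainder row is carried through the rest of the chain by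
the Schur test, and its main part is a scalar multiple of `e_x^*`, to which the induction applies.
The two square roots of the majorant of that scalar are shared between `Compat` at `(x, x)` and the
induction hypothesis. -/
lemma norm_symbolAt_chainMat_sub_le (hn : 1 ≤ n) (hε : 0 < ε) (hε1 : ε < 1) {C s σ : ℝ}
    (hC : 0 ≤ C) {H h : ℕ → ℝ → ℝ} (hh : ∀ j, Dominated C (H j) (h j))
    (hc : ∀ j, Compat ε n s (H j) (H (j + 1))) (hs : 0 ≤ s) (hσ : stepConst ε n ≤ σ)
    (hσ1 : 1 ≤ σ) {x : ℝ} (hx : x ∈ freqDomain) (hxn : 1 / (n : ℝ) ≤ |x|) (r : ℕ) :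
    ∀ j : ℕ, √(H j x) * ‖symbolAt (chainMat n h (j + 1) r) x -
        ((n * (2 * Real.pi) ^ r * ∏ i ∈ Finset.range r, h (j + 1 + i) x : ℝ) : ℂ)‖ *
        √(H (j + 1 + r) x) ≤ diagConst C r * s ^ (r + 1) * σ ^ r / absFloor n x := by
  have hpi := Real.pi_pos
  have hX : 0 < absFloor n x := absFloor_pos hn
  have hstep := stepConst_nonneg ε n
  induction r with
  | zero => intro j; simp [chainMat, symbolAt_one, diagConst]
  | succ r ih =>
    intro j
    set w := Matrix.vecMul (star (evec n x)) (toeplitz n (h (j + 1))) -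
        ((2 * Real.pi * h (j + 1) x : ℝ) : ℂ) • star (evec n x) with hw
    have hsplit : symbolAt (chainMat n h (j + 1) (r + 1)) x -
        ((n * (2 * Real.pi) ^ (r + 1) *
          ∏ i ∈ Finset.range (r + 1), h (j + 1 + i) x : ℝ) : ℂ) =
        Matrix.vecMul w (chainMat n h (j + 2) r) ⬝ᵥ evec n x +
        ((2 * Real.pi * h (j + 1) x : ℝ) : ℂ) * (symbolAt (chainMat n h (j + 1 + 1) r) x -
        ((n * (2 * Real.pi) ^ r * ∏ i ∈ Finset.range r, h (j + 1 + 1 + i) x : ℝ) : ℂ)) := by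
      rw [hw, Matrix.sub_vecMul, sub_dotProduct, Matrix.smul_vecMul, smul_dotProduct,
        Matrix.vecMul_vecMul, Finset.prod_range_succ']
      simp only [symbolAt, chainMat, smul_eq_mul, add_zero]
      have : ∀ i, j + 1 + (i + 1) = j + 1 + 1 + i := fun i => by ring
      rw [Finset.prod_congr rfl fun i _ => by rw [this i]]
      push_cast
      ring
    have h1 := norm_increment_row_le hn hε hε1 hC hs (hh (j + 1)) (hc j) (hc (j + 1)) hx hxn
    have h2 := norm_vecMul_chainMat_le hn hε hε1 hh hc hs (Real.sqrt_nonneg (H j x)) r (j + 2)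
      ((24 + 12 * C) * s ^ 2 * stepConst ε n / √(absFloor n x)) w (by positivity) h1 x hx
    have hsq : √(absFloor n x) * √(absFloor n x) = absFloor n x := Real.mul_self_sqrt hX.le
    have hsX : √(absFloor n x) ≠ 0 := (Real.sqrt_pos.2 hX).ne'
    have h3 : √(H j x) * ‖Matrix.vecMul w (chainMat n h (j + 2) r) ⬝ᵥ evec n x‖ *
        √(H (j + 2 + r) x) ≤ (24 + 12 * C) * s ^ (r + 2) * σ ^ (r + 1) / absFloor n x := by
      refine h2.trans ?_
      rw [singFactor_of_le hx hxn, Real.sqrt_one, mul_one]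
      calc (24 + 12 * C) * s ^ 2 * stepConst ε n / √(absFloor n x) *
            (s * stepConst ε n) ^ r / √(absFloor n x)
          = (24 + 12 * C) * s ^ (r + 2) * stepConst ε n ^ (r + 1) /
            (√(absFloor n x) * √(absFloor n x)) := by field_simp; ring
        _ ≤ (24 + 12 * C) * s ^ (r + 2) * σ ^ (r + 1) /
            (√(absFloor n x) * √(absFloor n x)) := by gcongr
        _ = _ := by rw [hsq]
    have h4 := ih (j + 1)
    have hb := (hh (j + 1)).bound x hx
    have hH : 0 ≤ H (j + 1) x := (abs_nonneg _).trans hb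
    have hcx : √(H j x) * √(H (j + 1) x) ≤ s := by
      have := hc j x hx x hx
      rw [singFactor_of_le hx hxn, scaleRatio_self hn, Real.sqrt_one] at this
      linarith
    rw [hsplit]
    set P := ‖Matrix.vecMul w (chainMat n h (j + 2) r) ⬝ᵥ evec n x‖
    set Q := symbolAt (chainMat n h (j + 1 + 1) r) x -
        ((n * (2 * Real.pi) ^ r * ∏ i ∈ Finset.range r, h (j + 1 + 1 + i) x : ℝ) : ℂ)
    have e1 : j + 1 + (r + 1) = j + 2 + r := by ring
    have e2 : j + 1 + 1 + r = j + 2 + r := by ring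
    rw [e1]
    rw [e2] at h4
    have h5 : ‖((2 * Real.pi * h (j + 1) x : ℝ) : ℂ) * Q‖ ≤
        2 * Real.pi * (√(H (j + 1) x) * √(H (j + 1) x)) * ‖Q‖ := by
      rw [norm_mul, Complex.norm_real, Real.norm_eq_abs, abs_mul, Real.mul_self_sqrt hH,
        abs_of_pos (by positivity : 0 < 2 * Real.pi)]
      gcongr
    have hD := diagConst_nonneg hC r
    calc √(H j x) * ‖_ + _‖ * √(H (j + 2 + r) x)
        ≤ √(H j x) * (P + 2 * Real.pi * (√(H (j + 1) x) * √(H (j + 1) x)) * ‖Q‖) *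
          √(H (j + 2 + r) x) := by
          gcongr
          exact (norm_add_le _ _).trans (add_le_add le_rfl h5)
      _ = √(H j x) * P * √(H (j + 2 + r) x) + 2 * Real.pi * (√(H j x) * √(H (j + 1) x)) *
          (√(H (j + 1) x) * ‖Q‖ * √(H (j + 2 + r) x)) := by ring
      _ ≤ (24 + 12 * C) * s ^ (r + 2) * σ ^ (r + 1) / absFloor n x + 2 * Real.pi * s *
          (diagConst C r * s ^ (r + 1) * σ ^ r / absFloor n x) := by gcongr
      _ ≤ (24 + 12 * C) * s ^ (r + 2) * σ ^ (r + 1) / absFloor n x + 2 * Real.pi * s *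
          (diagConst C r * s ^ (r + 1) * σ ^ (r + 1) / absFloor n x) := by
          gcongr
          exact Nat.le_succ r
      _ = _ := by rw [diagConst]; ring

/-- Below `1/n` the first kernel alternative always holds, so the row `e_x^*` itself can start the
Schur iteration without any subtraction. -/
lemma norm_symbolAt_chainMat_le (hn : 1 ≤ n) (hε : 0 < ε) (hε1 : ε < 1) {C s σ : ℝ}
    {H h : ℕ → ℝ → ℝ} (hh : ∀ j, Dominated C (H j) (h j))
    (hc : ∀ j, Compat ε n s (H j) (H (j + 1))) (hs : 0 ≤ s) (hσ : stepConst ε n ≤ σ)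
    {x : ℝ} (hx : x ∈ freqDomain) (hxn : |x| < 1 / (n : ℝ)) (r j : ℕ) :
    √(H j x) * ‖symbolAt (chainMat n h (j + 1) r) x‖ * √(H (j + 1 + r) x) ≤
      8 * s ^ (r + 1) * σ ^ r * (singFactor ε n x / absFloor n x) := by
  have hX : 0 < absFloor n x := absFloor_pos hn
  have hstep := stepConst_nonneg ε n
  have hω : √(singFactor ε n x) * √(singFactor ε n x) = singFactor ε n x :=
    Real.mul_self_sqrt (zero_le_one.trans (one_le_singFactor hε1.le hx))
  have hω0 : 0 ≤ singFactor ε n x := zero_le_one.trans (one_le_singFactor hε1.le hx)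
  have hsq : √(absFloor n x) * √(absFloor n x) = absFloor n x := Real.mul_self_sqrt hX.le
  have hsX : 0 < √(absFloor n x) := Real.sqrt_pos.2 hX
  have h0 : ∀ y ∈ freqDomain, √(H j x) * ‖star (evec n x) ⬝ᵥ evec n y‖ * √(H (j + 1) y) ≤
      (8 * s * √(singFactor ε n x) / √(absFloor n x)) * √(singFactor ε n y) /
        √(absFloor n y) := by
    intro y hy
    have hm : 0 < max (absFloor n x) (absFloor n y) := lt_max_of_lt_left hX
    have hD : ‖star (evec n x) ⬝ᵥ evec n y‖ ≤ 8 / max (absFloor n x) (absFloor n y) := by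
      rcases norm_kernel_mul_max_le_or hn hx hy with h | h
      · exact (le_div_iff₀ hm).2 h
      · exact absurd h.1 (not_le.2 hxn)
    calc √(H j x) * ‖star (evec n x) ⬝ᵥ evec n y‖ * √(H (j + 1) y)
        = (√(H j x) * √(H (j + 1) y)) * ‖star (evec n x) ⬝ᵥ evec n y‖ := by ring
      _ ≤ (s * √(scaleRatio n x y) * (√(singFactor ε n x) * √(singFactor ε n y))) *
          (8 / max (absFloor n x) (absFloor n y)) :=
          mul_le_mul (hc j x hx y hy) hD (norm_nonneg _) (by positivity)
      _ = 8 * s * (√(singFactor ε n x) * √(singFactor ε n y)) *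
          (√(scaleRatio n x y) / max (absFloor n x) (absFloor n y)) := by ring
      _ = _ := by rw [sqrt_scaleRatio_div_max hn]; field_simp
  have h2 := norm_vecMul_chainMat_le hn hε hε1 hh hc hs (Real.sqrt_nonneg (H j x)) r (j + 1)
      (8 * s * √(singFactor ε n x) / √(absFloor n x)) _ (by positivity) h0 x hx
  refine h2.trans ?_
  calc 8 * s * √(singFactor ε n x) / √(absFloor n x) * (s * stepConst ε n) ^ r *
        √(singFactor ε n x) / √(absFloor n x)
      = 8 * s ^ (r + 1) * stepConst ε n ^ r * ((√(singFactor ε n x) * √(singFactor ε n x)) /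
        (√(absFloor n x) * √(absFloor n x))) := by field_simp; ring
    _ = 8 * s ^ (r + 1) * stepConst ε n ^ r * (singFactor ε n x / absFloor n x) := by
        rw [hω, hsq]
    _ ≤ _ := by gcongr

/-- The constant in `norm_trace_chainMat_sub_le`. -/
noncomputable def traceConst (ε C Cd : ℝ) (r : ℕ) : ℝ :=
  (diagConst C r + 8 + (2 * Real.pi) ^ r * Cd) * (1 + 8 * schurConst ε) ^ r * schurConst ε

lemma traceConst_nonneg {C Cd : ℝ} (hC : 0 ≤ C) (hCd : 0 ≤ Cd) (r : ℕ) :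
    0 ≤ traceConst ε C Cd r := by
  have h1 := diagConst_nonneg hC r
  have h2 := schurConst_nonneg ε
  have h3 := Real.pi_pos
  unfold traceConst; positivity

/-- Approximation of the trace of a product of Toeplitz matrices by the integral of the product
of the symbols. -/
theorem norm_trace_chainMat_sub_le (hn : 1 ≤ n) (hε : 0 < ε) (hε1 : ε < 1) {C Cd s : ℝ}
    (hC : 0 ≤ C) (hCd : 0 ≤ Cd) {H h : ℕ → ℝ → ℝ} (hh : ∀ j, Dominated C (H j) (h j))
    (hc : ∀ j, Compat ε n s (H j) (H (j + 1))) (hs : 0 ≤ s) (r : ℕ) (hcyc : H (r + 1) = H 0)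
    (hdiag : ∀ x ∈ freqDomain, |x| < 1 / (n : ℝ) →
      ∏ i ∈ Finset.range (r + 1), H i x ≤ Cd * s ^ (r + 1) * singFactor ε n x)
    (hint : IntegrableOn (fun x => ∏ i ∈ Finset.range (r + 1), h i x) freqDomain) :
    ‖(chainMat n h 0 (r + 1)).trace - ((n * (2 * Real.pi) ^ r *
        ∫ x in freqDomain, ∏ i ∈ Finset.range (r + 1), h i x : ℝ) : ℂ)‖ ≤
      traceConst ε C Cd r * s ^ (r + 1) * (n : ℝ) ^ ((r + 1) * ε) := by
  have hpi := Real.pi_pos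
  have hn0 : (0 : ℝ) < n := by exact_mod_cast hn
  have hn1 : (1 : ℝ) ≤ n := by exact_mod_cast hn
  have hsc := schurConst_nonneg ε
  have hne1 : 1 ≤ (n : ℝ) ^ ε := Real.one_le_rpow hn1 hε.le
  -- An upper bound for the Schur constant that is at least `1`, so that lower powers may be
  -- replaced by higher ones.
  set σ := (n : ℝ) ^ ε * (1 + 8 * schurConst ε) with hσdef
  have hσ : stepConst ε n ≤ σ := by rw [hσdef, stepConst]; nlinarith
  have hσ1 : 1 ≤ σ := by rw [hσdef]; nlinarith
  have hDr := diagConst_nonneg hC r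
  set K := diagConst C r + 8 + (2 * Real.pi) ^ r * Cd with hK
  have hK0 : 0 ≤ K := by positivity
  set main : ℝ → ℝ := fun x => n * (2 * Real.pi) ^ r * ∏ i ∈ Finset.range r, h (0 + 1 + i) x
    with hmain
  have hprod : ∀ x, h 0 x * main x =
      n * (2 * Real.pi) ^ r * ∏ i ∈ Finset.range (r + 1), h i x := by
    intro x
    rw [Finset.prod_range_succ', hmain]
    simp only [zero_add, add_comm 1]
    ring
  have hpt : ∀ x ∈ freqDomain, ‖(h 0 x : ℂ) * symbolAt (chainMat n h 1 r) x -
      ((n * (2 * Real.pi) ^ r * ∏ i ∈ Finset.range (r + 1), h i x : ℝ) : ℂ)‖ ≤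
      K * s ^ (r + 1) * σ ^ r * (n : ℝ) ^ ε * |x| ^ (ε - 1) := by
    intro x hx
    have hX : 0 < absFloor n x := absFloor_pos hn
    have hb := (hh 0).bound x hx
    have hH : 0 ≤ H 0 x := (abs_nonneg _).trans hb
    have hω1 : 1 ≤ singFactor ε n x := one_le_singFactor hε1.le hx
    have hω0 : 0 ≤ singFactor ε n x := zero_le_one.trans hω1
    rw [mul_assoc _ ((n : ℝ) ^ ε)]
    refine le_trans ?_ (mul_le_mul_of_nonneg_left (singFactor_div_absFloor_le hn hε.le hx)
      (by positivity))
    have hσr : 1 ≤ σ ^ r := one_le_pow₀ hσ1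
    -- The cycle closes: the bound on `|h 0 x|` is `√(H 0 x) * √(H 0 x)`, which supplies the weights
    -- at both ends of the chain.
    have hlast : H (0 + 1 + r) = H 0 := by rw [← hcyc]; congr 1; ring
    rcases le_or_gt (1 / (n : ℝ)) |x| with hxn | hxn
    · have h1 := norm_symbolAt_chainMat_sub_le hn hε hε1 hC hh hc hs hσ hσ1 hx hxn r 0
      rw [hlast] at h1
      rw [← hprod x, Complex.ofReal_mul, ← mul_sub, norm_mul, Complex.norm_real,
        Real.norm_eq_abs]
      calc |h 0 x| * ‖symbolAt (chainMat n h 1 r) x - (main x : ℂ)‖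
          ≤ (√(H 0 x) * √(H 0 x)) * ‖symbolAt (chainMat n h 1 r) x - (main x : ℂ)‖ := by
            rw [Real.mul_self_sqrt hH]; gcongr
        _ = √(H 0 x) * ‖symbolAt (chainMat n h 1 r) x - (main x : ℂ)‖ * √(H 0 x) := by ring
        _ ≤ diagConst C r * s ^ (r + 1) * σ ^ r / absFloor n x := h1
        _ = diagConst C r * s ^ (r + 1) * σ ^ r * (1 / absFloor n x) := by ring
        _ ≤ K * s ^ (r + 1) * σ ^ r * (singFactor ε n x / absFloor n x) := by
            gcongr
            rw [hK]
            have : 0 ≤ (2 * Real.pi) ^ r * Cd := by positivity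
            linarith
    -- On `|x| < 1/n` the diagonal value and the main term are bounded separately; `hdiag` serves
    -- the latter, where `n` is the inverse of `absFloor n x`.
    · have h1 := norm_symbolAt_chainMat_le hn hε hε1 hh hc hs hσ hx hxn r 0
      rw [hlast] at h1
      have hXe : absFloor n x = 1 / n := max_eq_right hxn.le
      have h2 : ‖(h 0 x : ℂ) * symbolAt (chainMat n h 1 r) x‖ ≤
          8 * s ^ (r + 1) * σ ^ r * (singFactor ε n x / absFloor n x) := by
        rw [norm_mul, Complex.norm_real, Real.norm_eq_abs]
        calc |h 0 x| * ‖symbolAt (chainMat n h 1 r) x‖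
            ≤ (√(H 0 x) * √(H 0 x)) * ‖symbolAt (chainMat n h 1 r) x‖ := by
              rw [Real.mul_self_sqrt hH]; gcongr
          _ = √(H 0 x) * ‖symbolAt (chainMat n h 1 r) x‖ * √(H 0 x) := by ring
          _ ≤ _ := h1
      have h3 : ‖((n * (2 * Real.pi) ^ r *
          ∏ i ∈ Finset.range (r + 1), h i x : ℝ) : ℂ)‖ ≤
          (2 * Real.pi) ^ r * Cd * s ^ (r + 1) * σ ^ r *
          (singFactor ε n x / absFloor n x) := by
        rw [Complex.norm_real, Real.norm_eq_abs, abs_mul, Finset.abs_prod,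
          abs_of_nonneg (by positivity : 0 ≤ (n : ℝ) * (2 * Real.pi) ^ r)]
        calc n * (2 * Real.pi) ^ r * ∏ i ∈ Finset.range (r + 1), |h i x|
            ≤ n * (2 * Real.pi) ^ r * (Cd * s ^ (r + 1) * singFactor ε n x) := by
              gcongr
              exact (Finset.prod_le_prod (fun i _ => abs_nonneg _)
                fun i _ => (hh i).bound x hx).trans (hdiag x hx hxn)
          _ = (2 * Real.pi) ^ r * Cd * s ^ (r + 1) * 1 *
              (singFactor ε n x / absFloor n x) := by rw [hXe]; field_simp
          _ ≤ _ := by gcongr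
      refine (norm_sub_le _ _).trans ((add_le_add h2 h3).trans ?_)
      rw [← add_mul, ← add_mul, ← add_mul]
      gcongr
      rw [hK]; linarith
  have hrep : (chainMat n h 0 (r + 1)).trace - ((n * (2 * Real.pi) ^ r *
        ∫ x in freqDomain, ∏ i ∈ Finset.range (r + 1), h i x : ℝ) : ℂ) =
      ∫ x in freqDomain, ((h 0 x : ℂ) * symbolAt (chainMat n h 1 r) x -
      ((n * (2 * Real.pi) ^ r * ∏ i ∈ Finset.range (r + 1), h i x : ℝ) : ℂ)) := by
    rw [integral_sub (integrableOn_mul_symbolAt (hh 0).integrable _)]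
    · rw [integral_complex_ofReal, integral_const_mul,
        ← trace_toeplitz_mul (hh 0).integrable]
      rfl
    · exact (hint.const_mul _).ofReal
  rw [hrep]
  have hI := integrableOn_abs_rpow_freqDomain (r := ε - 1) (by linarith)
  refine (norm_integral_le_of_norm_le (hI.const_mul (K * s ^ (r + 1) * σ ^ r * (n : ℝ) ^ ε))
    ((ae_restrict_mem measurableSet_freqDomain).mono hpt)).trans ?_
  rw [integral_const_mul]
  have hIle : ∫ x in freqDomain, |x| ^ (ε - 1) ≤ schurConst ε := by
    have h1 := (integral_abs_add_rpow_le (r := ε - 1) (by linarith) (c := 0)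
      (by simpa using hpi.le)).2
    simp only [zero_add] at h1
    refine h1.trans ?_
    unfold schurConst
    have : 0 ≤ ∫ u in Set.Ioo (-(2 * Real.pi)) (2 * Real.pi), |u| ^ (ε - 1) :=
      integral_nonneg fun _ => Real.rpow_nonneg (abs_nonneg _) _
    linarith
  have hpow : (n : ℝ) ^ ((r + 1) * ε) = ((n : ℝ) ^ ε) ^ r * (n : ℝ) ^ ε := by
    rw [← pow_succ, ← Real.rpow_natCast, ← Real.rpow_mul hn0.le]
    congr 1; push_cast; ring
  calc K * s ^ (r + 1) * σ ^ r * (n : ℝ) ^ ε * ∫ x in freqDomain, |x| ^ (ε - 1)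
      ≤ K * s ^ (r + 1) * σ ^ r * (n : ℝ) ^ ε * schurConst ε := by gcongr
    _ = _ := by rw [hpow, traceConst, ← hK, hσdef, mul_pow]; ring

end

/-! ### Majorants furnished by the classes `Γ₁`. -/

/-- The majorant `∑ᵢ minₖ c i k |x|^(-α i k - ε) L ε` of the class `⊕ᵢ ⋂ₖ Γ₁(c i k, α i k, L)`. -/
noncomputable def sumInfPow {m q : ℕ} (c α : Fin m → Fin q → ℝ) (l ε x : ℝ) : ℝ :=
  ∑ i, ⨅ k, c i k * |x| ^ (-α i k - ε) * l

lemma isOpen_freqDomain : IsOpen freqDomain :=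
  isOpen_Ioo.sdiff isClosed_singleton

/-- By evenness both points may be taken positive, and the mean value inequality applies on the
segment between `|x|` and `|y|`, where every point is comparable to both. -/
lemma abs_sub_le_of_mem_GammaOne {c α l ε M : ℝ} {L h : ℝ → ℝ} (hh : h ∈ GammaOne c α L)
    (hε : 0 < ε)
    (hε1 : ε ≤ 1) (hl : l = L ε) (hc : 0 ≤ c) (hl0 : 0 ≤ l) (hα : |α| ≤ M) {x y : ℝ}
    (hx : x ∈ freqDomain)
    (hy : y ∈ freqDomain) (hxy : |(|x| - |y|)| ≤ |x| / 2) :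
    |h y - h x| ≤ (2 * 3 ^ (M + 1)) * (|(|x| - |y|)| / |x|) * (c * |y| ^ (-α - ε) * l) := by
  obtain ⟨heven, -, hdiff, hbd⟩ := hh
  have hx0 := freqDomain_abs_pos hx
  have hy0 := freqDomain_abs_pos hy
  have habs : ∀ z ∈ freqDomain, h z = h |z| := by
    intro z hz
    rcases abs_choice z with h1 | h1 <;> rw [h1]
    exact (heven z hz).symm
  rw [habs y hy, habs x hx]
  have hxy' := abs_le.1 hxy
  have hs : ∀ ξ ∈ Set.uIcc |x| |y|, ξ ∈ freqDomain ∧ |x| / 2 ≤ ξ ∧ ξ ≤ 3 * |y| ∧ |y| ≤ 3 * ξ := by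
    intro ξ hξ
    have h1 := freqDomain_abs_lt hx
    have h2 := freqDomain_abs_lt hy
    rcases le_total |x| |y| with hle | hle
    · rw [Set.uIcc_of_le hle] at hξ
      refine ⟨?_, by linarith [hξ.1], by linarith [hξ.2], by linarith [hξ.1]⟩
      rw [mem_freqDomain_iff, abs_of_pos (by linarith [hξ.1])]
      exact ⟨by linarith [hξ.1], by linarith [hξ.2]⟩
    · rw [Set.uIcc_of_ge hle] at hξ
      refine ⟨?_, by linarith [hξ.1], by linarith [hξ.2], by linarith [hξ.1]⟩
      rw [mem_freqDomain_iff, abs_of_pos (by linarith [hξ.1])]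
      exact ⟨by linarith [hξ.1], by linarith [hξ.2]⟩
  have hbound : ∀ ξ ∈ Set.uIcc |x| |y|, ‖deriv h ξ‖ ≤
      (2 * 3 ^ (M + 1)) * (c * |y| ^ (-α - ε) * l) / |x| := by
    intro ξ hξ
    obtain ⟨h1, h2, h3, h4⟩ := hs ξ hξ
    have hξ0 : 0 < ξ := by linarith
    have h5 := hbd ξ h1 ε hε
    rw [← hl, abs_mul, abs_of_pos hξ0] at h5
    have h6 : ξ * |deriv h ξ| ≤ c * ξ ^ (-α - ε) * l := by linarith [abs_nonneg (h ξ)]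
    -- The ratio `ξ / |y|` lies in `[1/3, 3]`, and the exponent has modulus at most `M + 1`.
    have h7 : ξ ^ (-α - ε) ≤ 3 ^ (M + 1) * |y| ^ (-α - ε) := by
      have e1 : ξ = (ξ / |y|) * |y| := by field_simp
      have hq : 0 < ξ / |y| := by positivity
      rw [e1, Real.mul_rpow hq.le hy0.le]
      refine mul_le_mul_of_nonneg_right ?_ (Real.rpow_nonneg hy0.le _)
      have hα' := abs_le.1 hα
      rcases le_total 0 (-α - ε) with h0 | h0
      · calc (ξ / |y|) ^ (-α - ε) ≤ 3 ^ (-α - ε) := by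
              refine Real.rpow_le_rpow hq.le ?_ h0
              rw [div_le_iff₀ hy0]; exact h3
          _ ≤ _ := Real.rpow_le_rpow_of_exponent_le (by norm_num) (by linarith)
      · rw [← inv_inv (ξ / |y|), Real.inv_rpow (by positivity), ← Real.rpow_neg (by positivity)]
        calc ((ξ / |y|)⁻¹) ^ (-(-α - ε)) ≤ 3 ^ (-(-α - ε)) := by
              refine Real.rpow_le_rpow (by positivity) ?_ (by linarith)
              rw [inv_div, div_le_iff₀ hξ0]; exact h4
          _ ≤ _ := Real.rpow_le_rpow_of_exponent_le (by norm_num) (by linarith)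
    rw [Real.norm_eq_abs, le_div_iff₀ hx0]
    calc |deriv h ξ| * |x| ≤ |deriv h ξ| * (2 * ξ) := by gcongr; linarith
      _ = 2 * (ξ * |deriv h ξ|) := by ring
      _ ≤ 2 * (c * ξ ^ (-α - ε) * l) := by gcongr
      _ ≤ 2 * (c * (3 ^ (M + 1) * |y| ^ (-α - ε)) * l) := by gcongr
      _ = _ := by ring
  have hd : ∀ ξ ∈ Set.uIcc |x| |y|, DifferentiableAt ℝ h ξ := fun ξ hξ =>
    (hdiff.differentiableOn one_ne_zero).differentiableAt (isOpen_freqDomain.mem_nhds (hs ξ hξ).1)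
  have := (convex_uIcc |x| |y|).norm_image_sub_le_of_norm_deriv_le hd hbound
    Set.left_mem_uIcc Set.right_mem_uIcc
  rw [Real.norm_eq_abs, Real.norm_eq_abs, abs_sub_comm |y| |x|] at this
  refine this.trans (le_of_eq ?_)
  ring

lemma InSumInter.dominated {m q : ℕ} [NeZero q] {c α : Fin m → Fin q → ℝ} {L h : ℝ → ℝ} {ε M : ℝ}
    (hh : InSumInter c α L h) (hε : 0 < ε) (hε1 : ε ≤ 1) (hc : ∀ i k, 0 < c i k)
    (hL : 0 < L ε) (hα : ∀ i k, |α i k| ≤ M) :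
    Dominated (2 * 3 ^ (M + 1)) (sumInfPow c α (L ε) ε) h := by
  obtain ⟨u, hu, hsum⟩ := hh
  have hub : ∀ i, ∀ x ∈ freqDomain, |u i x| ≤ ⨅ k, c i k * |x| ^ (-α i k - ε) * L ε := by
    intro i x hx
    refine le_ciInf fun k => ?_
    have := (hu i k).2.2.2 x hx ε hε
    linarith [abs_nonneg (x * deriv (u i) x)]
  refine ⟨?_, ?_, ?_⟩
  · have : IntegrableOn (fun x => ∑ i, u i x) freqDomain :=
      integrable_finsetSum _ fun i _ => (hu i 0).2.1
    exact this.congr_fun (fun x hx => (hsum x hx).symm) measurableSet_freqDomain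
  · intro x hx
    rw [hsum x hx]
    exact (Finset.abs_sum_le_sum_abs _ _).trans (Finset.sum_le_sum fun i _ => hub i x hx)
  · intro x hx y hy hxy
    rw [hsum x hx, hsum y hy, ← Finset.sum_sub_distrib, sumInfPow, Finset.mul_sum]
    refine (Finset.abs_sum_le_sum_abs _ _).trans (Finset.sum_le_sum fun i _ => ?_)
    rw [Real.mul_iInf_of_nonneg (by have := freqDomain_abs_pos hx; positivity)]
    exact le_ciInf fun k => abs_sub_le_of_mem_GammaOne (hu i k) hε hε1 rfl (hc i k).le
      hL.le (hα i k) hx hy hxy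

lemma sumInfPow_nonneg {m q : ℕ} [NeZero q] {c α : Fin m → Fin q → ℝ} {l ε : ℝ} (x : ℝ)
    (hc : ∀ i k, 0 < c i k) (hl : 0 ≤ l) : 0 ≤ sumInfPow c α l ε x :=
  Finset.sum_nonneg fun i _ => le_ciInf fun k => by have := hc i k; positivity

lemma iInf_pow_le {q : ℕ} (f : Fin q → ℝ) (k : Fin q) : ⨅ k, f k ≤ f k :=
  ciInf_le (Set.finite_range _).bddBelow k

section
variable {n : ℕ} {ε x y : ℝ}

lemma absFloor_rpow_le (hn : 1 ≤ n) (hx : x ∈ freqDomain) {s M : ℝ} (hM : |s| ≤ M) :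
    absFloor n x ^ (-s) ≤ Real.pi ^ M * (n : ℝ) ^ max s 0 := by
  have hX : 0 < absFloor n x := absFloor_pos hn
  have hn0 : (0 : ℝ) < n := by exact_mod_cast hn
  have hpi := Real.pi_gt_three
  have hM' := abs_le.1 hM
  have hM0 : 0 ≤ M := (abs_nonneg _).trans hM
  rcases le_total 0 s with h | h
  · rw [max_eq_left h, Real.rpow_neg hX.le, ← Real.inv_rpow hX.le]
    have h1 : (absFloor n x)⁻¹ ^ s ≤ (n : ℝ) ^ s := by
      refine Real.rpow_le_rpow (inv_nonneg.2 hX.le) ?_ h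
      rw [inv_le_comm₀ hX hn0, ← one_div]
      exact inv_le_absFloor
    refine h1.trans (le_mul_of_one_le_left (by positivity) ?_)
    exact Real.one_le_rpow (by linarith) hM0
  · rw [max_eq_right h, Real.rpow_zero, mul_one]
    calc absFloor n x ^ (-s) ≤ Real.pi ^ (-s) :=
          Real.rpow_le_rpow hX.le (absFloor_le_pi hn hx) (by linarith)
      _ ≤ _ := Real.rpow_le_rpow_of_exponent_le (by linarith) (by linarith)

lemma abs_rpow_eq (hn : 1 ≤ n) (hx : x ∈ freqDomain) (b : ℝ) :
    |x| ^ (-b) = absFloor n x ^ (-b) * (absFloor n x / |x|) ^ b := by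
  have hX : 0 < absFloor n x := absFloor_pos hn
  have hx0 := freqDomain_abs_pos hx
  rw [Real.div_rpow hX.le hx0.le, Real.rpow_neg hX.le, Real.rpow_neg hx0.le]
  have : absFloor n x ^ b ≠ 0 := (Real.rpow_pos_of_pos hX _).ne'
  field_simp

lemma one_le_absFloor_div (hx : x ∈ freqDomain) : 1 ≤ absFloor n x / |x| := by
  rw [one_le_div (freqDomain_abs_pos hx)]; exact abs_le_absFloor

/-- Only the sum `b + b'` costs a power of `n`. Moving both powers to the larger of the two scales
leaves a ratio with exponent at most `1`, absorbed by `scaleRatio`; the part below `1/n` goes into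
`singFactor`. -/
lemma abs_rpow_mul_abs_rpow_le (hn : 1 ≤ n) (hx : x ∈ freqDomain) (hy : y ∈ freqDomain)
    {b b' M : ℝ} (hb : b ≤ 1 - ε) (hb' : b' ≤ 1 - ε) (hε : 0 ≤ ε) (hM : |b + b'| ≤ M) :
    |x| ^ (-b) * |y| ^ (-b') ≤ Real.pi ^ M * (n : ℝ) ^ max (b + b') 0 *
      (scaleRatio n x y * (singFactor ε n x * singFactor ε n y)) := by
  have hX : 0 < absFloor n x := absFloor_pos hn
  have hY : 0 < absFloor n y := absFloor_pos hn
  have hωx : (absFloor n x / |x|) ^ b ≤ singFactor ε n x :=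
    Real.rpow_le_rpow_of_exponent_le (one_le_absFloor_div hx) hb
  have hωy : (absFloor n y / |y|) ^ b' ≤ singFactor ε n y :=
    Real.rpow_le_rpow_of_exponent_le (one_le_absFloor_div hy) hb'
  have hR : 1 ≤ scaleRatio n x y := one_le_scaleRatio hn
  have key : absFloor n x ^ (-b) * absFloor n y ^ (-b') ≤
      Real.pi ^ M * (n : ℝ) ^ max (b + b') 0 * scaleRatio n x y := by
    rcases le_total (absFloor n x) (absFloor n y) with h | h
    · have e : absFloor n x ^ (-b) * absFloor n y ^ (-b') =
          absFloor n y ^ (-(b + b')) * (absFloor n y / absFloor n x) ^ b := by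
        rw [Real.div_rpow hY.le hX.le, neg_add, Real.rpow_add hY, Real.rpow_neg hX.le,
          Real.rpow_neg hY.le b]
        have : absFloor n y ^ b ≠ 0 := (Real.rpow_pos_of_pos hY _).ne'
        field_simp
      rw [e]
      refine mul_le_mul (absFloor_rpow_le hn hy hM) ?_ (by positivity) (by positivity)
      calc (absFloor n y / absFloor n x) ^ b ≤ (absFloor n y / absFloor n x) ^ (1 : ℝ) :=
            Real.rpow_le_rpow_of_exponent_le ((one_le_div hX).2 h) (by linarith)
        _ ≤ _ := by rw [Real.rpow_one]; exact le_max_right _ _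
    · have e : absFloor n x ^ (-b) * absFloor n y ^ (-b') =
          absFloor n x ^ (-(b + b')) * (absFloor n x / absFloor n y) ^ b' := by
        rw [Real.div_rpow hX.le hY.le, neg_add, Real.rpow_add hX, Real.rpow_neg hY.le,
          Real.rpow_neg hX.le b']
        have : absFloor n x ^ b' ≠ 0 := (Real.rpow_pos_of_pos hX _).ne'
        field_simp
      rw [e]
      refine mul_le_mul (absFloor_rpow_le hn hx hM) ?_ (by positivity) (by positivity)
      calc (absFloor n x / absFloor n y) ^ b' ≤ (absFloor n x / absFloor n y) ^ (1 : ℝ) :=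
            Real.rpow_le_rpow_of_exponent_le ((one_le_div hY).2 h) (by linarith)
        _ ≤ _ := by rw [Real.rpow_one]; exact le_max_left _ _
  rw [abs_rpow_eq hn hx, abs_rpow_eq hn hy]
  calc absFloor n x ^ (-b) * (absFloor n x / |x|) ^ b *
        (absFloor n y ^ (-b') * (absFloor n y / |y|) ^ b')
      = (absFloor n x ^ (-b) * absFloor n y ^ (-b')) *
        ((absFloor n x / |x|) ^ b * (absFloor n y / |y|) ^ b') := by ring
    _ ≤ (Real.pi ^ M * (n : ℝ) ^ max (b + b') 0 * scaleRatio n x y) *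
        (singFactor ε n x * singFactor ε n y) := by
        have h1 : 0 ≤ (absFloor n x / |x|) ^ b := by positivity
        have h2 : 0 ≤ (absFloor n y / |y|) ^ b' := by positivity
        exact mul_le_mul key (mul_le_mul hωx hωy h2 (h1.trans hωx)) (by positivity)
          (by positivity)
    _ = _ := by ring

/-- The exponent `1/p` is chosen so that `p` such factors multiply to a single integrable
`singFactor`; this is the role of the condition on `p` times the gap. -/
lemma abs_rpow_le_singFactor (hn : 1 ≤ n) (hx : x ∈ freqDomain) {g M : ℝ} {p : ℕ} (hp : 1 ≤ p)
    (hg : p * max g 0 ≤ 1 - ε) (hM : |g| ≤ M) :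
    |x| ^ (-g) ≤ Real.pi ^ M * (n : ℝ) ^ max g 0 * singFactor ε n x ^ (1 / (p : ℝ)) := by
  have hX : 0 < absFloor n x := absFloor_pos hn
  have hx0 := freqDomain_abs_pos hx
  have hp0 : (0 : ℝ) < p := by exact_mod_cast hp
  rw [abs_rpow_eq hn hx]
  refine mul_le_mul (absFloor_rpow_le hn hx hM) ?_ (by positivity) (by positivity)
  rw [singFactor, ← Real.rpow_mul (by positivity)]
  refine Real.rpow_le_rpow_of_exponent_le (one_le_absFloor_div hx) ?_
  rw [mul_one_div, le_div_iff₀ hp0]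
  nlinarith [le_max_left g 0]

end

section
variable {m q : ℕ} {n p : ℕ} {ε η M : ℝ}

/-- In the product of the two sums the pair `(i, k)` carries an infimum over a column index and one
over a row index. The selection evaluates each at an index of its choice. -/
lemma sumInfPow_mul_sumInfPow_le [NeZero m] (s : Selection m q) {e b cbar αbar : Fin m → Fin q → ℝ}
    {l x y : ℝ} (hl : 0 ≤ l) (he : ∀ i k, 0 < e i k) (hcb : ∀ i k, 0 < cbar i k) :
    sumInfPow e b l ε x * sumInfPow (fun k i => 1 / cbar i k) (fun k i => -αbar i k) l ε y ≤
      ∑ i, ∑ k, l ^ 2 * (e i (s.col i k) / cbar (s.row i k) k) *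
        (|x| ^ (-(b i (s.col i k) + ε)) * |y| ^ (-(-αbar (s.row i k) k + ε))) := by
  unfold sumInfPow
  rw [Finset.sum_mul_sum]
  refine Finset.sum_le_sum fun i _ => Finset.sum_le_sum fun k _ => ?_
  have h1 := iInf_pow_le (fun k => e i k * |x| ^ (-b i k - ε) * l) (s.col i k)
  have h2 := iInf_pow_le (fun i => 1 / cbar i k * |y| ^ (- -αbar i k - ε) * l) (s.row i k)
  have hc := hcb (s.row i k) k
  have he' := he i (s.col i k)
  refine (mul_le_mul h1 h2 (le_ciInf fun i => ?_) (by positivity)).trans (le_of_eq ?_)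
  · have := hcb i k; positivity
  · rw [neg_add', neg_add']
    ring

/-- The constant in the compatibility of the majorants. -/
noncomputable def compatConst (l M : ℝ) : ℝ := l ^ 2 * Real.pi ^ (2 * M + 2)

lemma compatConst_nonneg (l M : ℝ) : 0 ≤ compatConst l M := by
  have := Real.pi_pos; unfold compatConst; positivity

lemma rpow_max_gap_le (hn : 1 ≤ n) (hε : 0 ≤ ε) (g : ℝ) :
    (n : ℝ) ^ max (g + 2 * ε) 0 ≤ (n : ℝ) ^ (max g 0 + 2 * ε) := by
  refine Real.rpow_le_rpow_of_exponent_le (by exact_mod_cast hn) ?_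
  refine max_le ?_ ?_
  · linarith [le_max_left g 0]
  · linarith [le_max_right g 0]

lemma sumInfPow_mul_le_deltaSum [NeZero m] (hn : 1 ≤ n) (s : Selection m q)
    {e b cbar αbar : Fin m → Fin q → ℝ}
    {l x y : ℝ} (hl : 0 ≤ l) (hε : 0 ≤ ε) (hε1 : ε ≤ 1) (hεη : 2 * ε ≤ η)
    (he : ∀ i k, 0 < e i k) (hcb : ∀ i k, 0 < cbar i k)
    (hb : ∀ i k, |b i k| ≤ M) (ha : ∀ i k, |αbar i k| ≤ M)
    (hb1 : ∀ i k, b i (s.col i k) < 1 - η) (ha1 : ∀ i k, -1 + η < αbar (s.row i k) k)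
    (hx : x ∈ freqDomain) (hy : y ∈ freqDomain) :
    sumInfPow e b l ε x * sumInfPow (fun k i => 1 / cbar i k) (fun k i => -αbar i k) l ε y ≤
      compatConst l M * deltaSum s e cbar b αbar (2 * ε) n *
        (scaleRatio n x y * (singFactor ε n x * singFactor ε n y)) := by
  refine (sumInfPow_mul_sumInfPow_le s hl he hcb).trans ?_
  rw [deltaSum, Finset.mul_sum, Finset.sum_mul]
  refine Finset.sum_le_sum fun i _ => ?_
  rw [Finset.mul_sum, Finset.sum_mul]
  refine Finset.sum_le_sum fun k _ => ?_
  have hc := hcb (s.row i k) k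
  have he' := he i (s.col i k)
  have hgap : b i (s.col i k) + ε + (-αbar (s.row i k) k + ε) = gap s b αbar i k + 2 * ε := by
    unfold gap; ring
  have h1 := abs_rpow_mul_abs_rpow_le hn hx hy (ε := ε) (b := b i (s.col i k) + ε)
    (b' := -αbar (s.row i k) k + ε) (M := 2 * M + 2) (by linarith [hb1 i k])
    (by linarith [ha1 i k]) hε (by
      have h1 := abs_le.1 (hb i (s.col i k))
      have h2 := abs_le.1 (ha (s.row i k) k)
      exact abs_le.2 ⟨by linarith, by linarith⟩)
  rw [hgap] at h1
  have hR : 0 ≤ scaleRatio n x y := zero_le_one.trans (one_le_scaleRatio hn)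
  have hωx : 0 ≤ singFactor ε n x := zero_le_one.trans (one_le_singFactor hε1 hx)
  have hωy : 0 ≤ singFactor ε n y := zero_le_one.trans (one_le_singFactor hε1 hy)
  have hpi := Real.pi_pos
  calc l ^ 2 * (e i (s.col i k) / cbar (s.row i k) k) *
        (|x| ^ (-(b i (s.col i k) + ε)) * |y| ^ (-(-αbar (s.row i k) k + ε)))
      ≤ l ^ 2 * (e i (s.col i k) / cbar (s.row i k) k) *
        (Real.pi ^ (2 * M + 2) * (n : ℝ) ^ (max (gap s b αbar i k) 0 + 2 * ε) *
        (scaleRatio n x y * (singFactor ε n x * singFactor ε n y))) := by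
        refine mul_le_mul_of_nonneg_left (h1.trans ?_) (by positivity)
        have := rpow_max_gap_le hn hε (gap s b αbar i k)
        gcongr
    _ = _ := by unfold compatConst; ring

lemma sumInfPow_mul_self_le_deltaSum [NeZero m] (hn : 1 ≤ n) (hp : 1 ≤ p) (s : Selection m q)
    {e b cbar αbar : Fin m → Fin q → ℝ}
    {l x : ℝ} (hl : 0 ≤ l) (hε : 0 ≤ ε) (hε1 : ε ≤ 1) (hεη : (2 * p + 1) * ε ≤ η)
    (he : ∀ i k, 0 < e i k) (hcb : ∀ i k, 0 < cbar i k)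
    (hb : ∀ i k, |b i k| ≤ M) (ha : ∀ i k, |αbar i k| ≤ M)
    (hgap : ∀ i k, (p : ℝ) * max (gap s b αbar i k) 0 < 1 - η)
    (hx : x ∈ freqDomain) :
    sumInfPow e b l ε x * sumInfPow (fun k i => 1 / cbar i k) (fun k i => -αbar i k) l ε x ≤
      compatConst l M * deltaSum s e cbar b αbar (2 * ε) n *
        singFactor ε n x ^ (1 / (p : ℝ)) := by
  refine (sumInfPow_mul_sumInfPow_le s hl he hcb).trans ?_
  rw [deltaSum, Finset.mul_sum, Finset.sum_mul]
  refine Finset.sum_le_sum fun i _ => ?_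
  rw [Finset.mul_sum, Finset.sum_mul]
  refine Finset.sum_le_sum fun k _ => ?_
  have hc := hcb (s.row i k) k
  have he' := he i (s.col i k)
  have hx0 := freqDomain_abs_pos hx
  have hp0 : (0 : ℝ) < p := by exact_mod_cast hp
  have hpow : |x| ^ (-(b i (s.col i k) + ε)) * |x| ^ (-(-αbar (s.row i k) k + ε)) =
      |x| ^ (-(gap s b αbar i k + 2 * ε)) := by
    rw [← Real.rpow_add hx0]; congr 1; unfold gap; ring
  have hmax : max (gap s b αbar i k + 2 * ε) 0 ≤ max (gap s b αbar i k) 0 + 2 * ε :=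
    max_le (by linarith [le_max_left (gap s b αbar i k) 0])
      (by linarith [le_max_right (gap s b αbar i k) 0])
  have h1 := abs_rpow_le_singFactor hn hx (ε := ε) (g := gap s b αbar i k + 2 * ε)
    (M := 2 * M + 2) hp (by nlinarith [hgap i k]) (by
      have h1 := abs_le.1 (hb i (s.col i k))
      have h2 := abs_le.1 (ha (s.row i k) k)
      unfold gap
      exact abs_le.2 ⟨by linarith, by linarith⟩)
  rw [hpow]
  have hωx : 0 ≤ singFactor ε n x := zero_le_one.trans (one_le_singFactor hε1 hx)
  have hpi := Real.pi_pos
  calc l ^ 2 * (e i (s.col i k) / cbar (s.row i k) k) * |x| ^ (-(gap s b αbar i k + 2 * ε))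
      ≤ l ^ 2 * (e i (s.col i k) / cbar (s.row i k) k) *
        (Real.pi ^ (2 * M + 2) * (n : ℝ) ^ (max (gap s b αbar i k) 0 + 2 * ε) *
        singFactor ε n x ^ (1 / (p : ℝ))) := by
        refine mul_le_mul_of_nonneg_left (h1.trans ?_) (by positivity)
        have := rpow_max_gap_le hn hε (gap s b αbar i k)
        gcongr
    _ = _ := by unfold compatConst; ring

lemma deltaSum_nonneg {s : Selection m q} {e cbar b αbar : Fin m → Fin q → ℝ}
    (he : ∀ i k, 0 < e i k) (hcb : ∀ i k, 0 < cbar i k) : 0 ≤ deltaSum s e cbar b αbar ε n :=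
  Finset.sum_nonneg fun i _ => Finset.sum_nonneg fun k _ => by
    have := he i (s.col i k); have := hcb (s.row i k) k; positivity

lemma deltaSum_mul_rpow (hn : 1 ≤ n) {s : Selection m q} {e cbar b αbar : Fin m → Fin q → ℝ}
    (ε' : ℝ) : deltaSum s e cbar b αbar ε n * (n : ℝ) ^ ε' =
      deltaSum s e cbar b αbar (ε + ε') n := by
  have hn0 : (0 : ℝ) < n := by exact_mod_cast hn
  unfold deltaSum
  rw [Finset.sum_mul]
  refine Finset.sum_congr rfl fun i _ => ?_
  rw [Finset.sum_mul]
  refine Finset.sum_congr rfl fun k _ => ?_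
  rw [mul_assoc, ← Real.rpow_add hn0, add_assoc]

end

/-! ### Trace approximation for alternating products. -/

/-- The sequence `a 0, b 0, a 1, b 1, …`. -/
def interleave {X : Type*} (a b : ℕ → X) (j : ℕ) : X := if j % 2 = 0 then a (j / 2) else b (j / 2)

lemma interleave_even {X : Type*} (a b : ℕ → X) (j : ℕ) : interleave a b (2 * j) = a j := by
  simp [interleave]

lemma interleave_odd {X : Type*} (a b : ℕ → X) (j : ℕ) : interleave a b (2 * j + 1) = b j := by
  have h1 : (2 * j + 1) % 2 = 1 := by omega
  have h2 : (2 * j + 1) / 2 = j := by omega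
  simp [interleave, h1, h2]

lemma forall_interleave {P : ℕ → Prop} (h0 : ∀ j, P (2 * j)) (h1 : ∀ j, P (2 * j + 1)) (j : ℕ) :
    P j := by
  rcases Nat.even_or_odd' j with ⟨k, rfl | rfl⟩
  · exact h0 k
  · exact h1 k

lemma prod_interleave (a b : ℕ → ℝ → ℝ) (p : ℕ) (x : ℝ) :
    ∏ i ∈ Finset.range (2 * p), interleave a b i x = ∏ l ∈ Finset.range p, a l x * b l x := by
  induction p with
  | zero => simp
  | succ p ih =>
    rw [Finset.prod_range_succ, ← ih, show 2 * (p + 1) = 2 * p + 1 + 1 by ring,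
      Finset.prod_range_succ, Finset.prod_range_succ, interleave_even, interleave_odd, mul_assoc]

lemma chainMat_interleave (n : ℕ) (a b : ℕ → ℝ → ℝ) (p : ℕ) : ∀ j,
    chainMat n (interleave a b) (2 * j) (2 * p) =
      ((List.range' j p).map fun l => toeplitz n (a l) * toeplitz n (b l)).prod := by
  induction p with
  | zero => intro j; simp [chainMat]
  | succ p ih =>
    intro j
    rw [show 2 * (p + 1) = 2 * p + 1 + 1 by ring, chainMat, chainMat, interleave_even,
      interleave_odd, show 2 * j + 1 + 1 = 2 * (j + 1) by ring, ih, List.range'_succ,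
      List.map_cons, List.prod_cons, Matrix.mul_assoc]

lemma ofFn_eq_map_range' {X : Type*} {p : ℕ} (F : ℕ → X) :
    (List.ofFn fun l : Fin p => F l) = (List.range' 0 p).map F := by
  refine List.ext_getElem (by simp) fun i h1 h2 => ?_
  simp

/-- Extension of a family indexed by `Fin p` to all natural numbers. -/
def finExtend {X : Type*} {p : ℕ} [NeZero p] (a : Fin p → X) (l : ℕ) : X := a (Fin.ofNat p l)

lemma finExtend_coe {X : Type*} {p : ℕ} [NeZero p] (a : Fin p → X) (l : Fin p) :
    finExtend a (l : ℕ) = a l := by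
  simp [finExtend]

section
variable {m q : ℕ} [NeZero m] [NeZero q] {n p : ℕ} [NeZero p] {ε η M : ℝ}

lemma Compat.symm {s : ℝ} {H H' : ℝ → ℝ} (h : Compat ε n s H H') : Compat ε n s H' H := by
  intro x hx y hy
  have := h y hy x hx
  rw [scaleRatio_comm]
  linarith

/-- The chain theorem is applied to `u 0, v 0, u 1, v 1, …`, of length `2 * p`, with majorants
alternating between `G` and `V`. Products at two different points give `Compat`; products at one
point give integrability and the bound near the origin. -/
lemma integrableOn_prod_and_norm_trace_sub_le (hn : 1 ≤ n) (s : Selection m q)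
    {e b cbar αbar : Fin m → Fin q → ℝ} {L : ℝ → ℝ} (hL : 0 < L ε) (hε : 0 < ε) (hε1 : ε < 1)
    (hεη : (2 * p + 1) * ε ≤ η) (he : ∀ i k, 0 < e i k) (hcb : ∀ i k, 0 < cbar i k)
    (hb : ∀ i k, |b i k| ≤ M) (ha : ∀ i k, |αbar i k| ≤ M)
    (hb1 : ∀ i k, b i (s.col i k) < 1 - η) (ha1 : ∀ i k, -1 + η < αbar (s.row i k) k)
    (hgap : ∀ i k, (p : ℝ) * max (gap s b αbar i k) 0 < 1 - η)
    {u v : Fin p → ℝ → ℝ} (hu : ∀ l, InSumInter e b L (u l))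
    (hv : ∀ l, InSumInter (fun k i => 1 / cbar i k) (fun k i => -αbar i k) L (v l)) :
    IntegrableOn (fun x => ∏ l, u l x * v l x) freqDomain ∧
    ‖(List.ofFn fun l : Fin p => toeplitz n (u l) * toeplitz n (v l)).prod.trace -
        ((n * (2 * Real.pi) ^ (2 * p - 1) *
          ∫ x in freqDomain, ∏ l, u l x * v l x : ℝ) : ℂ)‖ ≤
      traceConst ε (2 * 3 ^ (M + 1)) 1 (2 * p - 1) * compatConst (L ε) M ^ p *
        deltaSum s e cbar b αbar (4 * ε) n ^ p := by
  have hp : 1 ≤ p := NeZero.one_le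
  have hp0 : (1 : ℝ) ≤ p := by exact_mod_cast hp
  have hn0 : (0 : ℝ) < n := by exact_mod_cast hn
  set G := sumInfPow e b (L ε) ε with hG
  set V := sumInfPow (fun k i => 1 / cbar i k) (fun k i => -αbar i k) (L ε) ε with hV
  have hG0 : ∀ x, 0 ≤ G x := fun x => sumInfPow_nonneg x he hL.le
  have hV0 : ∀ x, 0 ≤ V x := fun x =>
    sumInfPow_nonneg x (fun k i => by have := hcb i k; positivity) hL.le
  have hGd : ∀ l, Dominated (2 * 3 ^ (M + 1)) G (u l) := fun l =>
    (hu l).dominated hε hε1.le he hL hb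
  have hVd : ∀ l, Dominated (2 * 3 ^ (M + 1)) V (v l) := fun l =>
    (hv l).dominated hε hε1.le (fun k i => by have := hcb i k; positivity) hL
      (fun k i => by rw [abs_neg]; exact ha i k)
  have hεη' : 2 * ε ≤ η := by nlinarith
  set A : ℕ → ℝ := fun n => compatConst (L ε) M * deltaSum s e cbar b αbar (2 * ε) n with hA
  have hA0 : ∀ n, 0 ≤ A n := fun n =>
    mul_nonneg (compatConst_nonneg _ _) (deltaSum_nonneg he hcb)
  have hdiag : ∀ n, 1 ≤ n → ∀ x ∈ freqDomain, G x * V x ≤ A n * singFactor ε n x ^ (1 / (p : ℝ)) :=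
    fun n hn x hx => sumInfPow_mul_self_le_deltaSum hn hp s hL.le hε.le hε1.le hεη he hcb hb ha
      hgap hx
  have hdiagp : ∀ n, 1 ≤ n → ∀ x ∈ freqDomain, (G x * V x) ^ p ≤ A n ^ p * singFactor ε n x := by
    intro n hn x hx
    have hω : 0 ≤ singFactor ε n x := zero_le_one.trans (one_le_singFactor hε1.le hx)
    refine (pow_le_pow_left₀ (mul_nonneg (hG0 x) (hV0 x)) (hdiag n hn x hx) p).trans
      (le_of_eq ?_)
    rw [mul_pow, ← Real.rpow_natCast (singFactor ε n x ^ _), ← Real.rpow_mul hω,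
      one_div_mul_cancel (by positivity), Real.rpow_one]
  have hprodle : ∀ x ∈ freqDomain, |∏ l, u l x * v l x| ≤ (G x * V x) ^ p := by
    intro x hx
    rw [Finset.abs_prod]
    calc ∏ l, |u l x * v l x| ≤ ∏ _l : Fin p, G x * V x := by
          refine Finset.prod_le_prod (fun _ _ => abs_nonneg _) fun l _ => ?_
          rw [abs_mul]
          exact mul_le_mul ((hGd l).bound x hx) ((hVd l).bound x hx) (abs_nonneg _) (hG0 x)
      _ = _ := by simp
  have hint : IntegrableOn (fun x => ∏ l, u l x * v l x) freqDomain := by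
    -- Integrability does not involve `n`, so the diagonal bound is used at `n = 1`, where
    -- `singFactor` is at most `π |x|^(ε-1)`.
    have hI := (integrableOn_abs_rpow_freqDomain (r := ε - 1) (by linarith)).const_mul
      (A 1 ^ p * Real.pi)
    refine Integrable.mono' hI ?_ ?_
    · exact Finset.aestronglyMeasurable_fun_prod _ fun l _ =>
        (hGd l).integrable.aestronglyMeasurable.mul (hVd l).integrable.aestronglyMeasurable
    · filter_upwards [ae_restrict_mem measurableSet_freqDomain] with x hx
      rw [Real.norm_eq_abs]
      refine ((hprodle x hx).trans (hdiagp 1 le_rfl x hx)).trans ?_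
      rw [mul_assoc]
      refine mul_le_mul_of_nonneg_left ?_ (pow_nonneg (hA0 1) p)
      have h1 := singFactor_div_absFloor_le (n := 1) le_rfl hε.le hx
      rw [Nat.cast_one, Real.one_rpow, one_mul, div_le_iff₀ (absFloor_pos le_rfl)] at h1
      refine h1.trans ?_
      rw [mul_comm]
      exact mul_le_mul_of_nonneg_right (absFloor_le_pi le_rfl hx)
        (Real.rpow_nonneg (abs_nonneg _) _)
  refine ⟨hint, ?_⟩
  have hcompat : Compat ε n (√(A n)) G V := by
    intro x hx y hy
    have hωx : 0 ≤ singFactor ε n x := zero_le_one.trans (one_le_singFactor hε1.le hx)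
    have hR : 0 ≤ scaleRatio n x y := zero_le_one.trans (one_le_scaleRatio hn)
    rw [← Real.sqrt_mul (hG0 x), ← Real.sqrt_mul (hA0 n), ← Real.sqrt_mul hωx,
      ← Real.sqrt_mul (mul_nonneg (hA0 n) hR)]
    refine Real.sqrt_le_sqrt ?_
    rw [mul_assoc (A n)]
    exact sumInfPow_mul_le_deltaSum hn s hL.le hε.le hε1.le hεη' he hcb hb ha hb1 ha1 hx hy
  set h := interleave (finExtend u) (finExtend v) with hh
  set H : ℕ → ℝ → ℝ := interleave (fun _ => G) (fun _ => V) with hH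
  have hr : 2 * p - 1 + 1 = 2 * p := by omega
  have hprod : ∀ x, ∏ i ∈ Finset.range (2 * p), h i x = ∏ l, u l x * v l x := by
    intro x
    rw [hh, prod_interleave, ← Fin.prod_univ_eq_prod_range
      (fun l => finExtend u l x * finExtend v l x)]
    refine Finset.prod_congr rfl fun l _ => ?_
    rw [finExtend_coe, finExtend_coe]
  have main := norm_trace_chainMat_sub_le (ε := ε) (C := 2 * 3 ^ (M + 1)) (Cd := 1) (s := √(A n))
    (H := H) (h := h) hn hε hε1 (by positivity) zero_le_one ?_ ?_ (Real.sqrt_nonneg _) (2 * p - 1)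
    ?_ ?_ ?_
  · rw [hr] at main
    have e1 : chainMat n h 0 (2 * p) =
        (List.ofFn fun l : Fin p => toeplitz n (u l) * toeplitz n (v l)).prod := by
      have := chainMat_interleave n (finExtend u) (finExtend v) p 0
      rw [mul_zero] at this
      rw [hh, this, ← ofFn_eq_map_range']
      congr 2
      funext l
      rw [finExtend_coe, finExtend_coe]
    rw [e1] at main
    simp only [hprod] at main
    refine main.trans (le_of_eq ?_)
    -- The majorants already lose `2 * ε` in the exponent. The chain of `2 * p` symbols loses a
    -- further `n ^ (2 * p * ε)`, that is `2 * ε` in each of the `p` factors `deltaSum`.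
    have e2 : √(A n) ^ (2 * p) = A n ^ p := by rw [pow_mul, Real.sq_sqrt (hA0 n)]
    have e3 : (n : ℝ) ^ (((2 * p - 1 : ℕ) + 1 : ℝ) * ε) = ((n : ℝ) ^ (2 * ε)) ^ p := by
      rw [← Real.rpow_natCast, ← Real.rpow_mul hn0.le]
      congr 1
      have : (((2 * p - 1 : ℕ) : ℝ) + 1) = 2 * p := by exact_mod_cast hr
      rw [this]; ring
    rw [e2, e3, show 4 * ε = 2 * ε + 2 * ε by ring, ← deltaSum_mul_rpow hn, mul_pow, mul_pow]
    ring
  · refine forall_interleave (fun j => ?_) fun j => ?_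
    · rw [hH, hh, interleave_even, interleave_even]; exact hGd _
    · rw [hH, hh, interleave_odd, interleave_odd]; exact hVd _
  · refine forall_interleave (fun j => ?_) fun j => ?_
    · rw [hH, interleave_even, interleave_odd]; exact hcompat
    · rw [hH, interleave_odd, show 2 * j + 1 + 1 = 2 * (j + 1) by ring, interleave_even]
      exact hcompat.symm
  · rw [hr, hH, interleave_even]
    exact (interleave_even (fun _ => G) (fun _ => V) 0).symm
  · intro x hx _
    rw [hr, hH, prod_interleave]
    simp only [Finset.prod_const, Finset.card_range]
    rw [one_mul, pow_mul, Real.sq_sqrt (hA0 n)]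
    exact hdiagp n hn x hx
  · rw [hr]
    simp only [hprod]
    exact hint

end

/-! ### Trigonometric polynomials near the origin. -/

lemma integrable_mul_of_sq {X : Type*} [MeasurableSpace X] {μ : Measure X} {a b : X → ℝ}
    (ha : Integrable (fun x => a x ^ 2) μ) (hb : Integrable (fun x => b x ^ 2) μ)
    (ham : AEStronglyMeasurable a μ) (hbm : AEStronglyMeasurable b μ) :
    Integrable (fun x => a x * b x) μ := by
  refine Integrable.mono' (ha.add hb) (ham.mul hbm) (Filter.Eventually.of_forall fun x => ?_)
  rw [Real.norm_eq_abs, abs_mul]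
  simp only [Pi.add_apply]
  nlinarith [sq_nonneg (|a x| - |b x|), sq_abs (a x), sq_abs (b x), sq_nonneg (a x),
    sq_nonneg (b x)]

/-- Cauchy–Schwarz, from the discriminant of `t ↦ ∫ (a - t b)²`. -/
lemma sq_integral_mul_le {X : Type*} [MeasurableSpace X] {μ : Measure X} {a b : X → ℝ}
    (ha : Integrable (fun x => a x ^ 2) μ) (hb : Integrable (fun x => b x ^ 2) μ)
    (ham : AEStronglyMeasurable a μ) (hbm : AEStronglyMeasurable b μ) :
    (∫ x, a x * b x ∂μ) ^ 2 ≤ (∫ x, a x ^ 2 ∂μ) * ∫ x, b x ^ 2 ∂μ := by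
  have hab := integrable_mul_of_sq ha hb ham hbm
  have key : ∀ t : ℝ, 0 ≤ (∫ x, b x ^ 2 ∂μ) * (t * t) + (-2 * ∫ x, a x * b x ∂μ) * t +
      ∫ x, a x ^ 2 ∂μ := by
    intro t
    have h1 : 0 ≤ ∫ x, (a x - t * b x) ^ 2 ∂μ := integral_nonneg fun x => sq_nonneg _
    have h2 : ∀ x, (a x - t * b x) ^ 2 = a x ^ 2 - (2 * t) * (a x * b x) + t ^ 2 * b x ^ 2 :=
      fun x => by ring
    simp only [h2] at h1
    have h3 : Integrable (fun x => a x ^ 2 - 2 * t * (a x * b x)) μ := ha.sub (hab.const_mul _)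
    rw [integral_add h3 (hb.const_mul _),
      integral_sub ha (hab.const_mul _), integral_const_mul, integral_const_mul] at h1
    linarith
  have := discrim_le_zero key
  unfold discrim at this
  linarith

section
variable {n : ℕ} {ε : ℝ}

lemma integrableOn_mul_sq_norm {f : ℝ → ℝ} (hf : IntegrableOn f freqDomain) (w : Fin n → ℂ) :
    IntegrableOn (fun x => f x * ‖star (evec n x) ⬝ᵥ w‖ ^ 2) freqDomain := by
  have hcont : Continuous fun x => ‖star (evec n x) ⬝ᵥ w‖ ^ 2 :=
    (continuous_star_evec_dotProduct w).norm.pow 2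
  have hb : ∀ x, ‖(‖star (evec n x) ⬝ᵥ w‖ ^ 2)‖ ≤ (∑ j, ‖w j‖) ^ 2 := by
    intro x
    rw [Real.norm_of_nonneg (by positivity)]
    refine pow_le_pow_left₀ (norm_nonneg _) ?_ 2
    rw [dotProduct]
    refine (norm_sum_le _ _).trans (Finset.sum_le_sum fun j _ => ?_)
    rw [norm_mul, Pi.star_apply, norm_star, norm_evec, one_mul]
  have := Integrable.bdd_mul (c := (∑ j, ‖w j‖) ^ 2) hf hcont.aestronglyMeasurable
    (Filter.Eventually.of_forall hb)
  refine this.congr (Filter.Eventually.of_forall fun x => ?_)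
  simp [mul_comm]

lemma two_pi_mul_star_evec_dotProduct (w : Fin n → ℂ) (x : ℝ) :
    ((2 * Real.pi : ℝ) : ℂ) * (star (evec n x) ⬝ᵥ w) =
      ∫ y in freqDomain, (star (evec n x) ⬝ᵥ evec n y) * (star (evec n y) ⬝ᵥ w) := by
  have h1 := dotProduct_toeplitz_mulVec (n := n) (f := fun _ => (1 : ℝ))
    (integrable_const _) (star (evec n x)) w
  rw [toeplitz_one, Matrix.smul_mulVec, Matrix.one_mulVec, dotProduct_smul] at h1
  simpa using h1

/-- A trigonometric polynomial of degree less than `n` is controlled on `|x| < 1/n` by its values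
on `|x| ≥ 1/n`. -/
lemma norm_sq_le_of_abs_lt (hn : 1 ≤ n) {f J : ℝ → ℝ} (hf : IntegrableOn f freqDomain)
    (hfpos : ∀ x ∈ freqDomain, 0 < f x) (hJ : IntegrableOn J freqDomain)
    (hJf : ∀ y ∈ freqDomain, 1 / (n : ℝ) ≤ |y| → (f y)⁻¹ * |y| ^ (-2 : ℝ) ≤ J y)
    (hJ0 : ∀ y ∈ freqDomain, 0 ≤ J y)
    (w : Fin n → ℂ) {x : ℝ} (hx : x ∈ freqDomain) (hxn : |x| < 1 / (n : ℝ)) :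
    ‖star (evec n x) ⬝ᵥ w‖ ^ 2 ≤ 4 * (∫ y in freqDomain, J y) *
      ∫ y in freqDomain, f y * ‖star (evec n y) ⬝ᵥ w‖ ^ 2 := by
  have hn0 : (0 : ℝ) < n := by exact_mod_cast hn
  set P : ℝ → ℂ := fun x => star (evec n x) ⬝ᵥ w with hP
  have hPc : Continuous P := continuous_star_evec_dotProduct w
  have hPb : ∀ x, ‖P x‖ ≤ ∑ j, ‖w j‖ := by
    intro x
    rw [hP]
    simp only [dotProduct]
    refine (norm_sum_le _ _).trans (Finset.sum_le_sum fun j _ => ?_)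
    rw [norm_mul, Pi.star_apply, norm_star, norm_evec, one_mul]
  set near : Set ℝ := freqDomain ∩ {y | |y| < 1 / (n : ℝ)} with hnear
  set far : Set ℝ := freqDomain ∩ {y | 1 / (n : ℝ) ≤ |y|} with hfar
  have hmn : MeasurableSet near :=
    measurableSet_freqDomain.inter (measurableSet_lt continuous_abs.measurable measurable_const)
  have hmf : MeasurableSet far :=
    measurableSet_freqDomain.inter (measurableSet_le measurable_const continuous_abs.measurable)
  have hun : near ∪ far = freqDomain := by
    rw [hnear, hfar, ← Set.inter_union_distrib_left]
    refine Set.inter_eq_left.2 fun y _ => ?_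
    exact lt_or_ge |y| (1 / (n : ℝ))
  have hdis : Disjoint near far := by
    rw [Set.disjoint_left]
    intro y h1 h2
    exact absurd (show |y| < 1 / (n : ℝ) from h1.2) (not_lt.2 h2.2)
  -- The reproducing formula expresses `P` near the origin by its near and far values. The near part
  -- contributes at most `n · S · (2/n) = 2 S`, which is absorbed afterwards.
  set S := sSup ((fun y => ‖P y‖) '' near) with hS
  have hbdd : BddAbove ((fun y => ‖P y‖) '' near) := by
    refine ⟨∑ j, ‖w j‖, ?_⟩
    rintro _ ⟨y, _, rfl⟩
    exact hPb y
  have hxS : ∀ y ∈ near, ‖P y‖ ≤ S := fun y hy => le_csSup hbdd ⟨y, hy, rfl⟩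
  have hxmem : x ∈ near := ⟨hx, hxn⟩
  have hS0 : 0 ≤ S := (norm_nonneg _).trans (hxS x hxmem)
  -- For a near point and a far point `y` the kernel is at most `8 / |y|`. The integrand `|P| / |y|`
  -- is split as `A * B`, so that Cauchy–Schwarz produces the weight `f` on `|P|²`.
  set A : ℝ → ℝ := fun y => √(f y) * ‖P y‖ with hA
  set B : ℝ → ℝ := fun y => √((f y)⁻¹) * |y|⁻¹ with hB
  have hA2 : ∀ y ∈ freqDomain, A y ^ 2 = f y * ‖P y‖ ^ 2 := by
    intro y hy
    rw [hA]; simp only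
    rw [mul_pow, Real.sq_sqrt (hfpos y hy).le]
  have hB2 : ∀ y ∈ freqDomain, B y ^ 2 = (f y)⁻¹ * |y| ^ (-2 : ℝ) := by
    intro y hy
    rw [hB]; simp only
    rw [mul_pow, Real.sq_sqrt (inv_nonneg.2 (hfpos y hy).le), Real.rpow_neg (abs_nonneg _),
      inv_pow]
    norm_num
  have hAB : ∀ y ∈ freqDomain, A y * B y = |y|⁻¹ * ‖P y‖ := by
    intro y hy
    have h1 := hfpos y hy
    have h2 : √(f y) * √((f y)⁻¹) = 1 := by
      rw [← Real.sqrt_mul h1.le, mul_inv_cancel₀ h1.ne', Real.sqrt_one]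
    rw [hA, hB]; simp only
    linear_combination (‖P y‖ * |y|⁻¹) * h2
  have hfar_sub : far ⊆ freqDomain := Set.inter_subset_left
  have hfm : AEStronglyMeasurable f (volume.restrict far) :=
    (hf.mono_set hfar_sub).aestronglyMeasurable
  have hAm : AEStronglyMeasurable A (volume.restrict far) :=
    (Real.continuous_sqrt.comp_aestronglyMeasurable hfm).mul hPc.norm.aestronglyMeasurable
  have hBm : AEStronglyMeasurable B (volume.restrict far) :=
    (Real.continuous_sqrt.comp_aestronglyMeasurable hfm.inv₀).mul
      (by fun_prop : Measurable fun y : ℝ => |y|⁻¹).aestronglyMeasurable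
  have hAi : IntegrableOn (fun y => A y ^ 2) far :=
    ((integrableOn_mul_sq_norm hf w).mono_set hfar_sub).congr_fun
      (fun y hy => (hA2 y hy.1).symm) hmf
  have hBi : IntegrableOn (fun y => B y ^ 2) far := by
    refine Integrable.mono' (hJ.mono_set hfar_sub) (hBm.pow 2) ?_
    filter_upwards [ae_restrict_mem hmf] with y hy
    rw [Real.norm_of_nonneg (sq_nonneg _), hB2 y hy.1]
    exact hJf y hy.1 hy.2
  have hCS := sq_integral_mul_le hAi hBi hAm hBm
  have hABi := integrable_mul_of_sq hAi hBi hAm hBm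
  set I := ∫ y in far, A y * B y with hI
  have hI0 : 0 ≤ I := integral_nonneg fun y =>
    mul_nonneg (mul_nonneg (Real.sqrt_nonneg _) (norm_nonneg _))
      (mul_nonneg (Real.sqrt_nonneg _) (inv_nonneg.2 (abs_nonneg _)))
  have hpt : ∀ z ∈ near, ‖P z‖ * (2 * Real.pi) ≤ 2 * S + 8 * I := by
    intro z hz
    have hrep := two_pi_mul_star_evec_dotProduct w z
    have hD : Continuous fun y => (star (evec n z) ⬝ᵥ evec n y) * P y :=
      (continuous_dotProduct_evec _).mul hPc
    have hDi : IntegrableOn (fun y => (star (evec n z) ⬝ᵥ evec n y) * P y) freqDomain := by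
      have hc : IntegrableOn (fun _ : ℝ => (1 : ℝ)) freqDomain := integrable_const _
      have := IntegrableOn.ofReal_mul_bounded hc hD
        (C := n * ∑ j, ‖w j‖) fun y => by
          rw [norm_mul]
          exact mul_le_mul (norm_star_evec_dotProduct_evec_le _ _ _) (hPb y) (norm_nonneg _)
            hn0.le
      simpa using this
    rw [← hun, setIntegral_union hdis hmf
      (hDi.mono_set (by rw [← hun]; exact Set.subset_union_left))
      (hDi.mono_set hfar_sub)] at hrep
    have h1 : ‖∫ y in near, (star (evec n z) ⬝ᵥ evec n y) * P y‖ ≤ 2 * S := by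
      have hvol : volume.real near ≤ 2 / n := by
        have : near ⊆ Set.Ioo (-(1 / (n : ℝ))) (1 / n) := fun y hy => abs_lt.1 hy.2
        refine (measureReal_mono this (by simp)).trans (le_of_eq ?_)
        rw [Real.volume_real_Ioo_of_le (by have : 0 < 1 / (n : ℝ) := by positivity
                                           linarith)]
        ring
      have hfin : volume near < ⊤ := by
        refine lt_of_le_of_lt (measure_mono (Set.inter_subset_left.trans freqDomain_subset)) ?_
        simp
      refine (norm_setIntegral_le_of_norm_le_const hfin (C := n * S) fun y hy => ?_).trans ?_
      · rw [norm_mul]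
        exact mul_le_mul (norm_star_evec_dotProduct_evec_le _ _ _) (hxS y hy) (norm_nonneg _)
          hn0.le
      · calc n * S * volume.real near ≤ n * S * (2 / n) := by gcongr
          _ = 2 * S := by field_simp
    have h2 : ‖∫ y in far, (star (evec n z) ⬝ᵥ evec n y) * P y‖ ≤ 8 * I := by
      rw [hI, ← integral_const_mul]
      refine norm_integral_le_of_norm_le (hABi.const_mul 8) ?_
      filter_upwards [ae_restrict_mem hmf] with y hy
      rw [norm_mul, hAB y hy.1, ← mul_assoc]
      refine mul_le_mul_of_nonneg_right ?_ (norm_nonneg _)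
      have hy0 := freqDomain_abs_pos hy.1
      rw [← div_eq_mul_inv, le_div_iff₀ hy0]
      rcases norm_kernel_mul_max_le_or hn hz.1 hy.1 with h | h
      · refine le_trans ?_ h
        exact mul_le_mul_of_nonneg_left (abs_le_absFloor.trans (le_max_right _ _)) (norm_nonneg _)
      · exact absurd h.1 (not_le.2 hz.2)
    calc ‖P z‖ * (2 * Real.pi) = ‖((2 * Real.pi : ℝ) : ℂ) * P z‖ := by
          rw [norm_mul, Complex.norm_real, Real.norm_of_nonneg (by have := Real.pi_pos; positivity),
            mul_comm]
      _ ≤ _ := by rw [hrep]; exact (norm_add_le _ _).trans (add_le_add h1 h2)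
  -- Absorption works because `2π - 2 > 4`.
  have hSI : S ≤ 2 * I := by
    have h1 : S * (2 * Real.pi) ≤ 2 * S + 8 * I := by
      rw [← le_div_iff₀ (by have := Real.pi_pos; positivity)]
      refine csSup_le ⟨_, ⟨x, hxmem, rfl⟩⟩ ?_
      rintro _ ⟨z, hz, rfl⟩
      rw [le_div_iff₀ (by have := Real.pi_pos; positivity)]
      exact hpt z hz
    nlinarith [Real.pi_gt_three]
  have hIA : ∫ y in far, A y ^ 2 ≤ ∫ y in freqDomain, f y * ‖P y‖ ^ 2 := by
    rw [setIntegral_congr_fun hmf fun y hy => hA2 y hy.1]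
    refine setIntegral_mono_set (integrableOn_mul_sq_norm hf w) ?_ (LE.le.eventuallyLE hfar_sub)
    filter_upwards [ae_restrict_mem measurableSet_freqDomain] with y hy
    have := hfpos y hy
    simp only [Pi.zero_apply]
    positivity
  have hIB : ∫ y in far, B y ^ 2 ≤ ∫ y in freqDomain, J y := by
    refine (setIntegral_mono_on hBi (hJ.mono_set hfar_sub) hmf fun y hy => ?_).trans
      (setIntegral_mono_set hJ ?_ (LE.le.eventuallyLE hfar_sub))
    · rw [hB2 y hy.1]; exact hJf y hy.1 hy.2
    · filter_upwards [ae_restrict_mem measurableSet_freqDomain] with y hy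
      exact hJ0 y hy
  have hx1 := hxS x hxmem
  have hA0 : 0 ≤ ∫ y in far, A y ^ 2 := integral_nonneg fun y => sq_nonneg _
  have hB0 : 0 ≤ ∫ y in far, B y ^ 2 := integral_nonneg fun y => sq_nonneg _
  calc ‖P x‖ ^ 2 ≤ (2 * I) ^ 2 := pow_le_pow_left₀ (norm_nonneg _) (hx1.trans hSI) 2
    _ = 4 * I ^ 2 := by ring
    _ ≤ 4 * ((∫ y in far, A y ^ 2) * ∫ y in far, B y ^ 2) := by gcongr
    _ ≤ 4 * ((∫ y in freqDomain, f y * ‖P y‖ ^ 2) * ∫ y in freqDomain, J y) := by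
        have := hA0.trans hIA
        gcongr
    _ = _ := by ring

lemma integral_abs_rpow_le_schurConst (hε : 0 < ε) :
    ∫ x in freqDomain, |x| ^ (ε - 1) ≤ schurConst ε := by
  have h1 := (integral_abs_add_rpow_le (r := ε - 1) (by linarith) (c := 0)
    (by simpa using Real.pi_pos.le)).2
  simp only [zero_add] at h1
  refine h1.trans ?_
  unfold schurConst
  have : 0 ≤ ∫ u in Set.Ioo (-(2 * Real.pi)) (2 * Real.pi), |u| ^ (ε - 1) :=
    integral_nonneg fun _ => Real.rpow_nonneg (abs_nonneg _) _
  linarith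

/-- The sum controlling the supremum of a trigonometric polynomial near the origin. -/
noncomputable def supSum {q : ℕ} (cb a : Fin q → ℝ) (ε : ℝ) (n : ℕ) : ℝ :=
  ∑ j, 1 / cb j * (n : ℝ) ^ (max (1 - a j + ε) 0 + ε)

/-- On `|y| ≥ 1/n`, the powers of `|y|` in the bound for `|y|⁻² / f` are rewritten as `|y|^(ε-1)`
times a power of `|y|` that is at most a constant times a power of `n`. -/
lemma norm_sq_le_supSum {q : ℕ} (hn : 1 ≤ n) (hε : 0 < ε) (hε1 : ε ≤ 1) {f : ℝ → ℝ}
    (hf : IntegrableOn f freqDomain)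
    (hfpos : ∀ x ∈ freqDomain, 0 < f x) {cb a : Fin q → ℝ} {l M : ℝ} (hl : 0 ≤ l)
    (hcb : ∀ j, 0 < cb j) (ha : ∀ j, |a j| ≤ M)
    (hinv : ∀ x ∈ freqDomain, (f x)⁻¹ ≤ l * ∑ j, 1 / cb j * |x| ^ (a j - ε))
    (w : Fin n → ℂ) {x : ℝ} (hx : x ∈ freqDomain) (hxn : |x| < 1 / (n : ℝ)) :
    ‖star (evec n x) ⬝ᵥ w‖ ^ 2 ≤ 4 * l * Real.pi ^ (M + 3) * schurConst ε * supSum cb a ε n *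
      ∫ y in freqDomain, f y * ‖star (evec n y) ⬝ᵥ w‖ ^ 2 := by
  have hn1 : (1 : ℝ) ≤ n := by exact_mod_cast hn
  have hpi := Real.pi_pos
  have hss : 0 ≤ supSum cb a ε n := Finset.sum_nonneg fun j _ => by
    have := hcb j; positivity
  have hI := (integrableOn_abs_rpow_freqDomain (r := ε - 1) (by linarith)).const_mul
    (l * Real.pi ^ (M + 3) * supSum cb a ε n)
  have hQ : 0 ≤ ∫ y in freqDomain, f y * ‖star (evec n y) ⬝ᵥ w‖ ^ 2 :=
    setIntegral_nonneg measurableSet_freqDomain fun y hy => by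
      have := hfpos y hy; positivity
  refine (norm_sq_le_of_abs_lt hn hf hfpos hI ?_ ?_ w hx hxn).trans ?_
  · intro y hy hyn
    have hy0 := freqDomain_abs_pos hy
    calc (f y)⁻¹ * |y| ^ (-2 : ℝ)
        ≤ (l * ∑ j, 1 / cb j * |y| ^ (a j - ε)) * |y| ^ (-2 : ℝ) :=
          mul_le_mul_of_nonneg_right (hinv y hy) (Real.rpow_nonneg hy0.le _)
      _ = l * ∑ j, 1 / cb j * (|y| ^ (-(1 - a j + 2 * ε)) * |y| ^ (ε - 1)) := by
          rw [mul_assoc, Finset.sum_mul]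
          congr 1
          refine Finset.sum_congr rfl fun j _ => ?_
          rw [mul_assoc, ← Real.rpow_add hy0, ← Real.rpow_add hy0]
          congr 2; ring
      _ ≤ l * ∑ j, 1 / cb j * ((Real.pi ^ (M + 3) * (n : ℝ) ^ (max (1 - a j + ε) 0 + ε)) *
          |y| ^ (ε - 1)) := by
          gcongr with j
          · have := hcb j; positivity
          · have h1 := absFloor_rpow_le hn hy (s := 1 - a j + 2 * ε) (M := M + 3) (by
              have := abs_le.1 (ha j)
              exact abs_le.2 ⟨by linarith, by linarith⟩)
            rw [absFloor_of_le hyn] at h1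
            refine h1.trans ?_
            gcongr
            · refine max_le ?_ ?_
              · linarith [le_max_left (1 - a j + ε) 0]
              · linarith [le_max_right (1 - a j + ε) 0]
      _ = _ := by
          unfold supSum
          rw [Finset.mul_sum, Finset.mul_sum, Finset.sum_mul]
          refine Finset.sum_congr rfl fun j _ => ?_
          ring
  · intro y hy
    positivity
  · refine mul_le_mul_of_nonneg_right ?_ hQ
    rw [integral_const_mul]
    calc 4 * (l * Real.pi ^ (M + 3) * supSum cb a ε n * ∫ y in freqDomain, |y| ^ (ε - 1))
        ≤ 4 * (l * Real.pi ^ (M + 3) * supSum cb a ε n * schurConst ε) := by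
          gcongr
          exact integral_abs_rpow_le_schurConst hε
      _ = _ := by ring

end

/-! ### Comparison of the quadratic forms of `|g|` and `f`. -/

section
variable {n q : ℕ} {ε η : ℝ}

/-- Treats one term `j` of `supSum` inside the cutoff `τ`. If `a j + g < 1 - η`, the index `j`
itself serves, because `n τ ≤ 1`. Otherwise `i` comes from the definition of `R`: since `τ ^ (1 - a
i) ≤ 1 / (R n)`, the factor `n · (cb i / cb j)` is cancelled. This explains both `R` and the
exponent `1 / (1 - α'₊)`. -/
lemma exists_near_bound (hn : 1 ≤ n) (hε : 0 < ε) (hεη : 4 * ε ≤ η) (hη : η < 1)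
    {cb a : Fin q → ℝ} {g R α' x : ℝ} (hcb : ∀ j, 0 < cb j) (hR1 : 1 ≤ R)
    (hR : ∀ j, 1 - η ≤ a j + g → ∃ i, a i + g < 1 - η ∧ cb i / cb j ≤ R)
    (hα : ∀ i, a i < 1 → a i ≤ α') (hα1 : α' < 1 - η) (hg : g < 1 - η)
    (hγ : 0 < g + 2 * ε) (hx0 : 0 < |x|) (hxτ : |x| < (R * n) ^ (-(1 / (1 - max α' 0))))
    (j : Fin q) :
    ∃ i, (n : ℝ) ^ (max (1 - a j + ε) 0 + ε) * (cb i / cb j) *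
      (|x| ^ (-(g + 2 * ε)) * |x| ^ (-(a i - ε))) ≤
      (R * n) ^ (max g 0 / (1 - max α' 0) + 4 * ε / η) * |x| ^ (ε - 1) := by
  have hn1 : (1 : ℝ) ≤ n := by exact_mod_cast hn
  have hn0 : (0 : ℝ) < n := by linarith
  have hη0 : 0 < η := by linarith
  set N := R * n with hN
  have hN1 : 1 ≤ N := by rw [hN]; nlinarith
  have hN0 : 0 < N := by linarith
  have hnN : (n : ℝ) ≤ N := by rw [hN]; nlinarith
  set ϑ := 1 - max α' 0 with hϑ
  have hϑη : η ≤ ϑ := by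
    rw [hϑ]
    have : max α' 0 ≤ 1 - η := max_le hα1.le (by linarith)
    linarith
  have hϑ1 : ϑ ≤ 1 := by rw [hϑ]; linarith [le_max_right α' 0]
  have hϑ0 : 0 < ϑ := by linarith
  set τ := N ^ (-(1 / ϑ)) with hτ
  have hτ0 : 0 < τ := Real.rpow_pos_of_pos hN0 _
  have hτN : τ ≤ N⁻¹ := by
    rw [← Real.rpow_neg_one, hτ]
    refine Real.rpow_le_rpow_of_exponent_le hN1 ?_
    have : 1 ≤ 1 / ϑ := by rw [le_div_iff₀ hϑ0]; linarith
    linarith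
  have hNi : N⁻¹ ≤ 1 := inv_le_one_of_one_le₀ hN1
  have hτ1 : τ ≤ 1 := hτN.trans hNi
  have hτγ : τ ^ (-(g + 2 * ε)) ≤ N ^ (max g 0 / ϑ + 2 * ε / η) := by
    rw [hτ, ← Real.rpow_mul hN0.le]
    refine Real.rpow_le_rpow_of_exponent_le hN1 ?_
    have h1 : (g + 2 * ε) / ϑ ≤ (max g 0 + 2 * ε) / ϑ := by
      gcongr; exact le_max_left _ _
    have h2 : 2 * ε / ϑ ≤ 2 * ε / η := by gcongr
    calc -(1 / ϑ) * -(g + 2 * ε) = (g + 2 * ε) / ϑ := by ring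
      _ ≤ _ := h1
      _ = max g 0 / ϑ + 2 * ε / ϑ := by ring
      _ ≤ _ := by linarith
  -- the common reduction
  have reduce : ∀ i, a i + g < 1 - η →
      (n : ℝ) ^ (max (1 - a j + ε) 0 + ε) * (cb i / cb j) * τ ^ (1 - a i) ≤ (n : ℝ) ^ (2 * ε) →
      (n : ℝ) ^ (max (1 - a j + ε) 0 + ε) * (cb i / cb j) *
        (|x| ^ (-(g + 2 * ε)) * |x| ^ (-(a i - ε))) ≤
        N ^ (max g 0 / ϑ + 4 * ε / η) * |x| ^ (ε - 1) := by
    intro i hi h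
    have hci := hcb i
    have hcj := hcb j
    have e1 : |x| ^ (-(g + 2 * ε)) * |x| ^ (-(a i - ε)) =
        |x| ^ (1 - a i - (g + 2 * ε)) * |x| ^ (ε - 1) := by
      rw [← Real.rpow_add hx0, ← Real.rpow_add hx0]; congr 1; ring
    -- The exponent is nonnegative because `a i + g < 1 - η` and `2 * ε ≤ η`, so `|x|` may be
    -- replaced by the larger `τ`.
    have e2 : |x| ^ (1 - a i - (g + 2 * ε)) ≤ τ ^ (1 - a i) * τ ^ (-(g + 2 * ε)) := by
      rw [← Real.rpow_add hτ0]
      exact Real.rpow_le_rpow hx0.le hxτ.le (by linarith)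
    rw [e1]
    have hx' : 0 ≤ |x| ^ (ε - 1) := Real.rpow_nonneg hx0.le _
    have hn2 : (n : ℝ) ^ (2 * ε) ≤ N ^ (2 * ε / η) := by
      calc (n : ℝ) ^ (2 * ε) ≤ N ^ (2 * ε) := Real.rpow_le_rpow hn0.le hnN (by linarith)
        _ ≤ _ := by
          refine Real.rpow_le_rpow_of_exponent_le hN1 ?_
          rw [le_div_iff₀ hη0]; nlinarith
    calc (n : ℝ) ^ (max (1 - a j + ε) 0 + ε) * (cb i / cb j) *
          (|x| ^ (1 - a i - (g + 2 * ε)) * |x| ^ (ε - 1))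
        ≤ (n : ℝ) ^ (max (1 - a j + ε) 0 + ε) * (cb i / cb j) *
          ((τ ^ (1 - a i) * τ ^ (-(g + 2 * ε))) * |x| ^ (ε - 1)) := by gcongr
      _ = ((n : ℝ) ^ (max (1 - a j + ε) 0 + ε) * (cb i / cb j) * τ ^ (1 - a i)) *
          τ ^ (-(g + 2 * ε)) * |x| ^ (ε - 1) := by ring
      _ ≤ N ^ (2 * ε / η) * N ^ (max g 0 / ϑ + 2 * ε / η) * |x| ^ (ε - 1) := by
          gcongr
          exact h.trans hn2
      _ = _ := by rw [← Real.rpow_add hN0]; congr 2; ring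
  by_cases hj : a j + g < 1 - η
  · refine ⟨j, reduce j hj ?_⟩
    have haj : 0 < 1 - a j := by linarith
    rw [div_self (hcb j).ne', mul_one, max_eq_left (by linarith)]
    have hnτ : n * τ ≤ 1 := by
      calc n * τ ≤ N * N⁻¹ := by gcongr
        _ = 1 := mul_inv_cancel₀ hN0.ne'
    calc (n : ℝ) ^ (1 - a j + ε + ε) * τ ^ (1 - a j)
        = (n : ℝ) ^ (2 * ε) * (n * τ) ^ (1 - a j) := by
          rw [Real.mul_rpow hn0.le hτ0.le, ← mul_assoc, ← Real.rpow_add hn0]; congr 2; ring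
      _ ≤ (n : ℝ) ^ (2 * ε) * 1 := by
          gcongr
          exact Real.rpow_le_one (by positivity) hnτ haj.le
      _ = _ := mul_one _
  · push Not at hj
    obtain ⟨i, hi, hiR⟩ := hR j hj
    refine ⟨i, reduce i hi ?_⟩
    have hai : a i < 1 := by linarith
    have haϑ : ϑ ≤ 1 - a i := by
      rw [hϑ]; linarith [hα i hai, le_max_left α' 0]
    have h1 : τ ^ (1 - a i) ≤ N⁻¹ := by
      calc τ ^ (1 - a i) ≤ τ ^ ϑ := Real.rpow_le_rpow_of_exponent_ge hτ0 hτ1 haϑ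
        _ = N⁻¹ := by
          rw [hτ, ← Real.rpow_mul hN0.le, ← Real.rpow_neg_one]
          congr 1; field_simp
    have h2 : (n : ℝ) ^ (max (1 - a j + ε) 0 + ε) ≤ n * (n : ℝ) ^ (2 * ε) := by
      calc (n : ℝ) ^ (max (1 - a j + ε) 0 + ε) ≤ (n : ℝ) ^ (1 + 2 * ε) := by
            refine Real.rpow_le_rpow_of_exponent_le hn1 ?_
            have : max (1 - a j + ε) 0 ≤ 1 + ε := max_le (by linarith) (by linarith)
            linarith
        _ = _ := by rw [Real.rpow_add hn0, Real.rpow_one]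
    have hq0 : 0 ≤ cb i / cb j := (div_pos (hcb i) (hcb j)).le
    calc (n : ℝ) ^ (max (1 - a j + ε) 0 + ε) * (cb i / cb j) * τ ^ (1 - a i)
        ≤ (n * (n : ℝ) ^ (2 * ε)) * R * N⁻¹ := by gcongr
      _ = (n : ℝ) ^ (2 * ε) * (N * N⁻¹) := by rw [hN]; ring
      _ = _ := by rw [mul_inv_cancel₀ hN0.ne', mul_one]

/-- The pointwise form of the operator norm bound, where the `k`-th term of the bound for `1/f`
dominates. -/
lemma mul_sq_norm_le_of_dominant (hn : 1 ≤ n) (hε : 0 < ε) (hεη : 4 * ε ≤ η) (hη : η < 1)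
    {cb a : Fin q → ℝ} {u P2 l C₀ Q R α' x M d b f : ℝ} {k : Fin q} (hcb : ∀ j, 0 < cb j)
    (hR1 : 1 ≤ R)
    (hR : 0 ≤ b - a k + η → ∀ j, 1 - η ≤ a j + (b - a k) →
      ∃ i, a i + (b - a k) < 1 - η ∧ cb i / cb j ≤ R)
    (hα : ∀ i, a i < 1 → a i ≤ α') (hα1 : α' < 1 - η) (hg : b - a k < 1 - η)
    (hx : x ∈ freqDomain) (hl : 0 ≤ l) (hC₀ : 0 ≤ C₀) (hQ : 0 ≤ Q) (hd : 0 < d)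
    (hP2 : 0 ≤ P2) (hf : 0 < f) (hM : |b - a k + 2 * ε| ≤ M)
    (hk : ∀ i, 1 / cb i * |x| ^ (a i - ε) ≤ 1 / cb k * |x| ^ (a k - ε))
    (hu : |u| ≤ d * |x| ^ (-b - ε) * l)
    (hinv : f⁻¹ ≤ l * ∑ j, 1 / cb j * |x| ^ (a j - ε))
    (hsup : |x| < 1 / (n : ℝ) → P2 ≤ C₀ * supSum cb a ε n * Q) :
    |u| * P2 ≤ (l ^ 2 * q * Real.pi ^ M + l * C₀ * q) *
      (d / cb k * (R * n) ^ (max (b - a k) 0 / (1 - max α' 0) + 4 * ε / η)) *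
      (f * P2 + Q * |x| ^ (ε - 1)) := by
  have hn1 : (1 : ℝ) ≤ n := by exact_mod_cast hn
  have hn0 : (0 : ℝ) < n := by linarith
  have hη0 : 0 < η := by linarith
  have hx0 := freqDomain_abs_pos hx
  have hpi := Real.pi_gt_three
  have hM0 : 0 ≤ M := (abs_nonneg _).trans hM
  have hpiM : 1 ≤ Real.pi ^ M := Real.one_le_rpow (by linarith) hM0
  set N := R * n with hN
  have hN1 : 1 ≤ N := by rw [hN]; nlinarith
  have hN0 : 0 < N := by linarith
  have hϑη : η ≤ 1 - max α' 0 := by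
    have : max α' 0 ≤ 1 - η := max_le hα1.le (by linarith)
    linarith
  have hϑ1 : 1 - max α' 0 ≤ 1 := by linarith [le_max_right α' 0]
  have hϑ0 : 0 < 1 - max α' 0 := by linarith
  set γ := b - a k + 2 * ε with hγ
  set E := N ^ (max (b - a k) 0 / (1 - max α' 0) + 4 * ε / η) with hE
  have hE1 : 1 ≤ E := Real.one_le_rpow hN1 (by
    have : 0 ≤ max (b - a k) 0 := le_max_right _ _
    positivity)
  have hck := hcb k
  have hY : 0 ≤ |x| ^ (ε - 1) := Real.rpow_nonneg hx0.le _
  have hpk : 0 < |x| ^ (a k - ε) := Real.rpow_pos_of_pos hx0 _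
  have hsplit : |x| ^ (-b - ε) = |x| ^ (-γ) * |x| ^ (-(a k - ε)) := by
    rw [← Real.rpow_add hx0]; congr 1; rw [hγ]; ring
  have hnegk : |x| ^ (-(a k - ε)) = (|x| ^ (a k - ε))⁻¹ := Real.rpow_neg hx0.le _
  have hγ0 : 0 ≤ |x| ^ (-γ) := Real.rpow_nonneg hx0.le _
  -- away from the origin
  have far : |x| ^ (-γ) ≤ Real.pi ^ M * E → |u| * P2 ≤
      (l ^ 2 * q * Real.pi ^ M + l * C₀ * q) * (d / cb k * E) * (f * P2 + Q * |x| ^ (ε - 1)) := by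
    intro h
    -- Dominance of the `k`-th term turns the sum into `q` copies of it, hence a lower bound for `f`
    -- by the single power that is compared with `u`.
    have h1 : f⁻¹ ≤ l * (q * (1 / cb k * |x| ^ (a k - ε))) := by
      refine hinv.trans (mul_le_mul_of_nonneg_left ?_ hl)
      refine (Finset.sum_le_sum fun j _ => hk j).trans ?_
      simp
    have h2 : cb k * |x| ^ (-(a k - ε)) ≤ l * q * f := by
      rw [hnegk, ← div_eq_mul_inv, div_le_iff₀ hpk]
      rw [inv_le_iff_one_le_mul₀ hf] at h1
      have : cb k * 1 ≤ cb k * (l * (q * (1 / cb k * |x| ^ (a k - ε))) * f) := by gcongr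
      calc cb k ≤ cb k * (l * (q * (1 / cb k * |x| ^ (a k - ε))) * f) := by linarith
        _ = _ := by field_simp
    have h3 : |u| ≤ l ^ 2 * q * Real.pi ^ M * (d / cb k * E) * f := by
      calc |u| ≤ d * |x| ^ (-b - ε) * l := hu
        _ = l * (d / cb k) * |x| ^ (-γ) * (cb k * |x| ^ (-(a k - ε))) := by
            rw [hsplit]; field_simp
        _ ≤ l * (d / cb k) * (Real.pi ^ M * E) * (l * q * f) := by gcongr
        _ = _ := by ring
    calc |u| * P2 ≤ (l ^ 2 * q * Real.pi ^ M * (d / cb k * E) * f) * P2 := by gcongr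
      _ = (l ^ 2 * q * Real.pi ^ M) * (d / cb k * E) * (f * P2 + 0) := by ring
      _ ≤ _ := by
          gcongr
          · exact le_add_of_nonneg_right (by positivity)
          · positivity
  -- If `γ ≤ 0`, or if `|x|` exceeds the cutoff, `u` is pointwise dominated by `f`. The bound on the
  -- supremum is needed only for `γ > 0` inside the cutoff.
  rcases le_or_gt γ 0 with hγn | hγp
  · apply far
    calc |x| ^ (-γ) ≤ Real.pi ^ (-γ) :=
          Real.rpow_le_rpow hx0.le (freqDomain_abs_lt hx).le (by linarith)
      _ ≤ Real.pi ^ M := Real.rpow_le_rpow_of_exponent_le (by linarith) (by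
          linarith [(abs_le.1 hM).1])
      _ ≤ Real.pi ^ M * E := le_mul_of_one_le_right (by positivity) hE1
  rcases le_or_gt (N ^ (-(1 / (1 - max α' 0)))) |x| with hxτ | hxτ
  · apply far
    calc |x| ^ (-γ) ≤ (N ^ (-(1 / (1 - max α' 0)))) ^ (-γ) :=
          Real.rpow_le_rpow_of_nonpos (by positivity) hxτ (by linarith)
      _ = N ^ (γ / (1 - max α' 0)) := by
          rw [← Real.rpow_mul hN0.le]; congr 1; ring
      _ ≤ E := by
          refine Real.rpow_le_rpow_of_exponent_le hN1 ?_
          have h1 : (b - a k + 2 * ε) / (1 - max α' 0) ≤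
              (max (b - a k) 0 + 2 * ε) / (1 - max α' 0) := by
            gcongr; exact le_max_left _ _
          have h2 : 2 * ε / (1 - max α' 0) ≤ 4 * ε / η := by
            gcongr; linarith
          calc γ / (1 - max α' 0) ≤ (max (b - a k) 0 + 2 * ε) / (1 - max α' 0) := h1
            _ = max (b - a k) 0 / (1 - max α' 0) + 2 * ε / (1 - max α' 0) := by ring
            _ ≤ _ := by linarith
      _ ≤ _ := le_mul_of_one_le_left (by positivity) hpiM
  · have hxn : |x| < 1 / (n : ℝ) := by
      refine hxτ.trans_le ?_
      calc N ^ (-(1 / (1 - max α' 0))) ≤ N ^ (-1 : ℝ) := by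
            refine Real.rpow_le_rpow_of_exponent_le hN1 ?_
            have : 1 ≤ 1 / (1 - max α' 0) := by rw [le_div_iff₀ hϑ0]; linarith
            linarith
        _ = N⁻¹ := Real.rpow_neg_one N
        _ ≤ 1 / n := by
            rw [one_div]
            exact inv_anti₀ hn0 (by rw [hN]; nlinarith)
    -- From `γ > 0` and `2 * ε ≤ η`; only in this case does `R` have to do anything, hence the
    -- condition in `hR`.
    have hgη : 0 ≤ b - a k + η := by linarith
    have hnear := exists_near_bound hn hε hεη hη hcb hR1 (hR hgη) hα hα1 hg hγp hx0 hxτ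
    have hterm : ∀ j, d * |x| ^ (-b - ε) * (1 / cb j * (n : ℝ) ^ (max (1 - a j + ε) 0 + ε)) ≤
        d / cb k * (E * |x| ^ (ε - 1)) := by
      intro j
      obtain ⟨i, hi⟩ := hnear j
      have hci := hcb i
      have hcj := hcb j
      have hpi' : 0 < |x| ^ (a i - ε) := Real.rpow_pos_of_pos hx0 _
      -- Dominance of `k` is used in the opposite direction here: it allows the passage to the index
      -- `i` supplied for the term `j`.
      have hki : cb k * |x| ^ (-(a k - ε)) ≤ cb i * |x| ^ (-(a i - ε)) := by
        have := hk i
        rw [one_div_mul_eq_div, one_div_mul_eq_div, div_le_div_iff₀ hci hck] at this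
        rw [hnegk, Real.rpow_neg hx0.le, ← div_eq_mul_inv, ← div_eq_mul_inv,
          div_le_div_iff₀ hpk hpi']
        linarith
      calc d * |x| ^ (-b - ε) * (1 / cb j * (n : ℝ) ^ (max (1 - a j + ε) 0 + ε))
          = d / cb k * ((n : ℝ) ^ (max (1 - a j + ε) 0 + ε) * (1 / cb j) *
            (|x| ^ (-γ) * (cb k * |x| ^ (-(a k - ε))))) := by rw [hsplit]; field_simp
        _ ≤ d / cb k * ((n : ℝ) ^ (max (1 - a j + ε) 0 + ε) * (1 / cb j) *
            (|x| ^ (-γ) * (cb i * |x| ^ (-(a i - ε))))) := by gcongr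
        _ = d / cb k * ((n : ℝ) ^ (max (1 - a j + ε) 0 + ε) * (cb i / cb j) *
            (|x| ^ (-γ) * |x| ^ (-(a i - ε)))) := by ring
        _ ≤ _ := by gcongr
    calc |u| * P2 ≤ (d * |x| ^ (-b - ε) * l) * (C₀ * supSum cb a ε n * Q) :=
          mul_le_mul hu (hsup hxn) hP2 (by positivity)
      _ = l * C₀ * Q * ∑ j, d * |x| ^ (-b - ε) *
          (1 / cb j * (n : ℝ) ^ (max (1 - a j + ε) 0 + ε)) := by
          rw [← Finset.mul_sum, supSum]; ring
      _ ≤ l * C₀ * Q * ∑ _j : Fin q, d / cb k * (E * |x| ^ (ε - 1)) := by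
          exact mul_le_mul_of_nonneg_left (Finset.sum_le_sum fun j _ => hterm j) (by positivity)
      _ = (l * C₀ * q) * (d / cb k * E) * (0 + Q * |x| ^ (ε - 1)) := by
          simp; ring
      _ ≤ _ := by
          gcongr
          · exact le_add_of_nonneg_left (by positivity)
          · positivity

end

section
variable {m q : ℕ} {n : ℕ} {ε η M : ℝ}

lemma one_le_ratioR (s : Selection m q) (cbar αbar β : Fin m → Fin q → ℝ) (i : Fin m) (k : Fin q) :
    1 ≤ ratioR s cbar αbar β η i k := by
  unfold ratioR
  split_ifs
  · exact le_max_left _ _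
  · exact le_rfl

/-- The minimum over a finite nonempty index set is attained. Nonemptiness is essential, since the
real infimum over an empty type is `0` and would provide no index. -/
lemma exists_div_le_ratioR {s : Selection m q} {cbar αbar β : Fin m → Fin q → ℝ} {i : Fin m}
    {k j : Fin q} (hη : 0 ≤ gap s β αbar i k + η)
    (hj : 1 - η ≤ αbar (s.row i j) j + gap s β αbar i k)
    (hne : ∃ k₂, αbar (s.row i k₂) k₂ + gap s β αbar i k < 1 - η) :
    ∃ k₂, αbar (s.row i k₂) k₂ + gap s β αbar i k < 1 - η ∧
      cbar (s.row i k₂) k₂ / cbar (s.row i j) j ≤ ratioR s cbar αbar β η i k := by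
  obtain ⟨k₀, hk₀⟩ := hne
  have : Nonempty {k₂ : Fin q // αbar (s.row i k₂) k₂ + gap s β αbar i k < 1 - η} := ⟨⟨k₀, hk₀⟩⟩
  obtain ⟨⟨k₂, hk₂⟩, he⟩ := exists_eq_ciInf_of_finite
    (f := fun k₂ : {k₂ : Fin q // αbar (s.row i k₂) k₂ + gap s β αbar i k < 1 - η} =>
      cbar (s.row i k₂) k₂ / cbar (s.row i j) j)
  refine ⟨k₂, hk₂, ?_⟩
  rw [ratioR, if_pos hη]
  refine le_max_of_le_right ?_
  simp only at he
  rw [he]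
  exact le_ciSup (f := fun k₁ : {k₁ : Fin q // 1 - η ≤ αbar (s.row i k₁) k₁ + gap s β αbar i k} =>
    ⨅ k₂ : {k₂ : Fin q // αbar (s.row i k₂) k₂ + gap s β αbar i k < 1 - η},
        cbar (s.row i k₂) k₂ / cbar (s.row i k₁) k₁) (Set.finite_range _).bddAbove ⟨j, hj⟩

lemma le_alphaPrime {s : Selection m q} {αbar : Fin m → Fin q → ℝ} {i : Fin m} {k : Fin q}
    (h : αbar (s.row i k) k < 1) : αbar (s.row i k) k ≤ alphaPrime s αbar i := by
  have := le_ciSup (f := fun k : Fin q => if αbar (s.row i k) k < 1 then αbar (s.row i k) k else 0)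
    (Set.finite_range _).bddAbove k
  simp only [if_pos h] at this
  exact this

/-- An index minimising `αbar` works for every `k`. It keeps the minimum in `ratioR` from being
empty. -/
lemma exists_alphabar_add_gap_lt [NeZero q] {s : Selection m q} {αbar β : Fin m → Fin q → ℝ}
    {i : Fin m}
    (h : (⨆ k, max (gap s β αbar i k) 0) + (⨅ k, αbar (s.row i k) k) < 1 - η) (k : Fin q) :
    ∃ k₂, αbar (s.row i k₂) k₂ + gap s β αbar i k < 1 - η := by
  obtain ⟨k₂, hk₂⟩ := exists_eq_ciInf_of_finite (f := fun k => αbar (s.row i k) k)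
  refine ⟨k₂, ?_⟩
  have h1 := le_ciSup (f := fun k => max (gap s β αbar i k) 0) (Set.finite_range _).bddAbove k
  have h2 := le_max_left (gap s β αbar i k) 0
  linarith

lemma InSumInter.abs_inv_le {cbar αbar : Fin m → Fin q → ℝ} {L v : ℝ → ℝ}
    (hv : InSumInter (fun k i => 1 / cbar i k) (fun k i => -αbar i k) L v) (hε : 0 < ε)
    (row : Fin q → Fin m) {x : ℝ} (hx : x ∈ freqDomain) :
    v x ≤ L ε * ∑ j, 1 / cbar (row j) j * |x| ^ (αbar (row j) j - ε) := by
  obtain ⟨u, hu, hsum⟩ := hv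
  rw [hsum x hx, Finset.mul_sum]
  refine Finset.sum_le_sum fun j _ => ?_
  have := (hu j (row j)).2.2.2 x hx ε hε
  simp only [neg_neg] at this
  calc u j x ≤ |u j x| + |x * deriv (u j) x| := by
        linarith [le_abs_self (u j x), abs_nonneg (x * deriv (u j) x)]
    _ ≤ _ := this.trans (le_of_eq (by ring))

/-- The constant in the operator norm bound. -/
noncomputable def opConst (q : ℕ) (l ε M : ℝ) : ℝ :=
  (l ^ 2 * q * Real.pi ^ (2 * M + 2) +
    l * (4 * l * Real.pi ^ (M + 3) * schurConst ε) * q) * (1 + schurConst ε)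

lemma opConst_nonneg {l : ℝ} (hl : 0 ≤ l) : 0 ≤ opConst q l ε M := by
  have := schurConst_nonneg ε
  have := Real.pi_pos
  unfold opConst; positivity

lemma deltaOp_nonneg {s : Selection m q} {d cbar αbar β : Fin m → Fin q → ℝ}
    (hd : ∀ i k, 0 < d i k) (hcb : ∀ i k, 0 < cbar i k) :
    0 ≤ deltaOp s d cbar αbar β η ε n :=
  Finset.sum_nonneg fun i _ => Finset.sum_nonneg fun k _ => by
    have := hd i (s.col i k)
    have := hcb (s.row i k) k
    have := zero_le_one.trans (one_le_ratioR (η := η) s cbar αbar β i k)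
    positivity

/-- Comparison of the quadratic forms of the Toeplitz matrices of `|g|` and `f`. -/
theorem integral_abs_mul_sq_norm_le [NeZero q] (hn : 1 ≤ n) (s : Selection m q)
    {d β cbar αbar : Fin m → Fin q → ℝ} {L f g : ℝ → ℝ} (hL : 0 < L ε) (hε : 0 < ε)
    (hεη : 4 * ε ≤ η) (hη : η < 1) (hd : ∀ i k, 0 < d i k) (hcb : ∀ i k, 0 < cbar i k)
    (hb : ∀ i k, |β i k| ≤ M) (ha : ∀ i k, |αbar i k| ≤ M)
    (hmm : ∀ i, (⨆ k, max (gap s β αbar i k) 0) + (⨅ k, αbar (s.row i k) k) < 1 - η)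
    (hgap : ∀ i k, gap s β αbar i k < 1 - η) (hα' : ∀ i, alphaPrime s αbar i < 1 - η)
    (hfi : IntegrableOn f freqDomain) (hfpos : ∀ x ∈ freqDomain, 0 < f x)
    (hinv : InSumInter (fun k i => 1 / cbar i k) (fun k i => -αbar i k) L (fun x => 1 / f x))
    (hg : InSumInter d β L g) (w : Fin n → ℂ) :
    ∫ x in freqDomain, |g x| * ‖star (evec n x) ⬝ᵥ w‖ ^ 2 ≤
      opConst q (L ε) ε M * deltaOp s d cbar αbar β η (4 * ε / η) n *
        ∫ x in freqDomain, f x * ‖star (evec n x) ⬝ᵥ w‖ ^ 2 := by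
  have hpi := Real.pi_pos
  have hsc := schurConst_nonneg ε
  set Q := ∫ x in freqDomain, f x * ‖star (evec n x) ⬝ᵥ w‖ ^ 2 with hQdef
  have hQ : 0 ≤ Q := setIntegral_nonneg measurableSet_freqDomain fun y hy => by
      have := hfpos y hy; positivity
  set l := L ε with hl
  set C₀ := 4 * l * Real.pi ^ (M + 3) * schurConst ε with hC₀
  set K := l ^ 2 * q * Real.pi ^ (2 * M + 2) + l * C₀ * q with hK
  have hK0 : 0 ≤ K := by positivity
  set Δ := deltaOp s d cbar αbar β η (4 * ε / η) n with hΔ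
  have hΔ0 : 0 ≤ Δ := deltaOp_nonneg hd hcb
  obtain ⟨u, hu, hsum⟩ := hg
  have hinv' : ∀ i, ∀ x ∈ freqDomain, (f x)⁻¹ ≤
      l * ∑ j, 1 / cbar (s.row i j) j * |x| ^ (αbar (s.row i j) j - ε) := by
    intro i x hx
    rw [← one_div]
    exact hinv.abs_inv_le hε (s.row i) hx
  have hpt : ∀ x ∈ freqDomain, |g x| * ‖star (evec n x) ⬝ᵥ w‖ ^ 2 ≤
      K * Δ * (f x * ‖star (evec n x) ⬝ᵥ w‖ ^ 2 + Q * |x| ^ (ε - 1)) := by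
    intro x hx
    have hfx := hfpos x hx
    set P2 := ‖star (evec n x) ⬝ᵥ w‖ ^ 2 with hP2
    have hP20 : 0 ≤ P2 := by positivity
    have hY : 0 ≤ f x * P2 + Q * |x| ^ (ε - 1) := by
      have := Real.rpow_nonneg (abs_nonneg x) (ε - 1)
      positivity
    have hi : ∀ i, |u i x| * P2 ≤ K * (∑ k, d i (s.col i k) / cbar (s.row i k) k *
        (ratioR s cbar αbar β η i k * (n : ℝ)) ^
        (max (gap s β αbar i k) 0 / (1 - max (alphaPrime s αbar i) 0) + 4 * ε / η)) *
        (f x * P2 + Q * |x| ^ (ε - 1)) := by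
      intro i
      -- The dominant index depends on `x`; the bound becomes uniform by passing to the sum over all
      -- `k`.
      obtain ⟨k, hk⟩ := Finite.exists_max fun k =>
        1 / cbar (s.row i k) k * |x| ^ (αbar (s.row i k) k - ε)
      have h1 := mul_sq_norm_le_of_dominant (n := n) (q := q) (ε := ε) (η := η)
        (cb := fun j => cbar (s.row i j) j) (a := fun j => αbar (s.row i j) j) (u := u i x)
        (P2 := P2) (l := l) (C₀ := C₀) (Q := Q) (R := ratioR s cbar αbar β η i k)
        (α' := alphaPrime s αbar i) (x := x) (M := 2 * M + 2) (d := d i (s.col i k))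
        (b := β i (s.col i k)) (f := f x) (k := k) hn hε hεη hη (fun j => hcb _ _)
        (one_le_ratioR _ _ _ _ _ _)
        (fun h0 j hj => exists_div_le_ratioR h0 hj (exists_alphabar_add_gap_lt (hmm i) k))
        (fun j hj => le_alphaPrime hj) (hα' i) (hgap i k) hx hL.le (by positivity) hQ (hd _ _)
        hP20 hfx (by
          have h1 := abs_le.1 (hb i (s.col i k))
          have h2 := abs_le.1 (ha (s.row i k) k)
          exact abs_le.2 ⟨by linarith, by linarith⟩) hk (by
          have := (hu i (s.col i k)).2.2.2 x hx ε hε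
          linarith [abs_nonneg (x * deriv (u i) x)]) (hinv' i x hx) (fun hxn => by
          have := norm_sq_le_supSum hn hε (by linarith) hfi hfpos hL.le
            (cb := fun j => cbar (s.row i j) j) (a := fun j => αbar (s.row i j) j)
            (fun j => hcb _ _) (fun j => ha _ _) (hinv' i) w hx hxn
          exact this)
      refine h1.trans ?_
      refine mul_le_mul_of_nonneg_right (mul_le_mul_of_nonneg_left ?_ hK0) hY
      refine Finset.single_le_sum (f := fun k => d i (s.col i k) / cbar (s.row i k) k *
        (ratioR s cbar αbar β η i k * (n : ℝ)) ^
        (max (gap s β αbar i k) 0 / (1 - max (alphaPrime s αbar i) 0) + 4 * ε / η))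
        (fun k _ => ?_) (Finset.mem_univ k)
      have := hd i (s.col i k)
      have := hcb (s.row i k) k
      have := zero_le_one.trans (one_le_ratioR (η := η) s cbar αbar β i k)
      positivity
    calc |g x| * P2 ≤ (∑ i, |u i x|) * P2 := by
          rw [hsum x hx]
          exact mul_le_mul_of_nonneg_right (Finset.abs_sum_le_sum_abs _ _) hP20
      _ = ∑ i, |u i x| * P2 := Finset.sum_mul _ _ _
      _ ≤ _ := Finset.sum_le_sum fun i _ => hi i
      _ = _ := by rw [← Finset.sum_mul, ← Finset.mul_sum]; rfl
  have hgi : IntegrableOn g freqDomain := by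
    have : IntegrableOn (fun x => ∑ i, u i x) freqDomain :=
      integrable_finsetSum _ fun i _ => (hu i 0).2.1
    exact this.congr_fun (fun x hx => (hsum x hx).symm) measurableSet_freqDomain
  have hI1 := integrableOn_mul_sq_norm hfi w
  have hI2 := (integrableOn_abs_rpow_freqDomain (r := ε - 1) (by linarith)).const_mul Q
  refine (setIntegral_mono_on (integrableOn_mul_sq_norm hgi.abs w) ((hI1.add hI2).const_mul _)
    measurableSet_freqDomain hpt).trans ?_
  rw [integral_const_mul, integral_add' hI1 hI2, integral_const_mul, ← hQdef]
  have h3 := integral_abs_rpow_le_schurConst hε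
  calc K * Δ * (Q + Q * ∫ x in freqDomain, |x| ^ (ε - 1))
      ≤ K * Δ * (Q + Q * schurConst ε) := by gcongr
    _ = _ := by unfold opConst; rw [hK, hC₀]; ring

end

end ToeplitzTrace

/-! ### Positivity, and comparison of `T_n(f)⁻¹` with `T_n(1/f)`. -/

namespace ToeplitzTrace
open MeasureTheory
open scoped ComplexOrder

section
variable {n : ℕ}

lemma star_dotProduct_evec (w : Fin n → ℂ) (x : ℝ) :
    star w ⬝ᵥ evec n x = star (star (evec n x) ⬝ᵥ w) := by
  rw [Matrix.star_dotProduct]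

lemma star_dotProduct_toeplitz_mulVec {f : ℝ → ℝ} (hf : IntegrableOn f freqDomain)
    (w : Fin n → ℂ) : star w ⬝ᵥ (toeplitz n f).mulVec w =
      ((∫ x in freqDomain, f x * ‖star (evec n x) ⬝ᵥ w‖ ^ 2 : ℝ) : ℂ) := by
  rw [dotProduct_toeplitz_mulVec hf, ← integral_complex_ofReal]
  refine integral_congr_ae (Filter.Eventually.of_forall fun x => ?_)
  simp only
  rw [star_dotProduct_evec, ← starRingEnd_apply, Complex.conj_mul']
  push_cast
  ring

/-- Weighted Cauchy–Schwarz. It is used with `h = 1`, `u = f`, `v = 1/f` for positivity and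
inverses, and with `h = g`, `u = v = |g|` for operator norms. -/
lemma sq_norm_star_dotProduct_toeplitz_le {h u v : ℝ → ℝ} (hh : IntegrableOn h freqDomain)
    (hu : IntegrableOn u freqDomain) (hv : IntegrableOn v freqDomain)
    (hu0 : ∀ x ∈ freqDomain, 0 ≤ u x) (hv0 : ∀ x ∈ freqDomain, 0 ≤ v x)
    (huv : ∀ x ∈ freqDomain, h x ^ 2 = u x * v x) (w z : Fin n → ℂ) :
    ‖star w ⬝ᵥ (toeplitz n h).mulVec z‖ ^ 2 ≤
      (∫ x in freqDomain, u x * ‖star (evec n x) ⬝ᵥ w‖ ^ 2) *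
        ∫ x in freqDomain, v x * ‖star (evec n x) ⬝ᵥ z‖ ^ 2 := by
  set a : ℝ → ℝ := fun x => √(u x) * ‖star (evec n x) ⬝ᵥ w‖ with ha
  set b : ℝ → ℝ := fun x => √(v x) * ‖star (evec n x) ⬝ᵥ z‖ with hb
  have ha2 : ∀ x ∈ freqDomain, u x * ‖star (evec n x) ⬝ᵥ w‖ ^ 2 = a x ^ 2 := fun x hx => by
    rw [ha]; simp only; rw [mul_pow, Real.sq_sqrt (hu0 x hx)]
  have hb2 : ∀ x ∈ freqDomain, v x * ‖star (evec n x) ⬝ᵥ z‖ ^ 2 = b x ^ 2 := fun x hx => by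
    rw [hb]; simp only; rw [mul_pow, Real.sq_sqrt (hv0 x hx)]
  have ham : AEStronglyMeasurable a (volume.restrict freqDomain) :=
    (Real.continuous_sqrt.comp_aestronglyMeasurable hu.aestronglyMeasurable).mul
      (continuous_star_evec_dotProduct w).norm.aestronglyMeasurable
  have hbm : AEStronglyMeasurable b (volume.restrict freqDomain) :=
    (Real.continuous_sqrt.comp_aestronglyMeasurable hv.aestronglyMeasurable).mul
      (continuous_star_evec_dotProduct z).norm.aestronglyMeasurable
  have hai : IntegrableOn (fun x => a x ^ 2) freqDomain :=
    (integrableOn_mul_sq_norm hu w).congr_fun ha2 measurableSet_freqDomain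
  have hbi : IntegrableOn (fun x => b x ^ 2) freqDomain :=
    (integrableOn_mul_sq_norm hv z).congr_fun hb2 measurableSet_freqDomain
  rw [setIntegral_congr_fun measurableSet_freqDomain ha2,
    setIntegral_congr_fun measurableSet_freqDomain hb2]
  refine le_trans ?_ (sq_integral_mul_le hai hbi ham hbm)
  refine pow_le_pow_left₀ (norm_nonneg _) ?_ 2
  rw [dotProduct_toeplitz_mulVec hh]
  refine norm_integral_le_of_norm_le (integrable_mul_of_sq hai hbi ham hbm) ?_
  filter_upwards [ae_restrict_mem measurableSet_freqDomain] with x hx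
  rw [norm_mul, norm_mul, star_dotProduct_evec, norm_star, Complex.norm_real, Real.norm_eq_abs,
    ← Real.sqrt_sq_eq_abs, huv x hx, Real.sqrt_mul (hu0 x hx)]
  exact le_of_eq (by rw [ha, hb]; ring)

lemma isHermitian_toeplitz (n : ℕ) (f : ℝ → ℝ) : (toeplitz n f).IsHermitian := by
  ext k j
  rw [Matrix.conjTranspose_apply, toeplitz_apply, toeplitz_apply, ← starRingEnd_apply,
    ← integral_conj]
  refine integral_congr_ae (Filter.Eventually.of_forall fun x => ?_)
  simp [mul_comm]

variable {f : ℝ → ℝ}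

lemma sq_norm_star_dotProduct_le (hf : IntegrableOn f freqDomain)
    (hf' : IntegrableOn (fun x => 1 / f x) freqDomain) (hfpos : ∀ x ∈ freqDomain, 0 < f x)
    (w z : Fin n → ℂ) :
    (2 * Real.pi) ^ 2 * ‖star w ⬝ᵥ z‖ ^ 2 ≤
      (∫ x in freqDomain, f x * ‖star (evec n x) ⬝ᵥ w‖ ^ 2) *
        ∫ x in freqDomain, 1 / f x * ‖star (evec n x) ⬝ᵥ z‖ ^ 2 := by
  have := sq_norm_star_dotProduct_toeplitz_le (h := fun _ => 1) (integrable_const _) hf hf'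
    (fun x hx => (hfpos x hx).le) (fun x hx => (one_div_pos.2 (hfpos x hx)).le)
    (fun x hx => by have := (hfpos x hx).ne'; field_simp) w z
  rwa [toeplitz_one, Matrix.smul_mulVec, Matrix.one_mulVec, dotProduct_smul, smul_eq_mul, norm_mul,
    Complex.norm_real, Real.norm_of_nonneg (by have := Real.pi_pos; positivity), mul_pow] at this

/-- A vanishing quadratic form would force `‖w‖ = 0` by Cauchy–Schwarz against `1/f`, which is
integrable. -/
lemma posDef_toeplitz (hf : IntegrableOn f freqDomain)
    (hf' : IntegrableOn (fun x => 1 / f x) freqDomain) (hfpos : ∀ x ∈ freqDomain, 0 < f x) :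
    (toeplitz n f).PosDef := by
  refine Matrix.PosDef.of_dotProduct_mulVec_pos (isHermitian_toeplitz n f) fun w hw => ?_
  rw [star_dotProduct_toeplitz_mulVec hf, Complex.zero_lt_real]
  have h0 : 0 ≤ ∫ x in freqDomain, f x * ‖star (evec n x) ⬝ᵥ w‖ ^ 2 :=
    setIntegral_nonneg measurableSet_freqDomain fun x hx =>
      mul_nonneg (hfpos x hx).le (sq_nonneg _)
  refine h0.lt_of_ne fun h => ?_
  have h1 := sq_norm_star_dotProduct_le hf hf' hfpos w w
  rw [← h, zero_mul] at h1
  have h2 : 0 < ‖star w ⬝ᵥ w‖ := norm_pos_iff.2 (by rwa [Ne, dotProduct_star_self_eq_zero])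
  have := Real.pi_pos
  have h3 : 0 < (2 * Real.pi) ^ 2 * ‖star w ⬝ᵥ w‖ ^ 2 := by positivity
  linarith

/-- With `y = T_n(f)⁻¹ x`, the number `t` is both the `T_n(f)`-form of `y` and the inner product of
`y` and `x`. Cauchy–Schwarz reads `(2π)² t² ≤ t T`, and one factor `t` is cancelled unless it is
zero. -/
lemma posSemidef_toeplitz_one_div_sub_inv (hf : IntegrableOn f freqDomain)
    (hf' : IntegrableOn (fun x => 1 / f x) freqDomain) (hfpos : ∀ x ∈ freqDomain, 0 < f x) :
    ((((2 * Real.pi) ^ 2)⁻¹ : ℝ) • toeplitz n (fun x => 1 / f x) -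
      (toeplitz n f)⁻¹).PosSemidef := by
  have hpd := posDef_toeplitz (n := n) hf hf' hfpos
  have hpi := Real.pi_pos
  refine Matrix.PosSemidef.of_dotProduct_mulVec_nonneg
    (Matrix.IsHermitian.sub ?_ hpd.isHermitian.inv) fun x => ?_
  · rw [Matrix.IsHermitian, Matrix.conjTranspose_smul, (isHermitian_toeplitz n _).eq, star_trivial]
  set y := (toeplitz n f)⁻¹.mulVec x with hy
  have hxy : (toeplitz n f).mulVec y = x := by
    rw [hy, Matrix.mulVec_mulVec,
      Matrix.mul_nonsing_inv _ ((Matrix.isUnit_iff_isUnit_det _).1 hpd.isUnit),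
      Matrix.one_mulVec]
  set t := ∫ ξ in freqDomain, f ξ * ‖star (evec n ξ) ⬝ᵥ y‖ ^ 2 with ht
  set T := ∫ ξ in freqDomain, 1 / f ξ * ‖star (evec n ξ) ⬝ᵥ x‖ ^ 2 with hT
  have hyx : star y ⬝ᵥ x = (t : ℂ) := by
    rw [← star_dotProduct_toeplitz_mulVec hf, hxy]
  have hxy' : star x ⬝ᵥ y = (t : ℂ) := by
    rw [Matrix.star_dotProduct, hyx, ← starRingEnd_apply, Complex.conj_ofReal]
  have ht0 : 0 ≤ t := setIntegral_nonneg measurableSet_freqDomain fun x hx =>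
      mul_nonneg (hfpos x hx).le (sq_nonneg _)
  have hT0 : 0 ≤ T := setIntegral_nonneg measurableSet_freqDomain fun x hx =>
      mul_nonneg (one_div_pos.2 (hfpos x hx)).le (sq_nonneg _)
  have hcs := sq_norm_star_dotProduct_le hf hf' hfpos y x
  rw [hyx, Complex.norm_real, Real.norm_of_nonneg ht0, ← ht, ← hT] at hcs
  have hle : t ≤ ((2 * Real.pi) ^ 2)⁻¹ * T := by
    rw [inv_mul_eq_div, le_div_iff₀ (by positivity)]
    rcases ht0.eq_or_lt with h | h
    · rw [← h, zero_mul]; exact hT0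
    · exact le_of_mul_le_mul_left (by linarith) h
  rw [Matrix.sub_mulVec, dotProduct_sub, ← hy, hxy', Matrix.smul_mulVec, dotProduct_smul,
    star_dotProduct_toeplitz_mulVec hf', ← hT, Complex.real_smul, ← Complex.ofReal_mul,
    ← Complex.ofReal_sub, Complex.zero_le_real]
  linarith

end
end ToeplitzTrace

/-! ### Operator norms, traces and replacement of the inverses. -/

namespace ToeplitzTrace
open scoped Matrix.Norms.L2Operator ComplexOrder

section
variable {n : ℕ}

lemma norm_star_dotProduct_le (w z : Fin n → ℂ) :
    ‖star w ⬝ᵥ z‖ ≤ ‖WithLp.toLp 2 w‖ * ‖WithLp.toLp 2 z‖ := by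
  have := norm_inner_le_norm (𝕜 := ℂ) (WithLp.toLp 2 w) (WithLp.toLp 2 z)
  rwa [EuclideanSpace.inner_toLp_toLp, dotProduct_comm] at this

lemma star_dotProduct_self_eq (w : Fin n → ℂ) :
    star w ⬝ᵥ w = ((‖WithLp.toLp 2 w‖ ^ 2 : ℝ) : ℂ) := by
  have := inner_self_eq_norm_sq_to_K (𝕜 := ℂ) (WithLp.toLp 2 w)
  rw [EuclideanSpace.inner_toLp_toLp, dotProduct_comm] at this
  rw [this]; push_cast; rfl

lemma norm_star_dotProduct_mulVec_le (Q : Matrix (Fin n) (Fin n) ℂ) (w : Fin n → ℂ) :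
    ‖star w ⬝ᵥ Q.mulVec w‖ ≤ ‖Q‖ * ‖WithLp.toLp 2 w‖ ^ 2 := by
  have h1 := norm_star_dotProduct_le w (Q.mulVec w)
  have h2 := Matrix.l2_opNorm_mulVec Q (WithLp.toLp 2 w)
  have h3 : ‖WithLp.toLp 2 (Q.mulVec w)‖ ≤ ‖Q‖ * ‖WithLp.toLp 2 w‖ := h2
  nlinarith [norm_nonneg (WithLp.toLp 2 w)]

lemma l2_opNorm_le_of_bilin {A : Matrix (Fin n) (Fin n) ℂ} {c : ℝ} (hc : 0 ≤ c)
    (h : ∀ w z, ‖star w ⬝ᵥ A.mulVec z‖ ≤ c * ‖WithLp.toLp 2 w‖ * ‖WithLp.toLp 2 z‖) :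
    ‖A‖ ≤ c := by
  rw [Matrix.cstar_norm_def]
  refine ContinuousLinearMap.opNorm_le_bound _ hc fun z => ?_
  have h1 := h (A.mulVec z.ofLp) z.ofLp
  rw [star_dotProduct_self_eq, Complex.norm_real, Real.norm_of_nonneg (sq_nonneg _)] at h1
  have h2 : Matrix.toEuclideanCLM (n := Fin n) (𝕜 := ℂ) A z = WithLp.toLp 2 (A.mulVec z.ofLp) := rfl
  rw [h2]
  rcases (norm_nonneg (WithLp.toLp 2 (A.mulVec z.ofLp))).eq_or_lt with h0 | h0
  · rw [← h0]; positivity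
  · refine le_of_mul_le_mul_left ?_ h0
    rw [WithLp.toLp_ofLp] at h1
    nlinarith

lemma trace_mul_conjTranspose_mul_self (Q V : Matrix (Fin n) (Fin n) ℂ) :
    (Q * (V.conjTranspose * V)).trace = ∑ k, star (star (V k)) ⬝ᵥ Q.mulVec (star (V k)) := by
  rw [← Matrix.mul_assoc, Matrix.trace_mul_comm, ← Matrix.mul_assoc, Matrix.trace]
  refine Finset.sum_congr rfl fun k _ => ?_
  rw [Matrix.diag_apply, Matrix.mul_assoc, star_star]
  rfl

lemma re_trace_conjTranspose_mul_self (V : Matrix (Fin n) (Fin n) ℂ) :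
    (V.conjTranspose * V).trace.re = ∑ k, ‖WithLp.toLp 2 (star (V k))‖ ^ 2 := by
  have := trace_mul_conjTranspose_mul_self 1 V
  rw [one_mul] at this
  rw [this, Complex.re_sum]
  refine Finset.sum_congr rfl fun k _ => ?_
  rw [Matrix.one_mulVec, star_dotProduct_self_eq, Complex.ofReal_re]

lemma exists_eq_conjTranspose_mul_self {W : Matrix (Fin n) (Fin n) ℂ} (hW : W.PosSemidef) :
    ∃ V : Matrix (Fin n) (Fin n) ℂ, W = V.conjTranspose * V := by
  open scoped MatrixOrder in
  obtain ⟨V, hV⟩ := CStarAlgebra.nonneg_iff_eq_star_mul_self.mp hW.nonneg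
  exact ⟨V, hV⟩

/-- Duality of operator norm and trace norm: with `W = V^* V` the trace is a sum of values of the
form `Q` at the conjugated rows of `V`. -/
lemma norm_trace_mul_le (Q : Matrix (Fin n) (Fin n) ℂ) {W : Matrix (Fin n) (Fin n) ℂ}
    (hW : W.PosSemidef) : ‖(Q * W).trace‖ ≤ ‖Q‖ * W.trace.re := by
  obtain ⟨V, rfl⟩ := exists_eq_conjTranspose_mul_self hW
  rw [trace_mul_conjTranspose_mul_self, re_trace_conjTranspose_mul_self, Finset.mul_sum]
  exact (norm_sum_le _ _).trans (Finset.sum_le_sum fun k _ => norm_star_dotProduct_mulVec_le _ _)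

lemma l2_opNorm_le_re_trace {W : Matrix (Fin n) (Fin n) ℂ} (hW : W.PosSemidef) :
    ‖W‖ ≤ W.trace.re := by
  have h0 : 0 ≤ W.trace.re := (Complex.nonneg_iff.1 hW.trace_nonneg).1
  obtain ⟨V, rfl⟩ := exists_eq_conjTranspose_mul_self hW
  refine l2_opNorm_le_of_bilin h0 fun w z => ?_
  have hV : ∀ w, ‖WithLp.toLp 2 (V.mulVec w)‖ ≤
      √((V.conjTranspose * V).trace.re) * ‖WithLp.toLp 2 w‖ := by
    intro w
    refine abs_le_of_sq_le_sq' ?_ (by positivity) |>.2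
    rw [mul_pow, Real.sq_sqrt h0, re_trace_conjTranspose_mul_self, Finset.sum_mul,
      EuclideanSpace.norm_sq_eq]
    refine Finset.sum_le_sum fun k _ => ?_
    rw [← mul_pow]
    refine pow_le_pow_left₀ (norm_nonneg _) ?_ 2
    have := norm_star_dotProduct_le (star (V k)) w
    rwa [star_star] at this
  rw [← Matrix.mulVec_mulVec, Matrix.dotProduct_mulVec, ← Matrix.star_mulVec]
  refine (norm_star_dotProduct_le _ _).trans ?_
  refine (mul_le_mul (hV w) (hV z) (norm_nonneg _) (by positivity)).trans (le_of_eq ?_)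
  linear_combination (‖WithLp.toLp 2 w‖ * ‖WithLp.toLp 2 z‖) * Real.mul_self_sqrt h0

lemma trace_prod_conj {U Y : ℕ → Matrix (Fin n) (Fin n) ℂ} (hU : ∀ l, IsUnit (U l).det) (r : ℕ) :
    ∀ j, ((List.range' j r).map fun l => U l * Y l * (U (l + 1))⁻¹).prod =
      U j * ((List.range' j r).map Y).prod * (U (j + r))⁻¹ := by
  induction r with
  | zero => intro j; simp [Matrix.mul_nonsing_inv _ (hU j)]
  | succ r ih =>
    intro j
    rw [List.range'_succ, List.map_cons, List.prod_cons, ih, List.map_cons, List.prod_cons,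
      show j + 1 + r = j + (r + 1) by ring]
    simp only [Matrix.mul_assoc]
    rw [Matrix.nonsing_inv_mul_cancel_left _ _ (hU (j + 1))]

lemma norm_prod_le [NeZero n] {Y : ℕ → Matrix (Fin n) (Fin n) ℂ} {ρ : ℝ}
    (hY : ∀ l, ‖Y l‖ ≤ ρ) (r : ℕ) :
    ∀ j, ‖((List.range' j r).map Y).prod‖ ≤ ρ ^ r := by
  have hρ := (norm_nonneg _).trans (hY 0)
  induction r with
  | zero => intro j; simp
  | succ r ih =>
    intro j
    rw [List.range'_succ, List.map_cons, List.prod_cons, pow_succ']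
    exact (norm_mul_le _ _).trans (mul_le_mul (hY j) (ih _) (norm_nonneg _) hρ)

/-- Telescoping, one factor at a time. The prefix `Z` collects the matrices to the left; each error
term contains exactly one exposed `W j`, which enters through its trace, while everything else
enters through operator norms. -/
lemma norm_trace_prod_sub_le [NeZero n] {M W : ℕ → Matrix (Fin n) (Fin n) ℂ} {δ τ : ℝ}
    (hM : ∀ l, ‖M l‖ ≤ δ) (hW : ∀ l, (W l).PosSemidef) (hτ : ∀ l, (W l).trace.re ≤ τ) (r : ℕ) :
    ∀ (j : ℕ) (Z : Matrix (Fin n) (Fin n) ℂ),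
      ‖(Z * (((List.range' j r).map fun l => M l * (1 + W l)).prod -
        ((List.range' j r).map M).prod)).trace‖ ≤ ‖Z‖ * (r * (δ * (1 + τ)) ^ r * τ) := by
  have hδ := (norm_nonneg _).trans (hM 0)
  have hτ0 : 0 ≤ τ := (Complex.nonneg_iff.1 (hW 0).trace_nonneg).1.trans (hτ 0)
  have hX : ∀ l, ‖M l * (1 + W l)‖ ≤ δ * (1 + τ) := by
    intro l
    refine (norm_mul_le _ _).trans (mul_le_mul (hM l) ?_ (norm_nonneg _) hδ)
    refine (norm_add_le _ _).trans (add_le_add (le_of_eq norm_one) ?_)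
    exact (l2_opNorm_le_re_trace (hW l)).trans (hτ l)
  induction r with
  | zero => intro j Z; simp
  | succ r ih =>
    intro j Z
    rw [List.range'_succ]
    simp only [List.map_cons, List.prod_cons]
    set P := ((List.range' (j + 1) r).map fun l => M l * (1 + W l)).prod with hP
    set P' := ((List.range' (j + 1) r).map M).prod with hP'
    have hsplit : Z * (M j * (1 + W j) * P - M j * P') =
        (Z * M j) * (P - P') + (Z * M j) * W j * P := by noncomm_ring
    rw [hsplit, Matrix.trace_add, Matrix.trace_mul_comm (Z * M j * W j), ← Matrix.mul_assoc]
    have h1 : ‖Z * M j‖ ≤ ‖Z‖ * δ :=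
      (norm_mul_le _ _).trans (mul_le_mul_of_nonneg_left (hM j) (norm_nonneg _))
    have h2 : ‖P * (Z * M j)‖ ≤ (δ * (1 + τ)) ^ r * (‖Z‖ * δ) :=
      (norm_mul_le _ _).trans (mul_le_mul (norm_prod_le hX r _) h1 (norm_nonneg _) (by positivity))
    calc _ ≤ ‖Z‖ * δ * (r * (δ * (1 + τ)) ^ r * τ) + (δ * (1 + τ)) ^ r * (‖Z‖ * δ) * τ := by
          refine (norm_add_le _ _).trans (add_le_add ?_ ?_)
          · exact (ih (j + 1) _).trans (mul_le_mul_of_nonneg_right h1 (by positivity))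
          · exact (norm_trace_mul_le _ (hW j)).trans (mul_le_mul h2 (hτ j)
              (Complex.nonneg_iff.1 (hW j).trace_nonneg).1 (by positivity))
      _ = ‖Z‖ * ((r + 1) * (δ * (1 + τ)) ^ r * δ * τ) := by ring
      _ ≤ ‖Z‖ * ((r + 1) * (δ * (1 + τ)) ^ r * (δ * (1 + τ)) * τ) := by
          gcongr
          nlinarith
      _ = _ := by push_cast; ring

/-- The effect on the trace of a product `∏ A B⁻¹` of replacing each `B⁻¹` by a matrix `C ≥ B⁻¹`. -/
lemma norm_trace_prod_sub_trace_prod_inv_le [NeZero n] {p : ℕ} [NeZero p]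
    {A B C : Fin p → Matrix (Fin n) (Fin n) ℂ} {δ τ : ℝ} (hδ : 0 ≤ δ)
    (hB : ∀ l, (B l).PosDef) (hC : ∀ l, (C l - (B l)⁻¹).PosSemidef)
    (hτ : ∀ l, (B l * C l).trace.re - n ≤ τ)
    (hA : ∀ l j w z, ‖star w ⬝ᵥ (A l).mulVec z‖ ^ 2 ≤
      (δ * (star w ⬝ᵥ (B j).mulVec w).re) * (δ * (star z ⬝ᵥ (B l).mulVec z).re)) :
    ‖(List.ofFn fun l => A l * C l).prod.trace - (List.ofFn fun l => A l * (B l)⁻¹).prod.trace‖ ≤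
      p * (δ * (1 + τ)) ^ p * τ := by
  choose T hT using fun l => exists_eq_conjTranspose_mul_self (hB l).posSemidef
  -- The cyclic shift puts `A l` between the factors of `B (l - 1)` and `B l`. This is why `hA`
  -- compares `A l` with the form of an arbitrary `B j` on one side.
  set S : ℕ → Matrix (Fin n) (Fin n) ℂ := fun l => T (Fin.ofNat p l - 1) with hS
  have hS1 : ∀ l, S (l + 1) = T (Fin.ofNat p l) := by
    intro l
    have : Fin.ofNat p (l + 1) = Fin.ofNat p l + 1 :=
      Fin.ext (by simp only [Fin.ofNat, Fin.val_add, Fin.val_one']; exact Nat.add_mod _ _ _)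
    rw [hS]; simp only [this, add_sub_cancel_right]
  have hSp : S p = S 0 := by
    have : Fin.ofNat p p = Fin.ofNat p 0 := by simp
    rw [hS]; simp only [this]
  have hTu : ∀ l, IsUnit (T l).det := by
    intro l
    have := (Matrix.isUnit_iff_isUnit_det _).1 (hB l).isUnit
    rw [hT l, Matrix.det_mul] at this
    exact isUnit_of_mul_isUnit_right this
  have hSu : ∀ l, IsUnit (S l).det := fun l => hTu _
  have hSu' : ∀ l, IsUnit (S l).conjTranspose.det := fun l => by
    rw [Matrix.det_conjTranspose]; exact (hSu l).star
  set A' : ℕ → Matrix (Fin n) (Fin n) ℂ := finExtend A with hA'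
  set C' : ℕ → Matrix (Fin n) (Fin n) ℂ := finExtend C with hC'
  set B' : ℕ → Matrix (Fin n) (Fin n) ℂ := finExtend B with hB'
  have hBS : ∀ l, B' l = (S (l + 1)).conjTranspose * S (l + 1) := fun l => by
    rw [hS1]; exact hT _
  have hBinv : ∀ l, (B' l)⁻¹ = (S (l + 1))⁻¹ * ((S (l + 1)).conjTranspose)⁻¹ := fun l => by
    rw [hBS, Matrix.mul_inv_rev]
  set M : ℕ → Matrix (Fin n) (Fin n) ℂ :=
    fun l => ((S l).conjTranspose)⁻¹ * A' l * (S (l + 1))⁻¹ with hM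
  -- The defect conjugated by the factor of `B l`, so that its trace is `tr (B l * C l) - n`.
  set W : ℕ → Matrix (Fin n) (Fin n) ℂ :=
    fun l => S (l + 1) * (C' l - (B' l)⁻¹) * (S (l + 1)).conjTranspose with hW
  have hW1 : ∀ l, 1 + W l = S (l + 1) * C' l * (S (l + 1)).conjTranspose := by
    intro l
    have : S (l + 1) * (B' l)⁻¹ * (S (l + 1)).conjTranspose = 1 := by
      rw [hBinv, ← Matrix.mul_assoc, Matrix.mul_nonsing_inv _ (hSu _), Matrix.one_mul,
        Matrix.nonsing_inv_mul _ (hSu' _)]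
    rw [hW]; simp only
    rw [Matrix.mul_sub, Matrix.sub_mul, this]
    abel
  have hWpsd : ∀ l, (W l).PosSemidef := fun l => (hC _).mul_mul_conjTranspose_same _
  have hWτ : ∀ l, (W l).trace.re ≤ τ := by
    intro l
    have h1 : (W l).trace = (B' l * C' l).trace - n := by
      have h2 : W l = S (l + 1) * C' l * (S (l + 1)).conjTranspose - 1 := by rw [← hW1]; abel
      rw [h2, Matrix.trace_sub, Matrix.trace_mul_comm, ← Matrix.mul_assoc, ← hBS, Matrix.trace_one,
        Fintype.card_fin]
    rw [h1, Complex.sub_re, Complex.natCast_re]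
    exact hτ _
  have hMn : ∀ l, ‖M l‖ ≤ δ := by
    intro l
    refine l2_opNorm_le_of_bilin hδ fun w z => ?_
    have hkey : ∀ (j : Fin p) (w : Fin n → ℂ),
        (star ((T j)⁻¹.mulVec w) ⬝ᵥ (B j).mulVec ((T j)⁻¹.mulVec w)).re =
        ‖WithLp.toLp 2 w‖ ^ 2 := by
      intro j w
      rw [hT j, ← Matrix.mulVec_mulVec, Matrix.dotProduct_mulVec, ← Matrix.star_mulVec,
        Matrix.mulVec_mulVec, Matrix.mul_nonsing_inv _ (hTu j), Matrix.one_mulVec,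
        star_dotProduct_self_eq, Complex.ofReal_re]
    have h1 := hA (Fin.ofNat p l) (Fin.ofNat p l - 1) ((S l)⁻¹.mulVec w) ((S (l + 1))⁻¹.mulVec z)
    rw [hS1, hkey, hkey] at h1
    have h2 : star w ⬝ᵥ (M l).mulVec z =
        star ((S l)⁻¹.mulVec w) ⬝ᵥ (A (Fin.ofNat p l)).mulVec ((T (Fin.ofNat p l))⁻¹.mulVec z) := by
      rw [hM]; simp only
      rw [hS1, ← Matrix.mulVec_mulVec, ← Matrix.mulVec_mulVec, Matrix.dotProduct_mulVec,
        ← Matrix.conjTranspose_nonsing_inv, ← Matrix.star_mulVec]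
      rfl
    rw [h2]
    refine abs_le_of_sq_le_sq' (h1.trans (le_of_eq (by ring))) (by positivity) |>.2
  have hAC : ∀ l, A' l * C' l =
      (S l).conjTranspose * (M l * (1 + W l)) * ((S (l + 1)).conjTranspose)⁻¹ := by
    intro l
    rw [hW1, hM]
    simp only [Matrix.mul_assoc]
    rw [Matrix.mul_nonsing_inv _ (hSu' _), Matrix.mul_one,
      Matrix.nonsing_inv_mul_cancel_left _ _ (hSu _),
      Matrix.mul_nonsing_inv_cancel_left _ _ (hSu' _)]
  have hAB : ∀ l, A' l * (B' l)⁻¹ =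
      (S l).conjTranspose * M l * ((S (l + 1)).conjTranspose)⁻¹ := by
    intro l
    rw [hBinv, hM]
    simp only [Matrix.mul_assoc]
    rw [Matrix.mul_nonsing_inv_cancel_left _ _ (hSu' _)]
  -- The conjugations cancel between neighbours, and at the ends by `S p = S 0` and cyclicity of the
  -- trace.
  have htr : ∀ Y : ℕ → Matrix (Fin n) (Fin n) ℂ, ((List.range' 0 p).map fun l =>
      (S l).conjTranspose * Y l * ((S (l + 1)).conjTranspose)⁻¹).prod.trace =
      ((List.range' 0 p).map Y).prod.trace := by
    intro Y
    rw [trace_prod_conj (U := fun l => (S l).conjTranspose) hSu' p 0, zero_add, hSp,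
      Matrix.trace_mul_comm, Matrix.nonsing_inv_mul_cancel_left _ _ (hSu' _)]
  have h1 : (List.ofFn fun l => A l * C l) = (List.range' 0 p).map fun l =>
      (S l).conjTranspose * (M l * (1 + W l)) * ((S (l + 1)).conjTranspose)⁻¹ := by
    rw [← ofFn_eq_map_range']
    congr 1; ext1 l
    rw [← hAC, hA', hC', finExtend_coe, finExtend_coe]
  have h2 : (List.ofFn fun l => A l * (B l)⁻¹) = (List.range' 0 p).map fun l =>
      (S l).conjTranspose * M l * ((S (l + 1)).conjTranspose)⁻¹ := by
    rw [← ofFn_eq_map_range']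
    congr 1; ext1 l
    rw [← hAB, hA', hB', finExtend_coe, finExtend_coe]
  rw [h1, h2, htr, htr, ← Matrix.trace_sub]
  have := norm_trace_prod_sub_le hMn hWpsd hWτ p 0 1
  rwa [one_mul, norm_one, one_mul] at this

end
end ToeplitzTrace

/-! ### Assembly of the error bound. -/

namespace ToeplitzTrace
open MeasureTheory
open scoped ComplexOrder

section
variable {m q : ℕ} {n p : ℕ} {ε η M : ℝ}

lemma InSumInter.integrableOn [NeZero q] {c α : Fin m → Fin q → ℝ} {L h : ℝ → ℝ}
    (hh : InSumInter c α L h) : IntegrableOn h freqDomain := by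
  obtain ⟨u, hu, hsum⟩ := hh
  have h1 : IntegrableOn (fun x => ∑ i, u i x) freqDomain :=
    integrable_finsetSum _ fun i _ => (hu i 0).2.1
  exact h1.congr_fun (fun x hx => (hsum x hx).symm) measurableSet_freqDomain

lemma deltaSum_mono (hn : 1 ≤ n) {s : Selection m q} {e cbar b αbar : Fin m → Fin q → ℝ}
    (he : ∀ i k, 0 < e i k) (hcb : ∀ i k, 0 < cbar i k) {ε' : ℝ} (h : ε ≤ ε') :
    deltaSum s e cbar b αbar ε n ≤ deltaSum s e cbar b αbar ε' n := by
  refine Finset.sum_le_sum fun i _ => Finset.sum_le_sum fun k _ => ?_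
  refine mul_le_mul_of_nonneg_left ?_ (div_pos (he _ _) (hcb _ _)).le
  exact Real.rpow_le_rpow_of_exponent_le (by exact_mod_cast hn) (by linarith)

lemma deltaOp_mono (hn : 1 ≤ n) {s : Selection m q} {d cbar αbar β : Fin m → Fin q → ℝ}
    (hd : ∀ i k, 0 < d i k) (hcb : ∀ i k, 0 < cbar i k) {ε' : ℝ} (h : ε ≤ ε') :
    deltaOp s d cbar αbar β η ε n ≤ deltaOp s d cbar αbar β η ε' n := by
  refine Finset.sum_le_sum fun i _ => Finset.sum_le_sum fun k _ => ?_
  refine mul_le_mul_of_nonneg_left ?_ (div_pos (hd _ _) (hcb _ _)).le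
  have h1 : (1 : ℝ) ≤ n := by exact_mod_cast hn
  exact Real.rpow_le_rpow_of_exponent_le
    (one_le_mul_of_one_le_of_one_le (one_le_ratioR _ _ _ _ _ _) h1) (by linarith)

/-- The constant of the main theorem, for exponents bounded by `M`. -/
noncomputable def errorConst (p q : ℕ) (l ε M : ℝ) : ℝ :=
  traceConst ε (2 * 3 ^ (M + 1)) 1 (2 * p - 1) * compatConst l M ^ p +
    p * (opConst q l ε M * (1 + traceConst ε (2 * 3 ^ (M + 1)) 1 1 * compatConst l M)) ^ p *
      (traceConst ε (2 * 3 ^ (M + 1)) 1 1 * compatConst l M)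

variable [NeZero m] [NeZero q]

/-- The trace approximation for the two symbols `f` and `1/f`: their product integrates to `2π`, so
the main term is `n (2π)²`, and the normalisation reduces it to `n`. -/
lemma re_trace_toeplitz_mul_sub_le (hn : 1 ≤ n) (s : Selection m q)
    {c α cbar αbar : Fin m → Fin q → ℝ} {L f : ℝ → ℝ} (hL : 0 < L ε) (hε : 0 < ε) (hε1 : ε < 1)
    (hεη : 3 * ε ≤ η) (hc : ∀ i k, 0 < c i k) (hcb : ∀ i k, 0 < cbar i k)
    (hα : ∀ i k, |α i k| ≤ M) (ha : ∀ i k, |αbar i k| ≤ M)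
    (hα1 : ∀ i k, α i (s.col i k) < 1 - η) (ha1 : ∀ i k, -1 + η < αbar (s.row i k) k)
    (hgap : ∀ i k, max (gap s α αbar i k) 0 < 1 - η)
    (hfpos : ∀ x ∈ freqDomain, 0 < f x) (hf : InSumInter c α L f)
    (hf' : InSumInter (fun k i => 1 / cbar i k) (fun k i => -αbar i k) L (fun x => 1 / f x)) :
    (toeplitz n f * (((2 * Real.pi) ^ 2)⁻¹ : ℝ) • toeplitz n (fun x => 1 / f x)).trace.re - n ≤
      traceConst ε (2 * 3 ^ (M + 1)) 1 1 * compatConst (L ε) M *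
        deltaSum s c cbar α αbar (4 * ε) n := by
  have h := (integrableOn_prod_and_norm_trace_sub_le (p := 1) (M := M) hn s hL hε hε1
    (by norm_num; linarith) hc hcb hα ha hα1 ha1 (by simpa using hgap) (u := fun _ => f)
    (v := fun _ x => 1 / f x) (fun _ => hf) (fun _ => hf')).2
  have hpi := Real.pi_gt_three
  have hint : ∫ x in freqDomain, ∏ _l : Fin 1, f x * (1 / f x) = 2 * Real.pi := by
    have h1 : ∀ x ∈ freqDomain, ∏ _l : Fin 1, f x * (1 / f x) = 1 := fun x hx => by
      have := (hfpos x hx).ne'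
      simp [this]
    rw [setIntegral_congr_fun measurableSet_freqDomain h1, ← intervalIntegral_eq_freqDomain,
      intervalIntegral.integral_const]
    simp; ring
  rw [hint] at h
  simp only [List.ofFn_succ, List.ofFn_zero, List.prod_cons, List.prod_nil, mul_one, pow_one,
    Nat.reduceSub] at h
  set B := traceConst ε (2 * 3 ^ (M + 1)) 1 1 * compatConst (L ε) M *
        deltaSum s c cbar α αbar (4 * ε) n with hB
  set t := (toeplitz n f * toeplitz n (fun x => 1 / f x)).trace with ht
  have h1 := (Complex.re_le_norm _).trans h
  rw [Complex.sub_re, Complex.ofReal_re] at h1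
  have hB0 : 0 ≤ B := (norm_nonneg _).trans h
  rw [Matrix.mul_smul, Matrix.trace_smul, Complex.smul_re, smul_eq_mul, ← ht]
  have hκ : 1 ≤ (2 * Real.pi) ^ 2 := by nlinarith
  rw [inv_mul_eq_div, sub_le_iff_le_add, div_le_iff₀ (by positivity)]
  nlinarith

lemma norm_trace_prod_toeplitz_sub_le [NeZero p] (hn : 1 ≤ n) {s₁ s₂ s₃ : Selection m q}
    {α αbar β c cbar d : Fin m → Fin q → ℝ} {L : ℝ → ℝ} (hL : 0 < L ε) (hε : 0 < ε)
    (hεη : 4 * (2 * p + 1) * ε ≤ η) (hη : η < 1)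
    (hα : ∀ i k, |α i k| ≤ M) (ha : ∀ i k, |αbar i k| ≤ M) (hβ : ∀ i k, |β i k| ≤ M)
    (hadm : Admissible p η α αbar β s₁ s₂ s₃)
    (hc : ∀ i k, 0 < c i k) (hcb : ∀ i k, 0 < cbar i k) (hd : ∀ i k, 0 < d i k)
    {f g : Fin p → ℝ → ℝ} (hfpos : ∀ l, ∀ x ∈ freqDomain, 0 < f l x)
    (hf : ∀ l, InSumInter c α L (f l))
    (hf' : ∀ l, InSumInter (fun k i => 1 / cbar i k) (fun k i => -αbar i k) L
      (fun x => 1 / f l x))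
    (hg : ∀ l, InSumInter d β L (g l)) :
    IntegrableOn (fun x => ∏ l, g l x * (1 / f l x)) freqDomain ∧
    ‖(List.ofFn fun l : Fin p => toeplitz n (g l) * (toeplitz n (f l))⁻¹).prod.trace -
        ((n * (1 / (2 * Real.pi) * ∫ x in freqDomain, ∏ l, g l x * (1 / f l x)) : ℝ) : ℂ)‖ ≤
      errorConst p q (L ε) ε M * max 1 (deltaSum s₃ c cbar α αbar (4 * ε) n) *
        (deltaSum s₂ d cbar β αbar (4 * ε) n ^ p +
          (max 1 (deltaSum s₃ c cbar α αbar (4 * ε) n) *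
            deltaOp s₁ d cbar αbar β η (4 * ε / η) n) ^ p) := by
  have hp0 : (1 : ℝ) ≤ p := by exact_mod_cast (NeZero.one_le : 1 ≤ p)
  have : NeZero n := ⟨by omega⟩
  have hpi := Real.pi_gt_three
  have hpε : ε ≤ p * ε := by nlinarith
  have hε1 : ε < 1 := by nlinarith
  obtain ⟨hint, htr⟩ := integrableOn_prod_and_norm_trace_sub_le (M := M) hn s₂ hL hε hε1
    (by nlinarith) hd hcb hβ ha hadm.beta_lt hadm.lt_alphabar hadm.mul_gap_beta hg hf'
  refine ⟨hint, ?_⟩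
  set κ : ℝ := ((2 * Real.pi) ^ 2)⁻¹ with hκ
  have hκ0 : 0 ≤ κ := by positivity
  have hκ1 : κ ≤ 1 := inv_le_one_of_one_le₀ (by nlinarith)
  set I := ∫ x in freqDomain, ∏ l, g l x * (1 / f l x) with hI
  set K₂ := traceConst ε (2 * 3 ^ (M + 1)) 1 (2 * p - 1) * compatConst (L ε) M ^ p with hK₂
  set K₁ := traceConst ε (2 * 3 ^ (M + 1)) 1 1 * compatConst (L ε) M with hK₁
  set K₃ := opConst q (L ε) ε M with hK₃
  have hC0 : (0 : ℝ) ≤ 2 * 3 ^ (M + 1) := by positivity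
  have hK₁0 : 0 ≤ K₁ := mul_nonneg (traceConst_nonneg hC0 zero_le_one _) (compatConst_nonneg _ _)
  have hK₂0 : 0 ≤ K₂ :=
    mul_nonneg (traceConst_nonneg hC0 zero_le_one _) (pow_nonneg (compatConst_nonneg _ _) _)
  have hK₃0 : 0 ≤ K₃ := opConst_nonneg hL.le
  set Δ₂ := deltaSum s₂ d cbar β αbar (4 * ε) n with hΔ₂
  set Δ₃ := deltaSum s₃ c cbar α αbar (4 * ε) n with hΔ₃
  set Δ := max 1 Δ₃ with hΔ
  set δ := deltaOp s₁ d cbar αbar β η (4 * ε / η) n with hδ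
  have hδ0 : 0 ≤ δ := deltaOp_nonneg hd hcb
  have hΔ₂0 : 0 ≤ Δ₂ := deltaSum_nonneg hd hcb
  have hΔ1 : 1 ≤ Δ := le_max_left _ _
  set C : Fin p → Matrix (Fin n) (Fin n) ℂ := fun l => κ • toeplitz n (fun x => 1 / f l x) with hC
  have hfi : ∀ l, IntegrableOn (f l) freqDomain := fun l => (hf l).integrableOn
  have hfi' : ∀ l, IntegrableOn (fun x => 1 / f l x) freqDomain := fun l => by
    have : NeZero m := inferInstance
    exact (hf' l).integrableOn
  have hgi : ∀ l, IntegrableOn (g l) freqDomain := fun l => (hg l).integrableOn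
  have hgap₃ : ∀ i k, max (gap s₃ α αbar i k) 0 < 1 - η := fun i k => by
    have := hadm.mul_gap_alpha i k
    nlinarith [le_max_right (gap s₃ α αbar i k) 0]
  have hτ : ∀ l, (toeplitz n (f l) * C l).trace.re - n ≤ K₁ * Δ := fun l =>
    (re_trace_toeplitz_mul_sub_le hn s₃ hL hε hε1 (by nlinarith) hc hcb hα ha hadm.alpha_lt
      hadm.lt_alphabar' hgap₃ (hfpos l) (hf l) (hf' l)).trans
      (mul_le_mul_of_nonneg_left (le_max_right _ _) hK₁0)
  have hquad : ∀ l j (w : Fin n → ℂ), ∫ x in freqDomain, |g l x| * ‖star (evec n x) ⬝ᵥ w‖ ^ 2 ≤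
      K₃ * δ * (star w ⬝ᵥ (toeplitz n (f j)).mulVec w).re := by
    intro l j w
    rw [star_dotProduct_toeplitz_mulVec (hfi j), Complex.ofReal_re]
    exact integral_abs_mul_sq_norm_le hn s₁ hL hε (by nlinarith) hη hd hcb hβ ha hadm.max_add_min
      hadm.gap_lt hadm.alphaPrime_lt (hfi j) (hfpos j) (hf' j) (hg l) w
  have hA : ∀ l j w z, ‖star w ⬝ᵥ (toeplitz n (g l)).mulVec z‖ ^ 2 ≤
      (K₃ * δ * (star w ⬝ᵥ (toeplitz n (f j)).mulVec w).re) *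
        (K₃ * δ * (star z ⬝ᵥ (toeplitz n (f l)).mulVec z).re) := by
    intro l j w z
    have h0 : ∀ w : Fin n → ℂ, 0 ≤ ∫ x in freqDomain, |g l x| * ‖star (evec n x) ⬝ᵥ w‖ ^ 2 :=
      fun w => integral_nonneg fun x => by positivity
    exact (sq_norm_star_dotProduct_toeplitz_le (hgi l) (hgi l).abs (hgi l).abs
      (fun x _ => abs_nonneg _) (fun x _ => abs_nonneg _)
      (fun x _ => by rw [abs_mul_abs_self, sq]) w z).trans
      (mul_le_mul (hquad l j w) (hquad l l z) (h0 z) ((h0 w).trans (hquad l j w)))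
  have h1 := norm_trace_prod_sub_trace_prod_inv_le (A := fun l => toeplitz n (g l))
    (B := fun l => toeplitz n (f l)) (C := C) (mul_nonneg hK₃0 hδ0)
    (fun l => posDef_toeplitz (hfi l) (hfi' l) (hfpos l))
    (fun l => posSemidef_toeplitz_one_div_sub_inv (hfi l) (hfi' l) (hfpos l)) hτ hA
  have h2 : (List.ofFn fun l => toeplitz n (g l) * C l).prod =
      κ ^ p • (List.ofFn fun l : Fin p =>
        toeplitz n (g l) * toeplitz n (fun x => 1 / f l x)).prod := by
    have := List.smul_prod (List.ofFn fun l : Fin p =>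
        toeplitz n (g l) * toeplitz n (fun x => 1 / f l x)) κ
    rw [List.length_ofFn, List.map_ofFn] at this
    rw [this]
    congr 2
    ext1 l
    rw [hC]
    simp
  have h3 : ‖(List.ofFn fun l => toeplitz n (g l) * C l).prod.trace -
      ((n * (1 / (2 * Real.pi) * I) : ℝ) : ℂ)‖ ≤ K₂ * Δ₂ ^ p := by
    -- The `p` factors `(2π)⁻²` turn `(2π)^(2p-1)` into `1/(2π)`.
    have h4 : n * (1 / (2 * Real.pi) * I) = κ ^ p * (n * (2 * Real.pi) ^ (2 * p - 1) * I) := by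
      have h5 : (2 * Real.pi) ^ (2 * p) = (2 * Real.pi) ^ (2 * p - 1) * (2 * Real.pi) := by
        rw [← pow_succ]; congr 1
        have : 1 ≤ p := NeZero.one_le
        omega
      rw [hκ, inv_pow, ← pow_mul, h5]
      field_simp
    rw [h2, Matrix.trace_smul, h4, Complex.ofReal_mul, Complex.real_smul, ← mul_sub, norm_mul,
      Complex.norm_real, Real.norm_of_nonneg (by positivity)]
    exact (mul_le_of_le_one_left (norm_nonneg _) (pow_le_one₀ hκ0 hκ1)).trans htr
  -- Here `Δ ≥ 1` is needed, for `1 + K₁ * Δ ≤ (1 + K₁) * Δ`.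
  have h6 : p * (K₃ * δ * (1 + K₁ * Δ)) ^ p * (K₁ * Δ) ≤
      p * (K₃ * (1 + K₁)) ^ p * K₁ * Δ * (Δ * δ) ^ p := by
    calc p * (K₃ * δ * (1 + K₁ * Δ)) ^ p * (K₁ * Δ) ≤
        p * (K₃ * δ * ((1 + K₁) * Δ)) ^ p * (K₁ * Δ) := by
          gcongr
          nlinarith
      _ = _ := by
          rw [show K₃ * δ * ((1 + K₁) * Δ) = (K₃ * (1 + K₁)) * (Δ * δ) by ring, mul_pow]
          ring
  rw [norm_sub_rev] at h1
  have h7 := (norm_sub_le_norm_sub_add_norm_sub _ _ _).trans (add_le_add h1 h3)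
  refine h7.trans ?_
  set E := p * (K₃ * (1 + K₁)) ^ p * K₁ with hE
  have hE0 : 0 ≤ E := by positivity
  have h8 : errorConst p q (L ε) ε M = K₂ + E := rfl
  rw [h8]
  have h9 : 0 ≤ Δ₂ ^ p := by positivity
  have h10 : 0 ≤ (Δ * δ) ^ p := by positivity
  have h11 : K₂ * Δ₂ ^ p ≤ K₂ * Δ * Δ₂ ^ p := by
    gcongr
    exact le_mul_of_one_le_right hK₂0 hΔ1
  have h12 : 0 ≤ K₂ * Δ * (Δ * δ) ^ p := by positivity
  have h13 : 0 ≤ E * Δ * Δ₂ ^ p := by positivity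
  nlinarith

end
end ToeplitzTrace

/-! ### The theorem. -/

namespace ToeplitzTrace
open scoped ComplexOrder in
lemma isUnit_det_toeplitz {n : ℕ} {f : ℝ → ℝ} (hf : MeasureTheory.IntegrableOn f freqDomain)
    (hf' : MeasureTheory.IntegrableOn (fun x => 1 / f x) freqDomain)
    (hfpos : ∀ x ∈ freqDomain, 0 < f x) : IsUnit (toeplitz n f).det :=
  (Matrix.isUnit_iff_isUnit_det _).1 (posDef_toeplitz hf hf' hfpos).isUnit

lemma errorConst_nonneg {p q : ℕ} {l ε M : ℝ} (hl : 0 ≤ l) : 0 ≤ errorConst p q l ε M := by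
  have hC0 : (0 : ℝ) ≤ 2 * 3 ^ (M + 1) := by positivity
  have h1 := traceConst_nonneg (ε := ε) hC0 zero_le_one 1
  have h2 := traceConst_nonneg (ε := ε) hC0 zero_le_one (2 * p - 1)
  have h3 := compatConst_nonneg l M
  have h4 : 0 ≤ opConst q l ε M := opConst_nonneg hl
  unfold errorConst
  positivity

end ToeplitzTrace

open ToeplitzTrace in
theorem theorem3 (m p q : ℕ) (hm : 1 ≤ m) (hp : 1 ≤ p) (hq : 1 ≤ q)
    (L : ℝ → ℝ) (hL : ∀ ε : ℝ, 0 < ε → 0 < L ε) (η : ℝ) (hη₀ : 0 < η) (hη₁ : η < 1) :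
    ∃ K : ℝ → Exponents m q → ℝ,
      (∀ S : Set (Exponents m q), IsCompact S →
        ∃ ε₀ : ℝ, 0 < ε₀ ∧ ∀ ε : ℝ, 0 < ε → ε ≤ ε₀ → BddAbove (K ε '' S)) ∧
      ∀ (ε : ℝ), 0 < ε →
      ∀ (α αbar β : Fin m → Fin q → ℝ) (s₁ s₂ s₃ : Selection m q),
        Admissible p η α αbar β s₁ s₂ s₃ →
      ∀ (c cbar d : Fin m → Fin q → ℝ),
        (∀ i k, 0 < c i k) → (∀ i k, 0 < cbar i k) → (∀ i k, 0 < d i k) →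
      ∀ (f g : Fin p → ℝ → ℝ),
        (∀ l, ∀ x ∈ freqDomain, 0 < f l x) →
        (∀ l, InSumInter c α L (f l)) →
        (∀ l, InSumInter (fun (k : Fin q) (i : Fin m) => 1 / cbar i k)
          (fun (k : Fin q) (i : Fin m) => -αbar i k) L (fun x => 1 / f l x)) →
        (∀ l, InSumInter d β L (g l)) →
      ∀ (n : ℕ), 1 ≤ n →
        (∀ l, IsUnit (toeplitz n (f l)).det) ∧
        IntervalIntegrable (fun x => ∏ l, g l x / f l x) MeasureTheory.volume
          (-Real.pi) Real.pi ∧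
        ‖(1 / (n : ℂ)) *
              (List.ofFn fun l : Fin p => toeplitz n (g l) * (toeplitz n (f l))⁻¹).prod.trace
            - (((1 / (2 * Real.pi)) *
              ∫ x in (-Real.pi)..Real.pi, ∏ l, g l x / f l x : ℝ) : ℂ)‖
          ≤ K ε (α, αbar, β) / (n : ℝ) * max 1 (deltaSum s₃ c cbar α αbar ε n) *
            ((deltaSum s₂ d cbar β αbar ε n) ^ p +
              (max 1 (deltaSum s₃ c cbar α αbar ε n) *
                deltaOp s₁ d cbar αbar β η ε n) ^ p) := by
  have : NeZero m := ⟨by omega⟩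
  have : NeZero p := ⟨by omega⟩
  have : NeZero q := ⟨by omega⟩
  have hp0 : (0 : ℝ) < 2 * p + 1 := by positivity
  -- The internal exponent loss is shrunk so that `4 * (2 * p + 1) * e ε ≤ η`, while the losses `4 *
  -- e ε` and `4 * e ε / η` in the bounds remain at most `ε`.
  set e : ℝ → ℝ := fun ε => min 1 ε * (η / (4 * (2 * p + 1))) with he
  have hη' : 0 < η / (4 * (2 * p + 1)) := by positivity
  -- Rounding the norm of the exponents up to an integer leaves only finitely many values of `K` on
  -- a bounded set, so no continuity or monotonicity in `M` is needed.
  refine ⟨fun ε a => errorConst p q (L (e ε)) (e ε) (⌈‖a‖⌉₊ : ℝ), ?_, ?_⟩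
  · intro S hS
    refine ⟨1, one_pos, fun ε _ _ => ?_⟩
    obtain ⟨R, hR⟩ := hS.isBounded.exists_norm_le
    refine (((Finset.range (⌈R⌉₊ + 1)).finite_toSet.image
      fun k : ℕ => errorConst p q (L (e ε)) (e ε) (k : ℝ)).subset ?_).bddAbove
    rintro _ ⟨a, ha, rfl⟩
    exact ⟨⌈‖a‖⌉₊, by simpa [Nat.lt_succ_iff] using (hR a ha).trans (Nat.le_ceil R), rfl⟩
  · intro ε hε α αbar β s₁ s₂ s₃ hadm c cbar d hc hcb hd f g hfpos hf hf' hg n hn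
    have hmin : 0 < min 1 ε := lt_min one_pos hε
    have he0 : 0 < e ε := mul_pos hmin hη'
    have heη : 4 * (2 * p + 1) * e ε = min 1 ε * η := by rw [he]; field_simp
    have h4 : 4 * e ε ≤ min 1 ε * η := by
      rw [← heη]
      have : (0 : ℝ) ≤ p := Nat.cast_nonneg p
      nlinarith
    have h5 : 4 * e ε / η ≤ ε := by
      rw [div_le_iff₀ hη₀]
      exact h4.trans (mul_le_mul_of_nonneg_right (min_le_right _ _) hη₀.le)
    have h6 : 4 * e ε ≤ ε :=
      h4.trans ((mul_le_of_le_one_right hmin.le hη₁.le).trans (min_le_right _ _))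
    have hn0 : (0 : ℝ) < n := by exact_mod_cast hn
    set a : Exponents m q := (α, αbar, β) with ha
    have hceil := Nat.le_ceil ‖a‖
    have hentry : ∀ (b : Fin m → Fin q → ℝ) i k, |b i k| ≤ ‖b‖ := fun b i k =>
      (norm_le_pi_norm (b i) k).trans (norm_le_pi_norm b i)
    have hα : ∀ i k, |α i k| ≤ (⌈‖a‖⌉₊ : ℝ) := fun i k =>
      (hentry α i k).trans ((norm_fst_le a).trans hceil)
    have hαbar : ∀ i k, |αbar i k| ≤ (⌈‖a‖⌉₊ : ℝ) := fun i k =>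
      (hentry αbar i k).trans (((norm_fst_le a.2).trans (norm_snd_le a)).trans hceil)
    have hβ : ∀ i k, |β i k| ≤ (⌈‖a‖⌉₊ : ℝ) := fun i k =>
      (hentry β i k).trans (((norm_snd_le a.2).trans (norm_snd_le a)).trans hceil)
    obtain ⟨hint, hbound⟩ := norm_trace_prod_toeplitz_sub_le hn (hL _ he0) he0
      (heη.le.trans (mul_le_of_le_one_left hη₀.le (min_le_left _ _))) hη₁ hα hαbar hβ hadm hc hcb
      hd hfpos hf hf' hg
    have hdiv : (fun x => ∏ l, g l x / f l x) = fun x => ∏ l, g l x * (1 / f l x) := by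
      simp only [mul_one_div]
    refine ⟨fun l => ?_, ?_, ?_⟩
    · exact isUnit_det_toeplitz (hf l).integrableOn (hf' l).integrableOn (hfpos l)
    · rw [intervalIntegrable_iff_freqDomain, hdiv]
      exact hint
    · rw [intervalIntegral_eq_freqDomain, hdiv]
      set t := (List.ofFn fun l : Fin p => toeplitz n (g l) * (toeplitz n (f l))⁻¹).prod.trace
      set J := 1 / (2 * Real.pi) * ∫ x in freqDomain, ∏ l, g l x * (1 / f l x)
      have h7 : 1 / (n : ℂ) * t - (J : ℂ) = 1 / (n : ℂ) * (t - ((n * J : ℝ) : ℂ)) := by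
        have : (n : ℂ) ≠ 0 := by exact_mod_cast hn0.ne'
        rw [Complex.ofReal_mul (n : ℝ) J, Complex.ofReal_natCast, mul_sub,
          ← mul_assoc (1 / (n : ℂ)) (n : ℂ),
          one_div_mul_cancel this, one_mul]
      have hK0 : 0 ≤ errorConst p q (L (e ε)) (e ε) (⌈‖a‖⌉₊ : ℝ) :=
        errorConst_nonneg (hL _ he0).le
      have h8 := deltaSum_mono hn (s := s₂) (b := β) (αbar := αbar) hd hcb h6
      have h9 := max_le_max_left 1 (deltaSum_mono hn (s := s₃) (b := α) (αbar := αbar) hc hcb h6)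
      have h10 := deltaOp_mono (η := η) hn (s := s₁) (β := β) (αbar := αbar) hd hcb h5
      have h11 : 0 ≤ deltaSum s₂ d cbar β αbar (4 * e ε) n := deltaSum_nonneg hd hcb
      have h12 : 0 ≤ deltaOp s₁ d cbar αbar β η (4 * e ε / η) n := deltaOp_nonneg hd hcb
      rw [h7, norm_mul, norm_div, norm_one, Complex.norm_natCast, one_div_mul_eq_div]
      refine (div_le_div_of_nonneg_right (hbound.trans (b := _) ?_) hn0.le).trans_eq
        (show errorConst p q (L (e ε)) (e ε) ⌈‖a‖⌉₊ * max 1 (deltaSum s₃ c cbar α αbar ε n) *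
            (deltaSum s₂ d cbar β αbar ε n ^ p + (max 1 (deltaSum s₃ c cbar α αbar ε n) *
              deltaOp s₁ d cbar αbar β η ε n) ^ p) / n = _ by ring)
      gcongr
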